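/- Let $B:\mathbb{R}^2\to\mathbb{R}$ satisfy $B\in L^p_{\rm loc}(\mathbb{R}^2)$ for some $p>2$ and $|B(x)|=\mathcal{O}(|x|^{-\tau})$ as $|x|\to\infty$ for some $\tau>2$. Let $$\alpha=\frac1{2\pi}\int_{\mathbb{R}^2}B\,dx,\qquad h(x)=-\frac1{2\pi}\int_{\mathbb{R}^2}B(y)\log|x-y|\,dy,\qquad \mu_\alpha=\min_{m\in\mathbb{Z}}|m-\alpha| .$$ For $\rho>0$ let $g_+(\rho;r)=1$ if $r\le\rho$ and $g_+(\rho;r)=\rho^{-\alpha}r^{\alpha}$ if $r>\rho$, let $g_-=1/g_+$, and put $$k_\pm(\rho)=\inf_{x\in\mathbb{R}^2}\frac{e^{\mp h(x)}}{g_\pm(\rho;|x|)},\qquad K_\pm(\rho)=\sup_{x\in\mathbb{R}^2}\frac{e^{\mp h(x)}}{g_\pm(\rho;|x|)},\qquad \beta_\pm(B;\rho)=\Big(\frac{k_\pm(\rho)}{K_\pm(\rho)}\Big)^2,$$ $$\mathrm{w}_\pm(\rho;x)=\beta_\pm(B;\rho)\begin{cases}\dfrac{\mu_\alpha^2}{\rho^2+|x|^2}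 & \text{if }\alpha\notin\mathbb{Z},\\[2ex] \dfrac{|\alpha|}{4|\alpha|+\pi}\,\dfrac{1}{\rho^2+|x|^2\big(1+\log^2(|x|/\rho)\big)} & \text{if }\alpha\in\mathbb{Z}.\end{cases}$$ Let $A\in L^2_{\rm loc}(\mathbb{R}^2;\mathbb{R}^2)$ be a vector potential of $B$, i.e. $\partial_1A_2-\partial_2A_1=B$ in the sense of distributions. If $\alpha\neq0$, then, with $\sigma=\operatorname{sign}\alpha$, $$\int_{\mathbb{R}^2}|(i\nabla+A)u|^2\,dx\;\ge\;\frac12\int_{\mathbb{R}^2}\mathrm{w}_\sigma(\rho;x)\,|u|^2\,dx$$ for all complex-valued $u\in H^1(\mathbb{R}^2)$ and all $\rho>0$, where both sides are understood as integrals of non-negative functions with values in $[0,\infty]$. -/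

import Mathlib

open MeasureTheory Filter
open scoped ENNReal ContDiff

noncomputable section

namespace MagneticHardy

/-- The Euclidean plane. -/
abbrev Plane : Type := EuclideanSpace ℝ (Fin 2)

/-- The partial derivative `∂ⱼ f`. -/
def partialDeriv {F : Type*} [NormedAddCommGroup F] [NormedSpace ℝ F]
    (j : Fin 2) (f : Plane → F) (x : Plane) : F :=
  fderiv ℝ f x (EuclideanSpace.single j 1)

/-- `φ` is a (real-valued) test function: smooth with compact support. -/
def IsTestFunction (φ : Plane → ℝ) : Prop :=
  ContDiff ℝ ∞ φ ∧ HasCompactSupport φ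

/-- The local Lebesgue space `L^p_loc(ℝ²; F)`. -/
def MemLpLoc {F : Type*} [NormedAddCommGroup F] (f : Plane → F) (p : ℝ≥0∞) : Prop :=
  ∀ K : Set Plane, IsCompact K → MemLp f p (volume.restrict K)

/-- The hypothesis on the magnetic field: `B ∈ L^p_loc` for some `p > 2`, and
`|B(x)| = O(|x|^{-τ})` as `|x| → ∞` for some `τ > 2` (`B` is a class of functions modulo null sets,
so the bound is required almost everywhere). -/
structure IsAdmissibleField (B : Plane → ℝ) : Prop where
  memLpLoc : ∃ p : ℝ≥0∞, 2 < p ∧ MemLpLoc B p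
  decay : ∃ τ : ℝ, 2 < τ ∧ ∃ C R : ℝ, 0 < R ∧
    ∀ᵐ x : Plane, R ≤ ‖x‖ → |B x| ≤ C * ‖x‖ ^ (-τ)

/-- The normalized flux `α = (1 / 2π) ∫ B`. -/
def flux (B : Plane → ℝ) : ℝ := 1 / (2 * Real.pi) * ∫ x, B x

/-- `A` is a vector potential of `B`: `A ∈ L²_loc(ℝ²; ℝ²)` and `∂₁A₂ - ∂₂A₁ = B` in the sense of
distributions. -/
structure IsVectorPotential (A : Plane → Plane) (B : Plane → ℝ) : Prop where
  memLpLoc : MemLpLoc A 2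
  curl_eq : ∀ φ : Plane → ℝ, IsTestFunction φ →
    ∫ x, (A x 0 * partialDeriv 1 φ x - A x 1 * partialDeriv 0 φ x) = ∫ x, B x * φ x

/-- `u ∈ H¹(ℝ²; ℂ)` with weak gradient `G = (G 0, G 1)`. -/
structure IsH1WithGradient (u : Plane → ℂ) (G : Fin 2 → Plane → ℂ) : Prop where
  memLp : MemLp u 2 volume
  memLp_grad : ∀ j, MemLp (G j) 2 volume
  weak_grad : ∀ j, ∀ φ : Plane → ℝ, IsTestFunction φ →
    ∫ x, u x * ((partialDeriv j φ x : ℝ) : ℂ) = - ∫ x, G j x * (φ x : ℂ)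

/-- The magnetic Dirichlet integral `∫ |(i∇ + A)u|² dx ∈ [0, ∞]`, where `G` is the weak gradient
of `u`. -/
def magneticEnergy (A : Plane → Plane) (u : Plane → ℂ) (G : Fin 2 → Plane → ℂ) : ℝ≥0∞ :=
  ∫⁻ x, ENNReal.ofReal (∑ j : Fin 2, ‖Complex.I * G j x + (A x j : ℂ) * u x‖ ^ 2)

/-- The scalar potential `h(x) = -(1 / 2π) ∫ B(y) log|x - y| dy`. -/
def scalarPotential (B : Plane → ℝ) (x : Plane) : ℝ :=
  -(1 / (2 * Real.pi)) * ∫ y, B y * Real.log ‖x - y‖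

/-- `g_±(ρ; r)` for `σ = ±1`: equal to `1` for `r ≤ ρ` and to `(ρ^{-α} r^α)^{±1}` for `r > ρ`. -/
def comparison (B : Plane → ℝ) (σ : SignType) (ρ r : ℝ) : ℝ :=
  if r ≤ ρ then 1 else (ρ ^ (-flux B) * r ^ flux B) ^ (σ : ℤ)

/-- The quotient `e^{∓h(x)} / g_±(ρ; |x|)`. -/
def expRatio (B : Plane → ℝ) (σ : SignType) (ρ : ℝ) (x : Plane) : ℝ :=
  Real.exp (-(σ : ℝ) * scalarPotential B x) / comparison B σ ρ ‖x‖

/-- `k_±(ρ)`, the infimum of the quotient `e^{∓h} / g_±`. -/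
def lowerConst (B : Plane → ℝ) (σ : SignType) (ρ : ℝ) : ℝ := ⨅ x, expRatio B σ ρ x

/-- `K_±(ρ)`, the supremum of the quotient `e^{∓h} / g_±`. -/
def upperConst (B : Plane → ℝ) (σ : SignType) (ρ : ℝ) : ℝ := ⨆ x, expRatio B σ ρ x

/-- `β_±(B; ρ) = (k_±(ρ) / K_±(ρ))²`. -/
def beta (B : Plane → ℝ) (σ : SignType) (ρ : ℝ) : ℝ :=
  (lowerConst B σ ρ / upperConst B σ ρ) ^ 2

/-- The distance `μ_α = min_{m ∈ ℤ} |m - α|` from `α` to the integers. -/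
def distToInt (α : ℝ) : ℝ := ⨅ m : ℤ, |(m : ℝ) - α|

open Classical in
/-- The Hardy weight `w_±(ρ; x)` of the Pauli operator, with the logarithmic version for
integer flux. -/
def hardyWeight (B : Plane → ℝ) (σ : SignType) (ρ : ℝ) (x : Plane) : ℝ :=
  beta B σ ρ *
    if ∃ m : ℤ, (m : ℝ) = flux B then
      |flux B| / (4 * |flux B| + Real.pi) *
        (1 / (ρ ^ 2 + ‖x‖ ^ 2 * (1 + Real.log (‖x‖ / ρ) ^ 2)))
    else
      distToInt (flux B) ^ 2 / (ρ ^ 2 + ‖x‖ ^ 2)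

end MagneticHardy

end

open MeasureTheory Filter Topology
open scoped ENNReal ContDiff

noncomputable section

namespace MagneticHardy

/-! Let `s = -sign α`. If `p`, `q` are the components of `(i∇ + A)u`, then `|p + isq|² ≤ 2(|p|² +
|q|²)`. At the price of the factor `1/2` it therefore suffices to prove a Hardy inequality for the
first-order operator `i(∂₁ + is∂₂) + (A₁ + isA₂)`, a factor of the Pauli operator
(`lintegral_pauliOp_le`).

Since `curl A = B = -Δh`, the field `A - (∂₂h, -∂₁h)` is a gradient `∇χ`. The substitution `u =
exp(iχ + sh) v` turns the operator, up to a unimodular factor, into `exp(sh)(∂₁ + is∂₂)v`. By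
definition of `k` and `K`, `exp(sh)` lies between `k g` and `K g` with the radial function `g =
max(1, (r/ρ)^|α|)`. Replacing it by these bounds on the two sides costs exactly `β = (k/K)²`
(`lintegral_mollified`).

What remains is radial (`lintegral_radialWeight_le_dbar`). In polar coordinates `∂₁ + is∂₂` acts on
the `m`-th angular mode `c(r)` as `c' + (n/r)c` with `n = -sm`. For the weight `w = g²`, completing
the square gives the Hardy inequality with weight `W` as soon as some `Q` satisfies `rQ' ≤ 2nQ -
Q²/w - W w r²` (`riccati_interval`). Explicit choices exist on either side of `ρ`, and they match at
`ρ` with a jump of the right sign. The critical mode `n = |α|`, possible only for integer flux, is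
what forces the logarithm (`exists_riccati_inner`, `exists_riccati_outer`, `mode_inequality`).

The gauge transformation needs smooth data, whereas `A` is only `L²_loc`. For smooth `u`, `A` and
`h` are mollified with one kernel, which keeps the curl relation; the bounds on `exp(sh)` survive
because `log g` is Lipschitz, and Jensen's inequality with continuity of translations removes the
mollification (`lintegral_smooth_le`). For `u ∈ H¹` the product `A u` need not be in `L²`, so the
inequality is first proved for bounded truncations `F(χu)` (`lintegral_truncated_le`) and then
passed to the limit. -/

/-! ### Riccati inequalities in one dimension -/

/-- The pointwise Riccati inequality behind the weighted one-dimensional Hardy inequality. -/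
lemma riccati_pointwise {r n q q' w W : ℝ} (hr : 0 < r) (hw : 0 < w)
    (h : r * q' ≤ 2 * n * q - q ^ 2 / w - W * w * r ^ 2) (c d : ℂ) :
    W * w * r * ‖c‖ ^ 2 + (q' * ‖c‖ ^ 2 + q * (2 * inner ℝ c d)) ≤
      w * r * ‖d + ((n / r : ℝ) : ℂ) * c‖ ^ 2 := by
  set e : ℂ := d + ((n / r : ℝ) : ℂ) * c with he
  have hd : d = e - (n / r) • c := by
    rw [he, Complex.real_smul]; ring
  have hin : inner ℝ c d = inner ℝ c e - n / r * ‖c‖ ^ 2 := by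
    rw [hd, inner_sub_right, real_inner_smul_right, real_inner_self_eq_norm_sq]
  have hcs : q * inner ℝ c e ≤ |q| * (‖c‖ * ‖e‖) := by
    calc q * inner ℝ c e ≤ |q * inner ℝ c e| := le_abs_self _
      _ = |q| * |inner ℝ c e| := abs_mul _ _
      _ ≤ _ := by gcongr; exact abs_real_inner_le_norm c e
  -- Young's inequality weighted by `w r`; its remainder `q²/(wr)` is the quadratic term of the
  -- Riccati inequality.
  have hsq : 2 * (|q| * (‖c‖ * ‖e‖)) ≤ w * r * ‖e‖ ^ 2 + q ^ 2 / (w * r) * ‖c‖ ^ 2 := by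
    have hwr : 0 < w * r := by positivity
    have h1 : 0 ≤ (w * r * ‖e‖ - |q| * ‖c‖) ^ 2 / (w * r) := by positivity
    have h2 : (w * r * ‖e‖ - |q| * ‖c‖) ^ 2 / (w * r) =
        w * r * ‖e‖ ^ 2 + q ^ 2 / (w * r) * ‖c‖ ^ 2 - 2 * (|q| * (‖c‖ * ‖e‖)) := by
      rw [← sq_abs q]
      field_simp
      ring
    linarith
  have h3 : q' + W * w * r - 2 * n / r * q + q ^ 2 / (w * r) ≤ 0 := by
    have : q' + W * w * r - 2 * n / r * q + q ^ 2 / (w * r) =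
        (r * q' - (2 * n * q - q ^ 2 / w - W * w * r ^ 2)) / r := by
      field_simp
      ring
    rw [this]
    exact div_nonpos_of_nonpos_of_nonneg (by linarith) hr.le
  have h4 := mul_le_mul_of_nonneg_right h3 (sq_nonneg ‖c‖)
  rw [hin]
  have h5 : q * (2 * (inner ℝ c e - n / r * ‖c‖ ^ 2)) =
    2 * (q * inner ℝ c e) - 2 * n / r * q * ‖c‖ ^ 2 := by ring
  nlinarith

/-- The pointwise inequality contains the total derivative of `Q ‖c‖²`, so integrating it leaves
only boundary values. These are kept explicit, to be matched at `ρ` and discarded at `0` and at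
infinity. -/
lemma riccati_interval {x y n : ℝ} (hx : 0 < x) (hxy : x ≤ y) {c c' : ℝ → ℂ}
    (hc : ∀ r, HasDerivAt c (c' r) r) (hc' : Continuous c') {Q Q' w W : ℝ → ℝ}
    (hQ : ∀ r ∈ Set.Icc x y, HasDerivAt Q (Q' r) r) (hQ' : ContinuousOn Q' (Set.Icc x y))
    (hw : ∀ r ∈ Set.Icc x y, 0 < w r) (hwc : ContinuousOn w (Set.Icc x y))
    (hW : ContinuousOn W (Set.Icc x y))
    (h : ∀ r ∈ Set.Icc x y,
      r * Q' r ≤ 2 * n * Q r - Q r ^ 2 / w r - W r * w r * r ^ 2) :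
    (∫ r in x..y, W r * w r * r * ‖c r‖ ^ 2) + (Q y * ‖c y‖ ^ 2 - Q x * ‖c x‖ ^ 2) ≤
      ∫ r in x..y, w r * r * ‖c' r + ((n / r : ℝ) : ℂ) * c r‖ ^ 2 := by
  have hcc : Continuous c := continuous_iff_continuousAt.2 fun r => (hc r).continuousAt
  have hu : Set.uIcc x y = Set.Icc x y := Set.uIcc_of_le hxy
  have hQc : ContinuousOn Q (Set.Icc x y) := fun r hr => (hQ r hr).continuousAt.continuousWithinAt
  have i1 : IntervalIntegrable (fun r => W r * w r * r * ‖c r‖ ^ 2) volume x y := by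
    apply ContinuousOn.intervalIntegrable
    rw [hu]; fun_prop
  have i2 : IntervalIntegrable
      (fun r => Q' r * ‖c r‖ ^ 2 + Q r * (2 * inner ℝ (c r) (c' r))) volume x y := by
    apply ContinuousOn.intervalIntegrable
    rw [hu]; fun_prop
  have i3 : IntervalIntegrable
      (fun r => w r * r * ‖c' r + ((n / r : ℝ) : ℂ) * c r‖ ^ 2) volume x y := by
    apply ContinuousOn.intervalIntegrable
    rw [hu]
    have : ContinuousOn (fun r : ℝ => n / r) (Set.Icc x y) :=
      continuousOn_const.div continuousOn_id fun r hr => (hx.trans_le hr.1).ne'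
    have h2 : ContinuousOn (fun r : ℝ => ((n / r : ℝ) : ℂ)) (Set.Icc x y) :=
      Complex.continuous_ofReal.comp_continuousOn this
    fun_prop
  have hftc := intervalIntegral.integral_eq_sub_of_hasDerivAt
    (f := fun r => Q r * ‖c r‖ ^ 2)
    (fun r hr => by
      rw [hu] at hr
      exact (hQ r hr).mul (hc r).norm_sq) i2
  rw [← hftc, ← intervalIntegral.integral_add i1 i2]
  refine intervalIntegral.integral_mono_on hxy (i1.add i2) i3 fun r hr => ?_
  exact riccati_pointwise (hx.trans_le hr.1) (hw r hr) (h r hr) (c r) (c' r)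

/-! ### The radial comparison function and the Hardy weight -/

/-- The radial comparison function `max(1, (r/ρ)^a)`. -/
def growth (a ρ r : ℝ) : ℝ := if r ≤ ρ then 1 else (r / ρ) ^ a

open Classical in
/-- The radial Hardy weight without the factor `β`. -/
def radialWeight (α ρ r : ℝ) : ℝ :=
  if ∃ m : ℤ, (m : ℝ) = α then
    |α| / (4 * |α| + Real.pi) * (1 / (ρ ^ 2 + r ^ 2 * (1 + Real.log (r / ρ) ^ 2)))
  else distToInt α ^ 2 / (ρ ^ 2 + r ^ 2)

lemma growth_pos (a : ℝ) {ρ : ℝ} (hρ : 0 < ρ) (r : ℝ) : 0 < growth a ρ r := by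
  unfold growth
  split_ifs with h
  · exact one_pos
  · have : 0 < r := hρ.trans (not_le.1 h)
    positivity

lemma growth_eq_max {a ρ : ℝ} (hρ : 0 < ρ) {r : ℝ} :
    growth a ρ r = (max r ρ / ρ) ^ a := by
  unfold growth
  split_ifs with h
  · rw [max_eq_right h, div_self hρ.ne', Real.one_rpow]
  · rw [max_eq_left (not_le.1 h).le]

lemma continuous_growth {a ρ : ℝ} (ha : 0 ≤ a) (hρ : 0 < ρ) : Continuous (growth a ρ) := by
  have : growth a ρ = fun r => (max r ρ / ρ) ^ a := funext fun r => growth_eq_max hρ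
  rw [this]
  exact Continuous.rpow_const (by fun_prop) fun x => Or.inr ha

lemma radialWeight_nonneg {α ρ : ℝ} (hρ : 0 < ρ) (r : ℝ) : 0 ≤ radialWeight α ρ r := by
  have := Real.pi_pos
  unfold radialWeight
  split_ifs <;> positivity

lemma continuousOn_radialWeight {α ρ : ℝ} (hρ : 0 < ρ) :
    ContinuousOn (radialWeight α ρ) (Set.Ioi 0) := by
  unfold radialWeight
  split_ifs
  · have : ContinuousOn (fun r => Real.log (r / ρ)) (Set.Ioi 0) :=
      (continuousOn_id.div_const ρ).log fun r hr => (div_pos hr hρ).ne'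
    refine continuousOn_const.mul (ContinuousOn.div continuousOn_const (by fun_prop) ?_)
    intro r hr
    positivity
  · refine ContinuousOn.div continuousOn_const (by fun_prop) ?_
    intro r hr
    positivity

lemma distToInt_le (α : ℝ) (m : ℤ) : distToInt α ≤ |(m : ℝ) - α| :=
  ciInf_le ⟨0, by rintro _ ⟨m, rfl⟩; exact abs_nonneg _⟩ m

lemma distToInt_nonneg (α : ℝ) : 0 ≤ distToInt α := Real.iInf_nonneg fun _ => abs_nonneg _

lemma distToInt_le_one (α : ℝ) : distToInt α ≤ 1 := by
  refine (distToInt_le α ⌊α⌋).trans ?_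
  rw [abs_le]
  constructor <;> linarith [Int.floor_le α, Int.lt_floor_add_one α]

/-- These crude bounds serve the region `r ≤ ρ`: the first beats `n² ≥ 1` for the nonzero modes, the
second controls the zero mode. -/
lemma radialWeight_mul_sq_le_of_forall {α ρ r : ℝ} (hρ : 0 < ρ) (hr : 0 < r) :
    radialWeight α ρ r * r ^ 2 ≤ 1 ∧ radialWeight α ρ r * ρ ^ 2 ≤ min 1 |α| := by
  have hπ := Real.pi_pos
  unfold radialWeight
  split_ifs with h
  · obtain ⟨m, rfl⟩ := h
    set a : ℝ := |(m : ℝ)| with ha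
    have ha0 : 0 ≤ a := abs_nonneg _
    have h1 : a / (4 * a + Real.pi) ≤ 1 := by
      rw [div_le_one (by positivity)]; linarith
    have h2 : a / (4 * a + Real.pi) ≤ a := by
      apply div_le_self ha0; linarith [Real.pi_gt_three]
    have h3 : 1 / (ρ ^ 2 + r ^ 2 * (1 + Real.log (r / ρ) ^ 2)) * r ^ 2 ≤ 1 := by
      rw [one_div_mul_eq_div, div_le_one (by positivity)]
      nlinarith [sq_nonneg (r * Real.log (r / ρ)), sq_nonneg ρ]
    have h4 : 1 / (ρ ^ 2 + r ^ 2 * (1 + Real.log (r / ρ) ^ 2)) * ρ ^ 2 ≤ 1 := by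
      rw [one_div_mul_eq_div, div_le_one (by positivity)]
      have : 0 ≤ r ^ 2 * (1 + Real.log (r / ρ) ^ 2) := by positivity
      linarith
    have h0 : 0 ≤ a / (4 * a + Real.pi) := by positivity
    refine ⟨?_, ?_⟩
    · rw [mul_assoc]
      exact mul_le_one₀ h1 (by positivity) h3
    · rw [mul_assoc]
      exact (mul_le_of_le_one_right h0 h4).trans (le_min h1 h2)
  · have h0 := distToInt_nonneg α
    have h1 := distToInt_le_one α
    have h2 : distToInt α ≤ |α| := by simpa using distToInt_le α 0
    have h3 : distToInt α ^ 2 ≤ distToInt α := by nlinarith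
    refine ⟨?_, ?_⟩
    · rw [div_mul_eq_mul_div, div_le_one (by positivity)]
      nlinarith [sq_nonneg ρ, sq_nonneg r]
    · refine le_trans ?_ (h3.trans (le_min h1 h2))
      rw [div_mul_eq_mul_div, div_le_iff₀ (by positivity)]
      nlinarith [sq_nonneg (distToInt α * r)]

/-- For non-integer flux this is the definition of the distance to the integers, up to a sign of
`n`. For integer flux, distinct integers differ by at least `1`, so the crude bound is enough. -/
lemma radialWeight_mul_sq_le_sub_sq {α ρ r : ℝ} (hρ : 0 < ρ) (hr : 0 < r) {n : ℤ}
    (hn : (n : ℝ) ≠ |α|) : radialWeight α ρ r * r ^ 2 ≤ (n - |α|) ^ 2 := by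
  by_cases h : ∃ m : ℤ, (m : ℝ) = α
  · refine (radialWeight_mul_sq_le_of_forall hρ hr).1.trans ?_
    obtain ⟨m, rfl⟩ := h
    rw [← Int.cast_abs] at hn ⊢
    have h1 : n - |m| ≠ 0 := sub_ne_zero.2 fun h => hn (by rw [h])
    have h2 : (1 : ℤ) ≤ (n - |m|) ^ 2 := by
      have := pow_pos (abs_pos.2 h1) 2
      rw [sq_abs] at this
      omega
    exact_mod_cast h2
  · have h2 : distToInt α ≤ abs (n - |α|) := by
      rcases abs_cases α with h | h
      · rw [h.1]; exact distToInt_le α n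
      · have := distToInt_le α (-n)
        rw [h.1]
        rwa [← abs_neg, show -(((-n : ℤ) : ℝ) - α) = n - -α by push_cast; ring] at this
    rw [radialWeight, if_neg h, div_mul_eq_mul_div, div_le_iff₀ (by positivity)]
    have h3 : distToInt α ^ 2 ≤ (n - |α|) ^ 2 := by
      rw [← sq_abs (n - |α|)]
      exact pow_le_pow_left₀ (distToInt_nonneg α) h2 2
    nlinarith [sq_nonneg ρ, sq_nonneg r, sq_nonneg (n - |α|),
      mul_le_mul_of_nonneg_right h3 (sq_nonneg r), mul_nonneg (sq_nonneg (n - |α|)) (sq_nonneg ρ)]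

/-- This is the bound for the critical mode `n = |α|`. The shift `1/(2|α|)` of the logarithm is
dictated by matching at `r = ρ`, and it is responsible for the shape of the constant `|α|/(4|α| +
π)`. -/
lemma radialWeight_mul_sq_le_log {α ρ r : ℝ} (hρ : 0 < ρ) (hr : ρ ≤ r) (hα : α ≠ 0)
    (h : ∃ m : ℤ, (m : ℝ) = α) :
    radialWeight α ρ r * r ^ 2 ≤ (1 / (2 * (Real.log (r / ρ) + 1 / (2 * |α|)))) ^ 2 := by
  have hπ := Real.pi_gt_three
  have hr0 : 0 < r := hρ.trans_le hr
  rw [radialWeight, if_pos h]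
  obtain ⟨m, rfl⟩ := h
  set a : ℝ := |(m : ℝ)| with ha
  have ha1 : 1 ≤ a := by
    rw [ha, ← Int.cast_abs]
    have : (1 : ℤ) ≤ |m| := Int.one_le_abs (by exact_mod_cast hα)
    exact_mod_cast this
  set t := Real.log (r / ρ) with ht
  have ht0 : 0 ≤ t := Real.log_nonneg (by rwa [one_le_div hρ])
  have hs : 0 < t + 1 / (2 * a) := by positivity
  have h1 : a / (4 * a + Real.pi) * (1 / (ρ ^ 2 + r ^ 2 * (1 + t ^ 2))) * r ^ 2 ≤
      a / (4 * a + Real.pi) * (1 / (1 + t ^ 2)) := by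
    rw [mul_assoc]
    gcongr
    rw [one_div_mul_eq_div, div_le_div_iff₀ (by positivity) (by positivity)]
    nlinarith [sq_nonneg ρ]
  refine h1.trans ?_
  rw [div_mul_div_comm, mul_one, div_pow, one_pow, div_le_div_iff₀ (by positivity) (by positivity)]
  -- Cauchy–Schwarz for the vectors `(t, 1)` and `(1, 1/(2a))`.
  have h2 : (t + 1 / (2 * a)) ^ 2 ≤ (1 + t ^ 2) * (1 + (1 / (2 * a)) ^ 2) := by
    nlinarith [sq_nonneg (1 - t * (1 / (2 * a)))]
  -- The left side equals `4a + 1/a`, and `1/a ≤ 1 < π` because `a` is a nonzero integer in absolute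
  -- value.
  have h3 : a * (4 * (1 + (1 / (2 * a)) ^ 2)) ≤ 4 * a + Real.pi := by
    have : a * (4 * (1 + (1 / (2 * a)) ^ 2)) = 4 * a + 1 / a := by field_simp; ring
    rw [this]
    have : 1 / a ≤ 1 := by rw [div_le_one (by linarith)]; exact ha1
    linarith
  calc a * (2 * (t + 1 / (2 * a))) ^ 2 = a * 4 * (t + 1 / (2 * a)) ^ 2 := by ring
    _ ≤ a * 4 * ((1 + t ^ 2) * (1 + (1 / (2 * a)) ^ 2)) := by gcongr
    _ = (a * (4 * (1 + (1 / (2 * a)) ^ 2))) * (1 + t ^ 2) := by ring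
    _ ≤ (4 * a + Real.pi) * (1 + t ^ 2) := by gcongr
    _ = _ := by ring

/-! ### Explicit solutions of the Riccati inequality -/

/-- Here `g = 1`. For `n ≠ 0` the constant `Q = n` maximizes `2nQ - Q²`, and the inequality reduces
to `W r² ≤ 1 ≤ n²`. For `n = 0` the mode need not vanish at the origin, so `Q(0) = 0` is required
and a negative multiple of `r²` is used. -/
lemma exists_riccati_inner {α ρ : ℝ} (hρ : 0 < ρ) (n : ℤ) :
    ∃ Q Q' : ℝ → ℝ, (∀ r, HasDerivAt Q (Q' r) r) ∧ Continuous Q' ∧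
      (∀ r, 0 < r → r ≤ ρ → r * Q' r ≤
        2 * n * Q r - Q r ^ 2 - radialWeight α ρ r * r ^ 2) ∧
      (n = 0 → Q 0 = 0) ∧ n - |α| ≤ Q ρ ∧ (n ≠ 0 → Q ρ = n) := by
  by_cases hn : n = 0
  · subst hn
    set κ := min 1 |α| with hκ
    have hκ0 : 0 ≤ κ := le_min zero_le_one (abs_nonneg _)
    -- With `x = r²/ρ² ≤ 1` the claim reads `-2κx ≤ -(κx)² - W r²`, which follows from `W r² ≤ κx`
    -- and `κx ≤ 1`. Taking `κ ≤ |α|` gives `Q(ρ) = -κ ≥ -|α|`.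
    refine ⟨fun r => -κ / ρ ^ 2 * r ^ 2, fun r => -κ / ρ ^ 2 * (2 * r), fun r => ?_, by fun_prop,
      fun r hr hrρ => ?_, fun _ => by simp, ?_, fun h => absurd rfl h⟩
    · simpa using (hasDerivAt_pow 2 r).const_mul (-κ / ρ ^ 2)
    · have h1 := (radialWeight_mul_sq_le_of_forall (α := α) hρ hr).2
      rw [← hκ] at h1
      set x := r ^ 2 / ρ ^ 2 with hx
      have hx0 : 0 ≤ x := by positivity
      have hx1 : x ≤ 1 := by
        rw [hx, div_le_one (by positivity)]
        exact pow_le_pow_left₀ hr.le hrρ 2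
      have h2 : radialWeight α ρ r * r ^ 2 ≤ κ * x := by
        calc radialWeight α ρ r * r ^ 2 = radialWeight α ρ r * ρ ^ 2 * x := by
              rw [hx]; field_simp
          _ ≤ κ * x := by gcongr
      have e1 : -κ / ρ ^ 2 * r ^ 2 = -(κ * x) := by rw [hx]; ring
      have e2 : r * (-κ / ρ ^ 2 * (2 * r)) = -2 * (κ * x) := by rw [hx]; ring
      simp only [e1, e2]
      have h3 : κ * x ≤ 1 := mul_le_one₀ (min_le_left _ _) hx0 hx1
      have h4 : 0 ≤ κ * x := by positivity
      push_cast
      nlinarith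
    · have : -κ / ρ ^ 2 * ρ ^ 2 = -κ := by field_simp
      simp only [this]
      have := min_le_right 1 |α|
      push_cast
      linarith
  · refine ⟨fun _ => n, fun _ => 0, fun r => hasDerivAt_const _ _, continuous_const,
      fun r hr hrρ => ?_, fun h => absurd h hn, by linarith [abs_nonneg α], fun _ => rfl⟩
    have h1 := (radialWeight_mul_sq_le_of_forall (α := α) hρ hr).1
    have h2 : (1 : ℤ) ≤ n ^ 2 := by
      have := pow_pos (abs_pos.2 hn) 2
      rw [sq_abs] at this
      omega
    have h3 : (1 : ℝ) ≤ (n : ℝ) ^ 2 := by exact_mod_cast h2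
    nlinarith

/-- Writing `Q = w q` with `w = (r/ρ)^(2|α|)` absorbs the weight and shifts `n` to `n - |α|`. Off
the critical mode the constant `q = n - |α|` is optimal. On it the linear term disappears, and a
multiple of the reciprocal of a logarithm takes over. -/
lemma exists_riccati_outer {α ρ : ℝ} (hρ : 0 < ρ) (hα : α ≠ 0) (n : ℤ) :
    ∃ q q' : ℝ → ℝ, (∀ r ∈ Set.Ici ρ, HasDerivAt q (q' r) r) ∧ ContinuousOn q' (Set.Ici ρ) ∧
      (∀ r ∈ Set.Ici ρ, r * q' r ≤
        2 * (n - |α|) * q r - q r ^ 2 - radialWeight α ρ r * r ^ 2) ∧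
      (q ρ = n - |α| ∨ n ≠ 0 ∧ q ρ = n) := by
  by_cases hn : (n : ℝ) = |α|
  · have ha : 0 < |α| := abs_pos.2 hα
    set s := 1 / (2 * |α|) with hs
    have hs0 : 0 < s := by positivity
    have hint : ∃ m : ℤ, (m : ℝ) = α := by
      rcases abs_cases α with h | h
      · exact ⟨n, by rw [hn, h.1]⟩
      · exact ⟨-n, by push_cast; rw [hn, h.1, neg_neg]⟩
    have hpos : ∀ r ∈ Set.Ici ρ, 0 < r := fun r hr => hρ.trans_le hr
    have hlog : ∀ r ∈ Set.Ici ρ, 0 < Real.log (r / ρ) + s := fun r hr => by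
      have : 0 ≤ Real.log (r / ρ) := Real.log_nonneg (by rw [one_le_div hρ]; exact hr)
      positivity
    -- This `q` satisfies `r q' = -2q²`: one `q²` pays for the quadratic term and the other for `W
    -- r²`. The shift `s = 1/(2|α|)` makes `q(ρ) = |α| = n`, the inner value.
    refine ⟨fun r => 1 / (2 * (Real.log (r / ρ) + s)),
      fun r => -(2 * (1 / r)) / (2 * (Real.log (r / ρ) + s)) ^ 2, fun r hr => ?_, ?_,
      fun r hr => ?_, Or.inr ⟨?_, ?_⟩⟩
    · have h1 : HasDerivAt (fun r => Real.log (r / ρ)) (1 / r) r := by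
        have := ((hasDerivAt_id' r).div_const ρ).log (div_pos (hpos r hr) hρ).ne'
        convert this using 1
        have := (hpos r hr).ne'
        field_simp
      have h2 := ((h1.add_const s).const_mul 2).fun_inv (by have := hlog r hr; positivity)
      simp only [one_div] at h2 ⊢
      exact h2
    · have h1 : ContinuousOn (fun r => Real.log (r / ρ)) (Set.Ici ρ) :=
        (continuousOn_id.div_const ρ).log fun r hr => (div_pos (hpos r hr) hρ).ne'
      have h2 : ContinuousOn (fun r : ℝ => 1 / r) (Set.Ici ρ) :=
        continuousOn_const.div continuousOn_id fun r hr => (hpos r hr).ne'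
      refine ContinuousOn.div (by fun_prop) (by fun_prop) fun r hr => ?_
      have := hlog r hr
      positivity
    · have h1 := radialWeight_mul_sq_le_log hρ hr hα hint
      rw [← hs] at h1
      have h2 := hlog r hr
      have h3 := hpos r hr
      rw [hn, sub_self]
      have e : r * (-(2 * (1 / r)) / (2 * (Real.log (r / ρ) + s)) ^ 2) =
          -2 * (1 / (2 * (Real.log (r / ρ) + s))) ^ 2 := by field_simp
      simp only [e]
      linarith
    · rintro rfl
      rw [Int.cast_zero] at hn
      exact ha.ne hn
    · simp only [hn, div_self hρ.ne', Real.log_one, zero_add, hs]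
      field_simp
  · refine ⟨fun _ => n - |α|, fun _ => 0, fun r _ => hasDerivAt_const _ _, continuousOn_const,
      fun r hr => ?_, Or.inl rfl⟩
    have := radialWeight_mul_sq_le_sub_sq (r := r) hρ (hρ.trans_le hr) hn
    nlinarith

/-! ### The Hardy inequality for a single angular mode -/

/-- The inner and outer estimates are added. The boundary term at `ρ` has a favourable sign, the one
at `R` is zero, and the one at `ε` is the error `b`, which tends to zero because `Q(0) = 0` or `c(0)
= 0`. -/
lemma mode_inequality_truncated {α ρ : ℝ} (hρ : 0 < ρ) (hα : α ≠ 0) (n : ℤ)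
    {c c' : ℝ → ℂ} (hc : ∀ r, HasDerivAt c (c' r) r) (hc' : Continuous c')
    (h0 : n ≠ 0 → c 0 = 0) {R : ℝ} (hR : ∀ r, R ≤ r → c r = 0) (hRρ : ρ ≤ R) :
    ∃ b : ℝ → ℝ, Tendsto b (𝓝[>] 0) (𝓝 0) ∧ ∀ ε, 0 < ε → ε < ρ →
      ∫ r in ε..R, radialWeight α ρ r * growth |α| ρ r ^ 2 * r * ‖c r‖ ^ 2 ≤
      (∫ r in ε..R, growth |α| ρ r ^ 2 * r * ‖c' r + ((n / r : ℝ) : ℂ) * c r‖ ^ 2) + b ε := by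
  obtain ⟨P, P', hP, hP', hPr, hP0, hPa, hPn⟩ := exists_riccati_inner (α := α) hρ n
  obtain ⟨q, q', hq, hq', hqr, hqρ⟩ := exists_riccati_outer hρ hα n
  have hcc : Continuous c := continuous_iff_continuousAt.2 fun r => (hc r).continuousAt
  have hPc : Continuous P := continuous_iff_continuousAt.2 fun r => (hP r).continuousAt
  refine ⟨fun ε => P ε * ‖c ε‖ ^ 2, ?_, fun ε hε hερ => ?_⟩
  · have : Tendsto (fun ε => P ε * ‖c ε‖ ^ 2) (𝓝 0) (𝓝 (P 0 * ‖c 0‖ ^ 2)) :=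
      Continuous.tendsto (by fun_prop) 0
    have h1 : P 0 * ‖c 0‖ ^ 2 = 0 := by
      by_cases hn : n = 0
      · rw [hP0 hn, zero_mul]
      · rw [h0 hn]; simp
    rw [h1] at this
    exact this.mono_left nhdsWithin_le_nhds
  set a := |α| with ha
  set g := growth a ρ with hg
  set W := radialWeight α ρ with hW
  have hgc : Continuous g := continuous_growth (abs_nonneg α) hρ
  have hWc := continuousOn_radialWeight (α := α) hρ
  have hg1 : ∀ r ∈ Set.Icc ε ρ, g r = 1 := fun r hr => by rw [hg, growth, if_pos hr.2]
  have hg2 : ∀ r ∈ Set.Icc ρ R, g r ^ 2 = (r / ρ) ^ (2 * a) := fun r hr => by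
    have hr0 : 0 < r := hρ.trans_le hr.1
    rw [hg, growth_eq_max hρ, max_eq_left hr.1, ← Real.rpow_natCast, ← Real.rpow_mul (by positivity)]
    congr 1
    push_cast
    ring
  have hin := riccati_interval (n := n) hε hερ.le hc hc' (Q := P) (Q' := P') (w := fun r => g r ^ 2)
    (W := W) (fun r _ => hP r) hP'.continuousOn (fun r _ => by have := growth_pos a hρ r; positivity)
    (by fun_prop) (hWc.mono fun r hr => hε.trans_le hr.1) (fun r hr => by
      have := hPr r (hε.trans_le hr.1) hr.2
      simpa [hg1 r hr] using this)
  have hwd : ∀ r ∈ Set.Icc ρ R, HasDerivAt (fun r => (r / ρ) ^ (2 * a))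
      (2 * a / r * (r / ρ) ^ (2 * a)) r := fun r hr => by
    have hr0 : 0 < r := hρ.trans_le hr.1
    have := ((hasDerivAt_id' r).div_const ρ).rpow_const (p := 2 * a)
      (Or.inl (div_pos hr0 hρ).ne')
    convert this using 1
    rw [Real.rpow_sub_one (div_pos hr0 hρ).ne']
    field_simp
  have hsub : Set.Icc ρ R ⊆ Set.Ici ρ := fun r hr => hr.1
  have hsub0 : Set.Icc ρ R ⊆ Set.Ioi 0 := fun r hr => hρ.trans_le hr.1
  have hqc : ContinuousOn q (Set.Icc ρ R) := fun r hr =>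
    (hq r (hsub hr)).continuousAt.continuousWithinAt
  have hwc : ContinuousOn (fun r => (r / ρ) ^ (2 * a)) (Set.Icc ρ R) := fun r hr =>
    (hwd r hr).continuousAt.continuousWithinAt
  have hout := riccati_interval (n := n) hρ hRρ hc hc' (w := fun r => g r ^ 2) (W := W)
    (Q := fun r => (r / ρ) ^ (2 * a) * q r)
    (Q' := fun r => 2 * a / r * (r / ρ) ^ (2 * a) * q r + (r / ρ) ^ (2 * a) * q' r)
    (fun r hr => (hwd r hr).mul (hq r (hsub hr)))
    (by
      have h1 : ContinuousOn (fun r : ℝ => 2 * a / r) (Set.Icc ρ R) :=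
        continuousOn_const.div continuousOn_id fun r hr => (hsub0 hr).ne'
      have h2 := hq'.mono hsub
      fun_prop)
    (fun r _ => by have := growth_pos a hρ r; positivity)
    (by fun_prop) (hWc.mono hsub0) (fun r hr => by
      have h1 := hqr r (hsub hr)
      have hr0 : 0 < r := hsub0 hr
      have hw : 0 < (r / ρ) ^ (2 * a) := by positivity
      simp only [hg2 r hr]
      set w := (r / ρ) ^ (2 * a) with hw'
      have e1 : r * (2 * a / r * w * q r + w * q' r) = w * (r * q' r + 2 * a * q r) := by
        field_simp; ring
      have e2 : 2 * n * (w * q r) - (w * q r) ^ 2 / w - W r * w * r ^ 2 =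
          w * (2 * n * q r - q r ^ 2 - W r * r ^ 2) := by
        field_simp
      rw [e1, e2]
      exact mul_le_mul_of_nonneg_left (by linarith) hw.le)
  -- At `ρ` the weight is `1`, so the two boundary terms combine to `(P ρ - q ρ)‖c ρ‖²`, which may
  -- be dropped.
  have hjump : q ρ ≤ P ρ := by
    rcases hqρ with h | ⟨h1, h2⟩
    · rw [h]; exact hPa
    · rw [h2, hPn h1]
  have hjump2 : q ρ * ‖c ρ‖ ^ 2 ≤ P ρ * ‖c ρ‖ ^ 2 := by gcongr
  simp only [div_self hρ.ne', Real.one_rpow, one_mul, hR R le_rfl, norm_zero, ne_eq,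
    OfNat.ofNat_ne_zero, not_false_eq_true, zero_pow, mul_zero] at hout
  have hII : ∀ {f : ℝ → ℝ}, ContinuousOn f (Set.Ioi 0) → ∀ {x y}, 0 < x → x ≤ y →
      IntervalIntegrable f volume x y := fun hf x y hx hxy => by
    apply ContinuousOn.intervalIntegrable
    rw [Set.uIcc_of_le hxy]
    exact hf.mono fun r hr => hx.trans_le hr.1
  have c1 : ContinuousOn (fun r => W r * g r ^ 2 * r * ‖c r‖ ^ 2) (Set.Ioi 0) := by fun_prop
  have c2 : ContinuousOn (fun r => g r ^ 2 * r * ‖c' r + ((n / r : ℝ) : ℂ) * c r‖ ^ 2)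
      (Set.Ioi 0) := by
    have : ContinuousOn (fun r : ℝ => n / r) (Set.Ioi 0) :=
      continuousOn_const.div continuousOn_id fun r hr => ne_of_gt hr
    have h2 : ContinuousOn (fun r : ℝ => ((n / r : ℝ) : ℂ)) (Set.Ioi 0) :=
      Complex.continuous_ofReal.comp_continuousOn this
    fun_prop
  rw [← intervalIntegral.integral_add_adjacent_intervals (hII c1 hε hερ.le) (hII c1 hρ hRρ),
    ← intervalIntegral.integral_add_adjacent_intervals (hII c2 hε hερ.le) (hII c2 hρ hRρ)]
  linarith

lemma mode_inequality {α ρ : ℝ} (hρ : 0 < ρ) (hα : α ≠ 0) (n : ℤ)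
    {c c' : ℝ → ℂ} (hc : ∀ r, HasDerivAt c (c' r) r) (hc' : Continuous c')
    (h0 : n ≠ 0 → c 0 = 0) {R : ℝ} (hR : ∀ r, R ≤ r → c r = 0) :
    ∫⁻ r in Set.Ioi 0, ENNReal.ofReal
        (radialWeight α ρ r * growth |α| ρ r ^ 2 * r * ‖c r‖ ^ 2) ≤
      ∫⁻ r in Set.Ioi 0, ENNReal.ofReal
        (growth |α| ρ r ^ 2 * r * ‖c' r + ((n / r : ℝ) : ℂ) * c r‖ ^ 2) := by
  set S := max ρ R
  have hS : 0 < S := hρ.trans_le (le_max_left _ _)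
  have hcS : ∀ r, S ≤ r → c r = 0 := fun r hr => hR r ((le_max_right _ _).trans hr)
  obtain ⟨b, hb, hε⟩ := mode_inequality_truncated hρ hα n hc hc' h0 hcS (le_max_left _ _)
  have hcc : Continuous c := continuous_iff_continuousAt.2 fun r => (hc r).continuousAt
  have hgc : Continuous (growth |α| ρ) := continuous_growth (abs_nonneg α) hρ
  have hWc := continuousOn_radialWeight (α := α) hρ
  set f := fun r => radialWeight α ρ r * growth |α| ρ r ^ 2 * r * ‖c r‖ ^ 2
  set F := fun r => growth |α| ρ r ^ 2 * r * ‖c' r + ((n / r : ℝ) : ℂ) * c r‖ ^ 2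
  have cf : ContinuousOn f (Set.Ioi 0) := by fun_prop
  have cF : ContinuousOn F (Set.Ioi 0) := by
    have : ContinuousOn (fun r : ℝ => n / r) (Set.Ioi 0) :=
      continuousOn_const.div continuousOn_id fun r hr => ne_of_gt hr
    have h2 : ContinuousOn (fun r : ℝ => ((n / r : ℝ) : ℂ)) (Set.Ioi 0) :=
      Complex.continuous_ofReal.comp_continuousOn this
    fun_prop
  have pf : ∀ r, 0 < r → 0 ≤ f r := fun r hr => by
    have := radialWeight_nonneg (α := α) hρ r
    positivity
  have pF : ∀ r, 0 < r → 0 ≤ F r := fun r hr => by positivity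
  have key : ∀ {h : ℝ → ℝ}, ContinuousOn h (Set.Ioi 0) → (∀ r, 0 < r → 0 ≤ h r) → ∀ ε, 0 < ε →
      ε ≤ S → ∫⁻ r in Set.Ioc ε S, ENNReal.ofReal (h r) = ENNReal.ofReal (∫ r in ε..S, h r) := by
    intro h hh hp ε hε hεS
    rw [intervalIntegral.integral_of_le hεS, ofReal_integral_eq_lintegral_ofReal]
    · exact ((hh.mono fun r hr => hε.trans_le hr.1).integrableOn_Icc).mono_set
        Set.Ioc_subset_Icc_self
    · exact (ae_restrict_iff' measurableSet_Ioc).2 (ae_of_all _ fun r hr => hp r (hε.trans hr.1))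
  have hlim : Tendsto (fun ε => ∫⁻ r in Set.Ioc ε S, ENNReal.ofReal (f r)) (𝓝[>] 0)
      (𝓝 (∫⁻ r in Set.Ioc 0 S, ENNReal.ofReal (f r))) := by
    have hcov : AECover (volume.restrict (Set.Ioc (0 : ℝ) S)) (𝓝[>] (0 : ℝ))
        fun ε => Set.Ioc ε S := aecover_Ioc_of_Ioc nhdsWithin_le_nhds tendsto_const_nhds
    have hmeas : AEMeasurable (fun r => ENNReal.ofReal (f r))
        (volume.restrict (Set.Ioc (0 : ℝ) S)) :=
      ((cf.mono fun r hr => hr.1).aemeasurable measurableSet_Ioc).ennreal_ofReal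
    have := hcov.lintegral_tendsto_of_countably_generated hmeas
    refine this.congr' ?_
    filter_upwards [self_mem_nhdsWithin] with ε (hε : 0 < ε)
    rw [Measure.restrict_restrict measurableSet_Ioc, Set.inter_eq_left.2]
    exact Set.Ioc_subset_Ioc_left hε.le
  have hsupp : ∫⁻ r in Set.Ioi 0, ENNReal.ofReal (f r) =
      ∫⁻ r in Set.Ioc 0 S, ENNReal.ofReal (f r) := by
    rw [← Set.Ioc_union_Ioi_eq_Ioi hS.le,
      lintegral_union measurableSet_Ioi (Set.Ioc_disjoint_Ioi le_rfl)]
    have : ∫⁻ r in Set.Ioi S, ENNReal.ofReal (f r) = 0 := by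
      rw [setLIntegral_congr_fun (g := fun _ => 0) measurableSet_Ioi fun r hr => ?_]
      · simp
      · simp [f, hcS r (le_of_lt hr)]
    rw [this, add_zero]
  rw [hsupp]
  have hlim2 : Tendsto (fun ε => (∫⁻ r in Set.Ioi 0, ENNReal.ofReal (F r)) + ENNReal.ofReal (b ε))
      (𝓝[>] 0) (𝓝 ((∫⁻ r in Set.Ioi 0, ENNReal.ofReal (F r)) + 0)) := by
    refine tendsto_const_nhds.add ?_
    simpa using ENNReal.tendsto_ofReal hb
  rw [add_zero] at hlim2
  refine le_of_tendsto_of_tendsto hlim hlim2 ?_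
  filter_upwards [self_mem_nhdsWithin, mem_nhdsWithin_of_mem_nhds (Iio_mem_nhds hρ)] with ε h1 h2
  have h1 : 0 < ε := h1
  have hεS : ε ≤ S := (le_of_lt h2).trans (le_max_left _ _)
  rw [key cf pf ε h1 hεS]
  calc _ ≤ ENNReal.ofReal ((∫ r in ε..S, F r) + b ε) := ENNReal.ofReal_le_ofReal (hε ε h1 h2)
    _ ≤ ENNReal.ofReal (∫ r in ε..S, F r) + ENNReal.ofReal (b ε) := ENNReal.ofReal_add_le
    _ = (∫⁻ r in Set.Ioc ε S, ENNReal.ofReal (F r)) + ENNReal.ofReal (b ε) := by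
      rw [key cF pF ε h1 hεS]
    _ ≤ _ := by
      gcongr
      exact fun r hr => h1.trans hr.1

/-! ### Polar coordinates and angular Fourier series -/

/-- The radial unit vector. -/
def radialVec (θ : ℝ) : Plane := !₂[Real.cos θ, Real.sin θ]

/-- The angular unit vector. -/
def angularVec (θ : ℝ) : Plane := !₂[-Real.sin θ, Real.cos θ]

lemma norm_radialVec (θ : ℝ) : ‖radialVec θ‖ = 1 := by
  simp [radialVec, EuclideanSpace.norm_eq]

lemma norm_smul_radialVec {r : ℝ} (hr : 0 ≤ r) (θ : ℝ) : ‖r • radialVec θ‖ = r := by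
  rw [norm_smul, norm_radialVec, mul_one, Real.norm_of_nonneg hr]

@[fun_prop]
lemma continuous_radialVec : Continuous radialVec := by
  unfold radialVec
  refine (PiLp.continuous_toLp 2 _).comp (continuous_pi fun i => ?_)
  fin_cases i <;> simp <;> fun_prop

@[fun_prop]
lemma continuous_angularVec : Continuous angularVec := by
  unfold angularVec
  refine (PiLp.continuous_toLp 2 _).comp (continuous_pi fun i => ?_)
  fin_cases i <;> simp <;> fun_prop

lemma hasDerivAt_radialVec (θ : ℝ) : HasDerivAt radialVec (angularVec θ) θ := by
  have h : HasDerivAt (fun θ => ![Real.cos θ, Real.sin θ]) ![-Real.sin θ, Real.cos θ] θ := by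
    rw [hasDerivAt_pi]
    intro i
    fin_cases i
    · simpa using Real.hasDerivAt_cos θ
    · simpa using Real.hasDerivAt_sin θ
  exact ((PiLp.continuousLinearEquiv 2 ℝ
    (fun _ : Fin 2 => ℝ)).symm.hasFDerivAt.comp_hasDerivAt θ h)

lemma lintegral_polar {f : Plane → ℝ≥0∞} (hf : Measurable f) :
    ∫⁻ x, f x = ∫⁻ r in Set.Ioi 0, ∫⁻ θ in Set.Ioc (-Real.pi) Real.pi,
      ENNReal.ofReal r * f (r • radialVec θ) := by
  have h1 : ∫⁻ x, f x = ∫⁻ p : ℝ × ℝ, f (WithLp.toLp 2 ![p.1, p.2]) := by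
    rw [← (PiLp.volume_preserving_toLp (Fin 2)).lintegral_comp hf,
      ← (volume_preserving_finTwoArrow ℝ).symm.lintegral_comp
        (f := fun a : Fin 2 → ℝ => f (WithLp.toLp 2 a))
        (hf.comp (PiLp.volume_preserving_toLp (Fin 2)).measurable)]
    rfl
  rw [h1, ← lintegral_comp_polarCoord_symm, polarCoord_target, Measure.volume_eq_prod,
    ← Measure.prod_restrict, lintegral_prod]
  · refine lintegral_congr fun r => ?_
    rw [restrict_Ioo_eq_restrict_Ioc]
    refine lintegral_congr fun θ => ?_
    rw [smul_eq_mul]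
    congr 2
    ext i
    fin_cases i <;> simp [radialVec]
  · refine Measurable.aemeasurable ?_
    have : Continuous fun p : ℝ × ℝ =>
        (WithLp.toLp 2 ![(polarCoord.symm p).1, (polarCoord.symm p).2] : Plane) := by
      refine (PiLp.continuous_toLp 2 _).comp (continuous_pi fun i => ?_)
      fin_cases i <;> simp <;> fun_prop
    have h3 := hf.comp this.measurable
    simp only [smul_eq_mul]
    exact measurable_fst.ennreal_ofReal.mul h3

/-- The `m`-th Fourier coefficient on `[-π, π]`. -/
def angularCoeff (f : ℝ → ℂ) (m : ℤ) : ℂ :=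
  fourierCoeffOn (show -Real.pi < Real.pi by linarith [Real.pi_pos]) f m

lemma angularCoeff_eq (f : ℝ → ℂ) (m : ℤ) : angularCoeff f m =
    (1 / (2 * Real.pi) : ℝ) • ∫ θ in -Real.pi..Real.pi, Complex.exp (-(m * θ * Complex.I)) * f θ := by
  rw [angularCoeff, fourierCoeffOn_eq_integral]
  congr 1
  · rw [sub_neg_eq_add, two_mul]
  · refine intervalIntegral.integral_congr fun θ _ => ?_
    simp only [smul_eq_mul]
    rw [fourier_coe_apply]
    congr 2
    have : (Real.pi : ℂ) ≠ 0 := by exact_mod_cast Real.pi_ne_zero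
    push_cast
    field_simp
    ring

lemma lintegral_angular {f : ℝ → ℂ} (hf : Continuous f) :
    ∫⁻ θ in Set.Ioc (-Real.pi) Real.pi, ENNReal.ofReal (‖f θ‖ ^ 2) =
      ENNReal.ofReal (2 * Real.pi) * ∑' m : ℤ, ENNReal.ofReal (‖angularCoeff f m‖ ^ 2) := by
  have hπ : -Real.pi < Real.pi := by linarith [Real.pi_pos]
  have hL2 : MemLp f 2 (volume.restrict (Set.Ioc (-Real.pi) Real.pi)) := by
    obtain ⟨C, hC⟩ := isCompact_Icc.exists_bound_of_continuousOn
      (hf.continuousOn (s := Set.Icc (-Real.pi) Real.pi))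
    refine MemLp.of_bound hf.aestronglyMeasurable C
      ((ae_restrict_iff' measurableSet_Ioc).2 (ae_of_all _ fun θ hθ => hC θ ⟨hθ.1.le, hθ.2⟩))
  have h := hasSum_sq_fourierCoeffOn hπ hL2
  have hs : ∑' m : ℤ, ENNReal.ofReal (‖angularCoeff f m‖ ^ 2) =
      ENNReal.ofReal (∑' m : ℤ, ‖angularCoeff f m‖ ^ 2) :=
    (ENNReal.ofReal_tsum_of_nonneg (fun _ => sq_nonneg _) h.summable).symm
  rw [hs, show (∑' m : ℤ, ‖angularCoeff f m‖ ^ 2) = _ from h.tsum_eq, smul_eq_mul,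
    ← ENNReal.ofReal_mul (by positivity), ← mul_assoc,
    show 2 * Real.pi * (Real.pi - -Real.pi)⁻¹ = 1 by
      rw [sub_neg_eq_add, two_mul]; exact mul_inv_cancel₀ (by linarith [Real.pi_pos]), one_mul,
    intervalIntegral.integral_of_le hπ.le, ofReal_integral_eq_lintegral_ofReal]
  · exact (Continuous.integrableOn_Icc (by fun_prop)).mono_set Set.Ioc_subset_Icc_self
  · exact ae_of_all _ fun _ => sq_nonneg _

/-- Only `‖f‖` has to agree with `‖F‖`, so that `F` may differ from `f` by a unimodular factor. This
is needed for `dbar`, whose polar form carries the factor `exp(isθ)`. -/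
lemma lintegral_polar_parseval {w : ℝ → ℝ} (hwm : Measurable w) (hw0 : ∀ r, 0 ≤ w r)
    {f : Plane → ℂ} (hf : Continuous f) {F : ℝ → ℝ → ℂ} (hF : ∀ r, 0 < r → Continuous (F r))
    (hfF : ∀ r, 0 < r → ∀ θ, ‖f (r • radialVec θ)‖ = ‖F r θ‖)
    (hm : ∀ m, ContinuousOn (fun r => angularCoeff (F r) m) (Set.Ioi 0)) :
    ∫⁻ x, ENNReal.ofReal (w ‖x‖ * ‖f x‖ ^ 2) = ENNReal.ofReal (2 * Real.pi) *
      ∑' m : ℤ, ∫⁻ r in Set.Ioi 0, ENNReal.ofReal (w r * r * ‖angularCoeff (F r) m‖ ^ 2) := by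
  rw [lintegral_polar (by
    have : Measurable fun x : Plane => w ‖x‖ := hwm.comp measurable_norm
    fun_prop), ← lintegral_tsum, ← lintegral_const_mul' _ _ ENNReal.ofReal_ne_top]
  · refine setLIntegral_congr_fun measurableSet_Ioi fun r hr => ?_
    have hr : 0 < r := hr
    simp only [norm_smul_radialVec hr.le, hfF r hr]
    have e : ∀ θ, ENNReal.ofReal r * ENNReal.ofReal (w r * ‖F r θ‖ ^ 2) =
        ENNReal.ofReal (w r * r) * ENNReal.ofReal (‖F r θ‖ ^ 2) := fun θ => by
      rw [← ENNReal.ofReal_mul hr.le, ← ENNReal.ofReal_mul (mul_nonneg (hw0 r) hr.le)]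
      congr 1
      ring
    simp_rw [e]
    rw [lintegral_const_mul' _ _ ENNReal.ofReal_ne_top, lintegral_angular (hF r hr),
      mul_left_comm, ← ENNReal.tsum_mul_left]
    congr 2
    ext m
    rw [← ENNReal.ofReal_mul (mul_nonneg (hw0 r) hr.le)]
  · intro m
    refine AEMeasurable.ennreal_ofReal ?_
    have := (hm m).aemeasurable measurableSet_Ioi (μ := volume)
    fun_prop

lemma angularCoeff_add {f g : ℝ → ℂ} (hf : Continuous f) (hg : Continuous g) (m : ℤ) :
    angularCoeff (fun θ => f θ + g θ) m = angularCoeff f m + angularCoeff g m := by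
  simp only [angularCoeff_eq, mul_add]
  rw [intervalIntegral.integral_add, smul_add] <;>
  · apply Continuous.intervalIntegrable
    fun_prop

lemma angularCoeff_const_mul (f : ℝ → ℂ) (c : ℂ) (m : ℤ) :
    angularCoeff (fun θ => c * f θ) m = c * angularCoeff f m :=
  fourierCoeffOn.const_mul _ _ _ _

lemma angularCoeff_deriv {f f' : ℝ → ℂ} (hf : ∀ θ, HasDerivAt f (f' θ) θ) (hf' : Continuous f')
    (hper : f (-Real.pi) = f Real.pi) (m : ℤ) :
    angularCoeff f' m = Complex.I * m * angularCoeff f m := by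
  have hf'i := hf'.intervalIntegrable (μ := volume) (-Real.pi) Real.pi
  have hπ : (Real.pi : ℂ) ≠ 0 := by exact_mod_cast Real.pi_ne_zero
  -- The integration-by-parts formula divides by `m`, so the zero mode is the fundamental theorem of
  -- calculus together with periodicity.
  by_cases hm : m = 0
  · subst hm
    rw [angularCoeff_eq]
    simp only [Int.cast_zero, zero_mul, neg_zero, Complex.exp_zero, one_mul, mul_zero]
    rw [intervalIntegral.integral_eq_sub_of_hasDerivAt (fun θ _ => hf θ) hf'i, hper, sub_self,
      smul_zero]
  · unfold angularCoeff
    rw [fourierCoeffOn_of_hasDerivAt _ hm (fun θ _ => hf θ) hf'i, hper, sub_self, mul_zero, zero_sub]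
    have hm' : (m : ℂ) ≠ 0 := by exact_mod_cast hm
    push_cast
    field_simp
    ring

lemma angularCoeff_const (z : ℂ) {m : ℤ} (hm : m ≠ 0) : angularCoeff (fun _ => z) m = 0 := by
  have h := angularCoeff_deriv (f := fun _ => z) (f' := fun _ => 0)
    (fun θ => hasDerivAt_const _ _) continuous_const rfl m
  have h0 : angularCoeff (fun _ => 0) m = 0 := by simp [angularCoeff_eq]
  rw [h0] at h
  have hm' : Complex.I * m ≠ 0 := mul_ne_zero Complex.I_ne_zero (by exact_mod_cast hm)
  exact (mul_eq_zero.1 h.symm).resolve_left hm'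

lemma continuous_angularCoeff {F : ℝ → ℝ → ℂ} (hF : Continuous fun p : ℝ × ℝ => F p.1 p.2)
    (m : ℤ) : Continuous fun r => angularCoeff (F r) m := by
  simp only [angularCoeff_eq]
  have h := intervalIntegral.continuous_parametric_intervalIntegral_of_continuous'
    (f := fun r (θ : ℝ) => Complex.exp (-(m * θ * Complex.I)) * F r θ)
    (by unfold Function.uncurry; fun_prop) (-Real.pi) Real.pi (μ := volume)
  exact h.const_smul (1 / (2 * Real.pi) : ℝ)

lemma hasDerivAt_angularCoeff {F F' : ℝ → ℝ → ℂ} (hF : Continuous fun p : ℝ × ℝ => F p.1 p.2)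
    (hF' : Continuous fun p : ℝ × ℝ => F' p.1 p.2)
    (h : ∀ r θ, HasDerivAt (fun r => F r θ) (F' r θ) r) (m : ℤ) {C : ℝ}
    (hC : ∀ r θ, ‖F' r θ‖ ≤ C) (r : ℝ) :
    HasDerivAt (fun r => angularCoeff (F r) m) (angularCoeff (F' r) m) r := by
  simp only [angularCoeff_eq]
  have hs : ∀ r, Continuous (F r) := fun r =>
    hF.comp (continuous_const.prodMk continuous_id)
  have hs' : ∀ r, Continuous (F' r) := fun r =>
    hF'.comp (continuous_const.prodMk continuous_id)
  have c1 : ∀ r, Continuous fun θ : ℝ => Complex.exp (-(m * θ * Complex.I)) * F r θ := fun r => by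
    have := hs r
    fun_prop
  have c2 : ∀ r, Continuous fun θ : ℝ => Complex.exp (-(m * θ * Complex.I)) * F' r θ := fun r => by
    have := hs' r
    fun_prop
  have h := (intervalIntegral.hasDerivAt_integral_of_dominated_loc_of_deriv_le (μ := volume)
    (a := -Real.pi) (b := Real.pi) (x₀ := r)
    (F := fun r θ => Complex.exp (-(m * θ * Complex.I)) * F r θ)
    (F' := fun r θ => Complex.exp (-(m * θ * Complex.I)) * F' r θ)
    (bound := fun _ => C) (s := Set.univ) univ_mem
    (Eventually.of_forall fun r => (c1 r).aestronglyMeasurable)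
    ((c1 r).intervalIntegrable _ _) (c2 r).aestronglyMeasurable
    (ae_of_all _ fun θ _ r _ => by
      rw [norm_mul, show -((m : ℂ) * θ * Complex.I) = ((-(m * θ) : ℝ) : ℂ) * Complex.I by
        push_cast; ring, Complex.norm_exp_ofReal_mul_I, one_mul]
      exact hC r θ)
    (continuous_const.intervalIntegrable _ _)
    (ae_of_all _ fun θ _ r _ => (h r θ).const_mul _)).2
  exact h.const_smul (1 / (2 * Real.pi) : ℝ)

/-! ### The weighted Hardy inequality for the Cauchy–Riemann operator -/

/-- The Cauchy–Riemann type operator `∂₁ + i s ∂₂`. -/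
def dbar (s : ℤ) (v : Plane → ℂ) (x : Plane) : ℂ :=
  partialDeriv 0 v x + Complex.I * s * partialDeriv 1 v x

lemma continuous_partialDeriv {F : Type*} [NormedAddCommGroup F] [NormedSpace ℝ F]
    {v : Plane → F} (hv : ContDiff ℝ 1 v) (j : Fin 2) : Continuous (partialDeriv j v) :=
  (hv.continuous_fderiv one_ne_zero).clm_apply continuous_const

lemma continuous_dbar {s : ℤ} {v : Plane → ℂ} (hv : ContDiff ℝ 1 v) : Continuous (dbar s v) := by
  have := continuous_partialDeriv hv 0
  have := continuous_partialDeriv hv 1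
  unfold dbar
  fun_prop

lemma fderiv_radialVec (v : Plane → ℂ) (x : Plane) (θ : ℝ) : fderiv ℝ v x (radialVec θ) =
    Real.cos θ * partialDeriv 0 v x + Real.sin θ * partialDeriv 1 v x := by
  have : radialVec θ = Real.cos θ • EuclideanSpace.single (0 : Fin 2) (1 : ℝ) +
      Real.sin θ • EuclideanSpace.single (1 : Fin 2) (1 : ℝ) := by
    ext i
    fin_cases i <;> simp [radialVec]
  rw [this, map_add, map_smul, map_smul, Complex.real_smul, Complex.real_smul]
  rfl

lemma fderiv_angularVec (v : Plane → ℂ) (x : Plane) (θ : ℝ) : fderiv ℝ v x (angularVec θ) =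
    -Real.sin θ * partialDeriv 0 v x + Real.cos θ * partialDeriv 1 v x := by
  have : angularVec θ = (-Real.sin θ) • EuclideanSpace.single (0 : Fin 2) (1 : ℝ) +
      Real.cos θ • EuclideanSpace.single (1 : Fin 2) (1 : ℝ) := by
    ext i
    fin_cases i <;> simp [angularVec]
  rw [this, map_add, map_smul, map_smul, Complex.real_smul, Complex.real_smul]
  push_cast
  rfl

/-- The operator equals `exp(isθ)` times `∂_r + is r⁻¹∂_θ`, and the prefactor has modulus one. -/
lemma norm_dbar_polar {s : ℤ} (hs : s = 1 ∨ s = -1) (v : Plane → ℂ) (x : Plane) (θ : ℝ) :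
    ‖dbar s v x‖ = ‖fderiv ℝ v x (radialVec θ) +
      Complex.I * s * fderiv ℝ v x (angularVec θ)‖ := by
  have hs2 : (s : ℂ) ^ 2 = 1 := by rcases hs with rfl | rfl <;> norm_num
  have hcs : (Real.cos θ : ℂ) ^ 2 + (Real.sin θ : ℂ) ^ 2 = 1 := by
    exact_mod_cast Real.cos_sq_add_sin_sq θ
  have h1 : dbar s v x = Complex.exp (((s * θ : ℝ) : ℂ) * Complex.I) *
      (fderiv ℝ v x (radialVec θ) + Complex.I * s * fderiv ℝ v x (angularVec θ)) := by
    have he : Complex.exp (((s * θ : ℝ) : ℂ) * Complex.I) =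
        Real.cos θ + s * Real.sin θ * Complex.I := by
      rw [Complex.exp_mul_I, ← Complex.ofReal_cos, ← Complex.ofReal_sin]
      rcases hs with rfl | rfl <;> simp
    rw [he, fderiv_radialVec, fderiv_angularVec, dbar]
    generalize partialDeriv 0 v x = a
    generalize partialDeriv 1 v x = b
    have hI := Complex.I_sq
    generalize (Real.cos θ : ℂ) = c at *
    generalize (Real.sin θ : ℂ) = d at *
    generalize (s : ℂ) = s at *
    linear_combination (-a - Complex.I * s * b) * hcs +
      (-d * s ^ 2 * (c * b - d * a)) * hI + (d * (c * b - d * a)) * hs2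
  rw [h1, norm_mul, Complex.norm_exp_ofReal_mul_I, one_mul]

lemma measurable_radialWeight (α ρ : ℝ) : Measurable (radialWeight α ρ) := by
  unfold radialWeight
  split_ifs <;> fun_prop

/-- The weighted Hardy inequality for the Cauchy–Riemann operator. -/
theorem lintegral_radialWeight_le_dbar {α ρ : ℝ} (hρ : 0 < ρ) (hα : α ≠ 0) {s : ℤ}
    (hs : s = 1 ∨ s = -1) {v : Plane → ℂ} (hv : ContDiff ℝ 1 v) (hsupp : HasCompactSupport v) :
    ∫⁻ x, ENNReal.ofReal (radialWeight α ρ ‖x‖ * growth |α| ρ ‖x‖ ^ 2 * ‖v x‖ ^ 2) ≤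
      ∫⁻ x, ENNReal.ofReal (growth |α| ρ ‖x‖ ^ 2 * ‖dbar s v x‖ ^ 2) := by
  have hgc : Continuous (growth |α| ρ) := continuous_growth (abs_nonneg α) hρ
  have hWm := measurable_radialWeight α ρ
  have hd : Continuous (fderiv ℝ v) := hv.continuous_fderiv one_ne_zero
  obtain ⟨C, hC⟩ := (hsupp.fderiv ℝ).exists_bound_of_continuous hd
  obtain ⟨R, hR⟩ := hsupp.isCompact.isBounded.subset_closedBall (0 : Plane)
  have hv1 : ∀ x, HasFDerivAt v (fderiv ℝ v x) x := fun x =>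
    (hv.differentiable one_ne_zero x).hasFDerivAt
  have hvc := hv.continuous
  have hpol : Continuous fun p : ℝ × ℝ => p.1 • radialVec p.2 := by fun_prop
  set V : ℝ → ℝ → ℂ := fun r θ => v (r • radialVec θ)
  set Vr : ℝ → ℝ → ℂ := fun r θ => fderiv ℝ v (r • radialVec θ) (radialVec θ)
  set Vt : ℝ → ℝ → ℂ := fun r θ => fderiv ℝ v (r • radialVec θ) (angularVec θ)
  have cV : Continuous fun p : ℝ × ℝ => V p.1 p.2 := hvc.comp hpol
  have cVr : Continuous fun p : ℝ × ℝ => Vr p.1 p.2 :=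
    (hd.comp hpol).clm_apply (by fun_prop)
  have cVt : Continuous fun p : ℝ × ℝ => Vt p.1 p.2 :=
    (hd.comp hpol).clm_apply (by fun_prop)
  have slice : ∀ {F : ℝ → ℝ → ℂ}, (Continuous fun p : ℝ × ℝ => F p.1 p.2) → ∀ r, Continuous (F r) :=
    fun hF r => hF.comp (continuous_const.prodMk continuous_id)
  have hVr : ∀ r θ, HasDerivAt (fun r => V r θ) (Vr r θ) r := fun r θ => by
    have := (hv1 (r • radialVec θ)).comp_hasDerivAt r ((hasDerivAt_id' r).smul_const (radialVec θ))
    rw [one_smul] at this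
    exact this
  have hVt : ∀ r θ, HasDerivAt (V r) ((r : ℂ) * Vt r θ) θ := fun r θ => by
    have := (hv1 (r • radialVec θ)).comp_hasDerivAt θ ((hasDerivAt_radialVec θ).const_smul r)
    rw [map_smul, Complex.real_smul] at this
    exact this
  have hper : ∀ r, V r (-Real.pi) = V r Real.pi := fun r => by
    simp only [V, radialVec]
    simp
  have hcoef : ∀ (m : ℤ) r, 0 < r → angularCoeff (Vt r) m =
      Complex.I * m / r * angularCoeff (V r) m := fun m r hr => by
    have h1 := angularCoeff_deriv (hVt r) (by have := slice cVt r; fun_prop) (hper r) m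
    rw [angularCoeff_const_mul] at h1
    have hr' : (r : ℂ) ≠ 0 := by exact_mod_cast hr.ne'
    rw [div_mul_eq_mul_div, ← h1, mul_div_cancel_left₀ _ hr']
  have hs2 : (s : ℝ) ^ 2 = 1 := by rcases hs with rfl | rfl <;> norm_num
  set F : ℝ → ℝ → ℂ := fun r θ => Vr r θ + Complex.I * s * Vt r θ
  have cF : Continuous fun p : ℝ × ℝ => F p.1 p.2 := by fun_prop
  have hFcoef : ∀ (m : ℤ) r, 0 < r → angularCoeff (F r) m =
      angularCoeff (Vr r) m + (((-s * m : ℤ) / r : ℝ) : ℂ) * angularCoeff (V r) m :=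
    fun m r hr => by
      rw [show F r = fun θ => Vr r θ + Complex.I * s * Vt r θ from rfl,
        angularCoeff_add (slice cVr r) (by have := slice cVt r; fun_prop), angularCoeff_const_mul,
        hcoef m r hr]
      push_cast
      linear_combination (s * m / r * angularCoeff (V r) m : ℂ) * Complex.I_sq
  have hP1 := lintegral_polar_parseval (w := fun r => radialWeight α ρ r * growth |α| ρ r ^ 2)
    (hWm.mul (hgc.measurable.pow_const 2))
    (fun r => mul_nonneg (radialWeight_nonneg hρ r) (sq_nonneg _)) hvc (F := V)
    (fun r _ => slice cV r) (fun r _ θ => rfl) fun m => (continuous_angularCoeff cV m).continuousOn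
  have hP2 := lintegral_polar_parseval (w := fun r => growth |α| ρ r ^ 2)
    (hgc.measurable.pow_const 2) (fun r => sq_nonneg _) (continuous_dbar (s := s) hv) (F := F)
    (fun r _ => slice cF r) (fun r _ θ => norm_dbar_polar hs v _ θ)
    fun m => (continuous_angularCoeff cF m).continuousOn
  rw [hP1, hP2]
  gcongr ENNReal.ofReal (2 * Real.pi) * ?_
  refine ENNReal.tsum_le_tsum fun m => ?_
  -- The index is `n = -sm`, because `is r⁻¹∂_θ` acts on the `m`-th mode as `is · im/r`. At the
  -- origin `v(r cos θ, r sin θ)` does not depend on `θ`, which kills every nonzero mode there.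
  have hmode := mode_inequality hρ hα (-s * m) (c := fun r => angularCoeff (V r) m)
    (c' := fun r => angularCoeff (Vr r) m)
    (hasDerivAt_angularCoeff cV cVr hVr m (C := C) fun r θ =>
      ((fderiv ℝ v _).le_opNorm _).trans (by rw [norm_radialVec, mul_one]; exact hC _))
    (continuous_angularCoeff cVr m)
    (fun hm => by
      have hm0 : m ≠ 0 := fun h => hm (by rw [h, mul_zero])
      simp only [V, zero_smul]
      exact angularCoeff_const _ hm0)
    (R := max 0 R + 1) (fun r hr => by
      have h0 : V r = fun _ => 0 := by
        funext θ
        by_contra hne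
        have h1 := hR (subset_closure (Function.mem_support.2 hne))
        have hr0 : 0 ≤ r := by linarith [le_max_left 0 R]
        rw [mem_closedBall_zero_iff, norm_smul_radialVec hr0] at h1
        linarith [le_max_right 0 R]
      simp [h0, angularCoeff_eq])
  refine hmode.trans (le_of_eq ?_)
  refine setLIntegral_congr_fun measurableSet_Ioi fun r hr => ?_
  simp only [hFcoef m r hr]

/-! ### The fundamental solution of the Laplacian -/

lemma IsTestFunction.partialDeriv {φ : Plane → ℝ} (hφ : IsTestFunction φ) (j : Fin 2) :
    IsTestFunction (partialDeriv j φ) := by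
  refine ⟨?_, hφ.2.fderiv_apply ℝ _⟩
  exact (hφ.1.fderiv_right (m := ∞) (by simp)).clm_apply contDiff_const

lemma IsTestFunction.continuous {φ : Plane → ℝ} (hφ : IsTestFunction φ) : Continuous φ :=
  hφ.1.continuous

lemma integral_mul_partialDeriv {f φ : Plane → ℝ} (hf : ContDiff ℝ 1 f) (hφ : ContDiff ℝ 1 φ)
    (hs : HasCompactSupport φ) (j : Fin 2) :
    ∫ x, f x * partialDeriv j φ x = -∫ x, partialDeriv j f x * φ x := by
  have h1 := continuous_partialDeriv hf j
  have h2 := continuous_partialDeriv hφ j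
  have hs2 : HasCompactSupport (partialDeriv j φ) := hs.fderiv_apply ℝ _
  have := hf.continuous
  have := hφ.continuous
  exact integral_mul_fderiv_eq_neg_fderiv_mul_of_integrable
    (Continuous.integrable_of_hasCompactSupport (h1.mul hφ.continuous) hs.mul_left)
    (Continuous.integrable_of_hasCompactSupport (hf.continuous.mul h2) hs2.mul_left)
    (Continuous.integrable_of_hasCompactSupport (hf.continuous.mul hφ.continuous) hs.mul_left)
    (fun x _ => hf.differentiable one_ne_zero x) (fun x _ => hφ.differentiable one_ne_zero x)

/-- The regularized logarithm `(1/2) log(e + |x|²)`. -/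
def regLog (e : ℝ) (x : Plane) : ℝ := Real.log (e + ‖x‖ ^ 2) / 2

lemma contDiff_regLog {e : ℝ} (he : 0 < e) : ContDiff ℝ 2 (regLog e) := by
  unfold regLog
  refine ContDiff.div_const (ContDiff.log (contDiff_const.add (contDiff_norm_sq ℝ)) ?_) 2
  intro x
  positivity

lemma hasFDerivAt_add_norm_sq (e : ℝ) (x : Plane) :
    HasFDerivAt (fun x : Plane => e + ‖x‖ ^ 2) (2 • innerSL ℝ x) x :=
  (hasStrictFDerivAt_norm_sq x).hasFDerivAt.const_add e

lemma partialDeriv_regLog {e : ℝ} (he : 0 < e) (j : Fin 2) :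
    partialDeriv j (regLog e) = fun x => x j / (e + ‖x‖ ^ 2) := by
  funext x
  have hpos : e + ‖x‖ ^ 2 ≠ 0 := by positivity
  have h := ((hasFDerivAt_add_norm_sq e x).log hpos).mul_const (2⁻¹ : ℝ)
  have h2 : HasFDerivAt (regLog e) _ x := h
  rw [partialDeriv, h2.fderiv]
  simp [innerSL_apply_apply, EuclideanSpace.inner_single_right]
  field_simp

lemma laplacian_regLog {e : ℝ} (he : 0 < e) (x : Plane) :
    partialDeriv 0 (partialDeriv 0 (regLog e)) x + partialDeriv 1 (partialDeriv 1 (regLog e)) x =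
      2 * e / (e + ‖x‖ ^ 2) ^ 2 := by
  have hpos : e + ‖x‖ ^ 2 ≠ 0 := by positivity
  have key : ∀ j : Fin 2, partialDeriv j (partialDeriv j (regLog e)) x =
      1 / (e + ‖x‖ ^ 2) - 2 * x j ^ 2 / (e + ‖x‖ ^ 2) ^ 2 := fun j => by
    rw [partialDeriv_regLog he j, partialDeriv]
    have hp : HasFDerivAt (fun x : Plane => x j) (EuclideanSpace.proj j : Plane →L[ℝ] ℝ) x :=
      (EuclideanSpace.proj j : Plane →L[ℝ] ℝ).hasFDerivAt
    have h := hp.mul ((hasDerivAt_inv hpos).comp_hasFDerivAt x (hasFDerivAt_add_norm_sq e x))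
    have h2 : HasFDerivAt (fun x : Plane => x j / (e + ‖x‖ ^ 2)) _ x := h
    rw [h2.fderiv]
    simp [innerSL_apply_apply, EuclideanSpace.inner_single_right]
    field_simp
    ring
  rw [key, key]
  have : ‖x‖ ^ 2 = x 0 ^ 2 + x 1 ^ 2 := by
    rw [EuclideanSpace.norm_sq_eq]; simp
  have e1 : 2 * e = 2 * (e + ‖x‖ ^ 2) - 2 * (x 0 ^ 2 + x 1 ^ 2) := by rw [this]; ring
  rw [e1]
  field_simp
  ring

/-- The Laplacian. -/
def laplacian (φ : Plane → ℝ) (x : Plane) : ℝ :=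
  partialDeriv 0 (partialDeriv 0 φ) x + partialDeriv 1 (partialDeriv 1 φ) x

lemma IsTestFunction.continuous_laplacian {φ : Plane → ℝ} (hφ : IsTestFunction φ) :
    Continuous (laplacian φ) :=
  ((hφ.partialDeriv 0).partialDeriv 0).continuous.add
    ((hφ.partialDeriv 1).partialDeriv 1).continuous

lemma IsTestFunction.hasCompactSupport_laplacian {φ : Plane → ℝ} (hφ : IsTestFunction φ) :
    HasCompactSupport (laplacian φ) :=
  ((hφ.partialDeriv 0).partialDeriv 0).2.add ((hφ.partialDeriv 1).partialDeriv 1).2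

lemma integral_regLog_mul_laplacian {e : ℝ} (he : 0 < e) {φ : Plane → ℝ} (hφ : IsTestFunction φ) :
    ∫ x, regLog e x * laplacian φ x = ∫ x, 2 * e / (e + ‖x‖ ^ 2) ^ 2 * φ x := by
  have hL := contDiff_regLog he
  have h1 : ∀ j, ContDiff ℝ 1 (partialDeriv j (regLog e)) := fun j =>
    (hL.fderiv_right (m := 1) (by norm_num)).clm_apply contDiff_const
  have h2 : ∀ j, ContDiff ℝ 1 (partialDeriv j φ) := fun j =>
    (hφ.partialDeriv j).1.of_le (by simp)
  have hφ1 : ContDiff ℝ 1 φ := hφ.1.of_le (by simp)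
  have hL1 : ContDiff ℝ 1 (regLog e) := hL.of_le (by norm_num)
  have step : ∀ j, ∫ x, regLog e x * partialDeriv j (partialDeriv j φ) x =
      ∫ x, partialDeriv j (partialDeriv j (regLog e)) x * φ x := fun j => by
    rw [integral_mul_partialDeriv hL1 (h2 j) (hφ.partialDeriv j).2,
      integral_mul_partialDeriv (h1 j) hφ1 hφ.2, neg_neg]
  have hi : ∀ j, Integrable fun x => regLog e x * partialDeriv j (partialDeriv j φ) x := fun j =>
    (hL1.continuous.mul ((hφ.partialDeriv j).partialDeriv j).continuous).integrable_of_hasCompactSupport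
      ((hφ.partialDeriv j).partialDeriv j).2.mul_left
  have hi2 : ∀ j, Integrable fun x => partialDeriv j (partialDeriv j (regLog e)) x * φ x := fun j =>
    ((continuous_partialDeriv (h1 j) j).mul hφ.continuous).integrable_of_hasCompactSupport
      hφ.2.mul_left
  simp only [laplacian, mul_add, ← laplacian_regLog he, add_mul]
  rw [integral_add (hi 0) (hi 1), integral_add (hi2 0) (hi2 1), step, step]

/-- With `e = c⁻²` the Laplacian of the regularized logarithm is `2π c² p(cx)`, where `p = 1/(π(1 +
|x|²)²)` is a probability density. As `c → ∞` these are peak functions at the origin. -/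
lemma tendsto_integral_regLog {φ : Plane → ℝ} (hφ : IsTestFunction φ) :
    Tendsto (fun c : ℝ => ∫ x, regLog (c ^ 2)⁻¹ x * laplacian φ x) atTop
      (𝓝 (2 * Real.pi * φ 0)) := by
  have hπ := Real.pi_pos
  set p : Plane → ℝ := fun x => 1 / (Real.pi * (1 + ‖x‖ ^ 2) ^ 2) with hp
  have hpint : ∫ x, p x = 1 := by
    have h := integral_fun_norm_addHaar (volume : Measure Plane)
      (fun r : ℝ => 1 / (Real.pi * (1 + r ^ 2) ^ 2))
    rw [hp, h]
    have hvol : volume.real (Metric.ball (0 : Plane) 1) = Real.pi := by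
      rw [Measure.real, EuclideanSpace.volume_ball_fin_two]
      simp [hπ.le]
    have hd : ∀ r ∈ Set.Ici (0 : ℝ), HasDerivAt (fun r : ℝ => -(1 / (2 * Real.pi)) * (1 + r ^ 2)⁻¹)
        (r * (1 / (Real.pi * (1 + r ^ 2) ^ 2))) r := fun r _ => by
      have h1 : HasDerivAt (fun r : ℝ => 1 + r ^ 2) (2 * r) r := by
        simpa using (hasDerivAt_pow 2 r).const_add 1
      have := (h1.fun_inv (by positivity)).const_mul (-(1 / (2 * Real.pi)))
      refine this.congr_deriv ?_
      field_simp
    have hlim : Tendsto (fun r : ℝ => -(1 / (2 * Real.pi)) * (1 + r ^ 2)⁻¹) atTop (𝓝 0) := by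
      have : Tendsto (fun r : ℝ => 1 + r ^ 2) atTop atTop :=
        tendsto_atTop_add_const_left _ _ (tendsto_pow_atTop two_ne_zero)
      simpa using this.inv_tendsto_atTop.const_mul (-(1 / (2 * Real.pi)))
    have hI := integral_Ioi_of_hasDerivAt_of_nonneg' hd
      (fun r (hr : 0 < r) => by positivity) hlim
    simp only [finrank_euclideanSpace, Fintype.card_fin, Nat.add_one_sub_one, pow_one, smul_eq_mul,
      hvol]
    rw [hI]
    simp
  have hdecay : Tendsto (fun x : Plane => ‖x‖ ^ Module.finrank ℝ Plane * p x)
      (Bornology.cobounded Plane) (𝓝 0) := by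
    have h1 : Tendsto (fun r : ℝ => 1 / (Real.pi * (1 + r ^ 2))) atTop (𝓝 0) := by
      have : Tendsto (fun r : ℝ => Real.pi * (1 + r ^ 2)) atTop atTop :=
        Tendsto.const_mul_atTop hπ
          (tendsto_atTop_add_const_left _ _ (tendsto_pow_atTop two_ne_zero))
      refine this.inv_tendsto_atTop.congr fun r => ?_
      rw [one_div, Pi.inv_apply]
    refine squeeze_zero (fun x => by positivity) (fun x => ?_)
      (h1.comp tendsto_norm_cobounded_atTop)
    simp only [finrank_euclideanSpace, Fintype.card_fin, hp, Function.comp]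
    rw [mul_one_div, div_le_div_iff₀ (by positivity) (by positivity)]
    nlinarith [sq_nonneg ‖x‖, mul_pos hπ (show 0 < 1 + ‖x‖ ^ 2 by positivity)]
  have hpk := tendsto_integral_comp_smul_smul_of_integrable (μ := (volume : Measure Plane))
    (φ := p) (fun x => by positivity) hpint hdecay
    (hφ.continuous.integrable_of_hasCompactSupport hφ.2) hφ.continuous.continuousAt
  have := hpk.const_mul (2 * Real.pi)
  refine this.congr' ?_
  filter_upwards [eventually_gt_atTop 0] with c hc
  rw [integral_regLog_mul_laplacian (by positivity) hφ, ← integral_const_mul]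
  refine integral_congr_ae (ae_of_all _ fun x => ?_)
  simp only [finrank_euclideanSpace, Fintype.card_fin, hp, norm_smul, Real.norm_of_nonneg hc.le,
    smul_eq_mul]
  field_simp

/-- An integrable majorant of the local singularity of the logarithm. -/
def logKernel (x : Plane) : ℝ := (Set.Iio (1 : ℝ)).indicator (fun r => r⁻¹) ‖x‖

lemma integrable_logKernel : Integrable logKernel := by
  unfold logKernel
  rw [integrable_fun_norm_addHaar (volume : Measure Plane)]
  simp only [finrank_euclideanSpace, Fintype.card_fin, Nat.add_one_sub_one, pow_one, smul_eq_mul]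
  have : IntegrableOn (fun _ : ℝ => (1 : ℝ)) (Set.Ioo 0 1) :=
    integrableOn_const (by simp)
  rw [← integrable_indicator_iff measurableSet_Ioo] at this
  refine this.integrableOn.congr_fun (fun r hr => ?_) measurableSet_Ioi
  have hr : 0 < r := hr
  by_cases h : r < 1
  · simp [hr, h, hr.ne']
  · simp [h]

lemma logKernel_nonneg (x : Plane) : 0 ≤ logKernel x := by
  unfold logKernel
  rw [Set.indicator_apply]
  split_ifs <;> positivity

/-- The exponent `δ` stays free so that the growth at infinity can be absorbed by the decay of `B`.
-/
lemma abs_log_norm_le {δ : ℝ} (hδ : 0 < δ) (x : Plane) :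
    |Real.log ‖x‖| ≤ logKernel x + ‖x‖ ^ δ / δ := by
  have hk := logKernel_nonneg x
  have h0 : 0 ≤ ‖x‖ ^ δ / δ := by positivity
  rcases (norm_nonneg x).eq_or_lt with h | h
  · rw [← h] at h0 ⊢
    simp only [Real.log_zero, abs_zero]
    positivity
  rcases lt_or_ge ‖x‖ 1 with h1 | h1
  · rw [abs_of_nonpos (Real.log_nonpos h.le h1.le)]
    have : logKernel x = ‖x‖⁻¹ := by
      unfold logKernel
      rw [Set.indicator_of_mem (show ‖x‖ ∈ Set.Iio (1 : ℝ) from h1)]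
    rw [this, ← Real.log_inv]
    have := Real.log_le_sub_one_of_pos (inv_pos.2 h)
    linarith
  · rw [abs_of_nonneg (Real.log_nonneg h1)]
    have := Real.log_le_rpow_div h.le hδ
    linarith

lemma locallyIntegrable_log_norm : LocallyIntegrable (fun x : Plane => Real.log ‖x‖) := by
  have h1 : LocallyIntegrable (fun x : Plane => logKernel x + ‖x‖ ^ (1 : ℝ) / 1) :=
    integrable_logKernel.locallyIntegrable.add
      (Continuous.locallyIntegrable (by simp only [Real.rpow_one]; fun_prop))
  exact h1.mono (Real.measurable_log.comp measurable_norm).aestronglyMeasurable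
    (ae_of_all _ fun x => (abs_log_norm_le one_pos x).trans (le_abs_self _))

/-- `(1/2π) log|x|` is the fundamental solution of the Laplacian. -/
lemma integral_log_norm_mul_laplacian {φ : Plane → ℝ} (hφ : IsTestFunction φ) :
    ∫ x, Real.log ‖x‖ * laplacian φ x = 2 * Real.pi * φ 0 := by
  refine tendsto_nhds_unique ?_ (tendsto_integral_regLog hφ)
  have hLc := hφ.continuous_laplacian
  have hLs := hφ.hasCompactSupport_laplacian
  -- For `c ≥ 1` and `x ≠ 0` the regularized logarithm lies between `log|x|` and `|x|²`, which gives
  -- the majorant.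
  refine tendsto_integral_filter_of_dominated_convergence
    (fun x => |Real.log ‖x‖ * laplacian φ x| + |‖x‖ ^ 2 * laplacian φ x|) ?_ ?_ ?_ ?_
  · filter_upwards [eventually_gt_atTop 0] with c hc
    exact ((contDiff_regLog (by positivity)).continuous.mul hLc).aestronglyMeasurable
  · filter_upwards [eventually_ge_atTop 1] with c hc
    have hc1 : (c ^ 2)⁻¹ ≤ 1 := inv_le_one_of_one_le₀ (one_le_pow₀ hc)
    have hc0 : 0 < (c ^ 2)⁻¹ := by positivity
    have hne : ∀ᵐ x : Plane, x ≠ 0 := by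
      simp [ae_iff, measure_singleton]
    filter_upwards [hne] with x hx
    have hx0 : 0 < ‖x‖ := norm_pos_iff.2 hx
    rw [Real.norm_eq_abs, abs_mul, abs_mul, abs_mul, ← add_mul]
    gcongr
    have hlow : Real.log ‖x‖ ≤ regLog (c ^ 2)⁻¹ x := by
      have : Real.log (‖x‖ ^ 2) ≤ Real.log ((c ^ 2)⁻¹ + ‖x‖ ^ 2) :=
        Real.log_le_log (by positivity) (by linarith)
      rw [Real.log_pow] at this
      unfold regLog
      push_cast at this
      linarith
    have hup : regLog (c ^ 2)⁻¹ x ≤ ‖x‖ ^ 2 := by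
      have := Real.log_le_sub_one_of_pos (show 0 < (c ^ 2)⁻¹ + ‖x‖ ^ 2 by positivity)
      unfold regLog
      nlinarith [sq_nonneg ‖x‖]
    rw [abs_le]
    constructor
    · linarith [neg_abs_le (Real.log ‖x‖), abs_nonneg (‖x‖ ^ 2)]
    · linarith [abs_nonneg (Real.log ‖x‖), le_abs_self (‖x‖ ^ 2)]
  · refine Integrable.add (Integrable.abs ?_) (Integrable.abs ?_)
    · exact locallyIntegrable_log_norm.integrable_smul_right_of_hasCompactSupport hLc hLs
    · exact Continuous.integrable_of_hasCompactSupport (by fun_prop) hLs.mul_left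
  · have hne : ∀ᵐ x : Plane, x ≠ 0 := by
      simp [ae_iff, measure_singleton]
    filter_upwards [hne] with x hx
    have hx0 : 0 < ‖x‖ := norm_pos_iff.2 hx
    have h1 : Tendsto (fun c : ℝ => (c ^ 2)⁻¹ + ‖x‖ ^ 2) atTop (𝓝 (0 + ‖x‖ ^ 2)) :=
      (tendsto_pow_atTop two_ne_zero).inv_tendsto_atTop.add_const _
    have h2 := ((h1.log (by positivity)).div_const 2).mul_const (laplacian φ x)
    rw [zero_add, Real.log_pow, show ((2 : ℕ) : ℝ) * Real.log ‖x‖ / 2 = Real.log ‖x‖ by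
      push_cast; ring] at h2
    exact h2

/-! ### The scalar potential -/

lemma MemLpLoc.integrableOn {F : Type*} [NormedAddCommGroup F] {f : Plane → F} {p : ℝ≥0∞}
    (hf : MemLpLoc f p) (hp : 1 ≤ p) {K : Set Plane} (hK : IsCompact K) : IntegrableOn f K := by
  have : IsFiniteMeasure (volume.restrict K) := ⟨by simpa using hK.measure_lt_top⟩
  exact (hf K hK).integrable hp

lemma MemLpLoc.locallyIntegrable {F : Type*} [NormedAddCommGroup F] {f : Plane → F} {p : ℝ≥0∞}
    (hf : MemLpLoc f p) (hp : 1 ≤ p) : LocallyIntegrable f :=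
  locallyIntegrable_iff.2 fun _ hK => hf.integrableOn hp hK

lemma IsAdmissibleField.locallyIntegrable {B : Plane → ℝ} (hB : IsAdmissibleField B) :
    LocallyIntegrable B := by
  obtain ⟨p, hp, hBp⟩ := hB.memLpLoc
  exact hBp.locallyIntegrable (le_trans (by norm_num) hp.le)

lemma IsAdmissibleField.exists_integrable_weight {B : Plane → ℝ} (hB : IsAdmissibleField B) :
    ∃ δ : ℝ, 0 < δ ∧ Integrable fun y => B y * (1 + ‖y‖) ^ δ := by
  have hBl := hB.locallyIntegrable
  obtain ⟨τ, hτ, C, R, hR, hdec⟩ := hB.decay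
  -- Half of the excess decay is spent on the weight; the remaining exponent `τ - δ = (τ + 2)/2`
  -- still exceeds the dimension `2`.
  set δ := (τ - 2) / 2 with hδ
  have hδ0 : 0 < δ := by rw [hδ]; linarith
  refine ⟨δ, hδ0, ?_⟩
  have hwc : Continuous fun y : Plane => (1 + ‖y‖) ^ δ :=
    Continuous.rpow_const (by fun_prop) fun x => Or.inr hδ0.le
  have hK : IsCompact (Metric.closedBall (0 : Plane) R) := isCompact_closedBall _ _
  rw [← integrableOn_univ, ← Set.union_compl_self (Metric.closedBall (0 : Plane) R)]
  refine IntegrableOn.union ?_ ?_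
  · exact (hBl.integrableOn_isCompact hK).mul_continuousOn hwc.continuousOn hK
  -- Chosen so that `q(1 + |y|) ≤ |y|` whenever `|y| ≥ R`, which trades `|y|^(-τ)` for `(1 +
  -- |y|)^(-τ)`.
  · set q := R / (1 + R) with hq
    have hq0 : 0 < q := by positivity
    have hint : Integrable fun y : Plane => |C| * q ^ (-τ) * (1 + ‖y‖) ^ (-(τ - δ)) := by
      refine (integrable_one_add_norm ?_).const_mul _
      simp only [finrank_euclideanSpace, Fintype.card_fin, Nat.cast_ofNat]
      rw [hδ]
      linarith
    refine hint.integrableOn.mono'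
      (hBl.aestronglyMeasurable.mul hwc.aestronglyMeasurable).restrict ?_
    refine (ae_restrict_iff' Metric.isClosed_closedBall.measurableSet.compl).2 ?_
    filter_upwards [hdec] with y hy hyR
    have hyR : R ≤ ‖y‖ := by
      simp only [Set.mem_compl_iff, mem_closedBall_zero_iff, not_le] at hyR
      exact hyR.le
    have hy0 : 0 < ‖y‖ := hR.trans_le hyR
    have h1 : q * (1 + ‖y‖) ≤ ‖y‖ := by
      rw [hq, div_mul_eq_mul_div, div_le_iff₀ (by positivity)]
      nlinarith
    have h2 : ‖y‖ ^ (-τ) ≤ (q * (1 + ‖y‖)) ^ (-τ) :=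
      Real.rpow_le_rpow_of_nonpos (by positivity) h1 (by linarith)
    rw [Real.mul_rpow hq0.le (by positivity)] at h2
    have h3 : |B y| ≤ |C| * (q ^ (-τ) * (1 + ‖y‖) ^ (-τ)) :=
      (hy hyR).trans (mul_le_mul (le_abs_self C) h2 (by positivity) (abs_nonneg _))
    rw [norm_mul, Real.norm_eq_abs, Real.norm_of_nonneg (by positivity)]
    calc |B y| * (1 + ‖y‖) ^ δ
        ≤ |C| * (q ^ (-τ) * (1 + ‖y‖) ^ (-τ)) * (1 + ‖y‖) ^ δ := by gcongr
      _ = |C| * q ^ (-τ) * ((1 + ‖y‖) ^ (-τ) * (1 + ‖y‖) ^ δ) := by ring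
      _ = _ := by
        rw [← Real.rpow_add (by positivity)]
        congr 2
        ring

/-- The singular part of the logarithm gives the convolution integrand of two integrable functions.
The growing part separates through `|x - y|^δ ≤ (1 + |x|)^δ (1 + |y|)^δ`. This joint integrability
justifies Fubini for `h` and its local integrability. -/
lemma integrable_log_kernel {B : Plane → ℝ} {δ : ℝ} (hδ : 0 < δ)
    (hBm : AEStronglyMeasurable B volume)
    (hB : Integrable fun y => B y * (1 + ‖y‖) ^ δ) {ψ : Plane → ℝ}
    (hψm : AEStronglyMeasurable ψ volume) {M R : ℝ} (hM : ∀ x, |ψ x| ≤ M)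
    (hR : ∀ x, R < ‖x‖ → ψ x = 0) :
    Integrable (fun p : Plane × Plane => ψ p.1 * (B p.2 * Real.log ‖p.1 - p.2‖))
      (volume.prod volume) := by
  have hM0 : 0 ≤ M := (abs_nonneg _).trans (hM 0)
  have hwc : Continuous fun y : Plane => (1 + ‖y‖) ^ δ :=
    Continuous.rpow_const (by fun_prop) fun x => Or.inr hδ.le
  have hw1 : ∀ y : Plane, 1 ≤ (1 + ‖y‖) ^ δ := fun y =>
    Real.one_le_rpow (by linarith [norm_nonneg y]) hδ.le
  have hBi : Integrable B := by
    refine hB.mono hBm (ae_of_all _ fun y => ?_)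
    rw [norm_mul, Real.norm_of_nonneg (show 0 ≤ (1 + ‖y‖) ^ δ by positivity)]
    exact le_mul_of_one_le_right (norm_nonneg _) (hw1 y)
  have hψw : Integrable fun x => ψ x * (1 + ‖x‖) ^ δ := by
    have hbound : Integrable ((Metric.closedBall (0 : Plane) R).indicator
        fun x => M * (1 + ‖x‖) ^ δ) := by
      rw [integrable_indicator_iff Metric.isClosed_closedBall.measurableSet]
      exact (continuous_const.mul hwc).continuousOn.integrableOn_compact (isCompact_closedBall _ _)
    refine hbound.mono' (hψm.mul hwc.aestronglyMeasurable) (ae_of_all _ fun x => ?_)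
    by_cases hx : ‖x‖ ≤ R
    · rw [Set.indicator_of_mem (by simpa using hx), norm_mul,
        Real.norm_of_nonneg (show 0 ≤ (1 + ‖x‖) ^ δ by positivity)]
      exact mul_le_mul_of_nonneg_right (hM x) (by positivity)
    · rw [hR x (not_le.1 hx), zero_mul, norm_zero]
      exact Set.indicator_nonneg (fun _ _ => by positivity) _
  have i1 : Integrable (fun p : Plane × Plane => M * (B p.2 * logKernel (p.1 - p.2)))
      (volume.prod volume) :=
    (hBi.convolution_integrand (ContinuousLinearMap.mul ℝ ℝ) integrable_logKernel).const_mul M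
  have i2 : Integrable (fun p : Plane × Plane =>
      δ⁻¹ * ((ψ p.1 * (1 + ‖p.1‖) ^ δ) * (B p.2 * (1 + ‖p.2‖) ^ δ))) (volume.prod volume) :=
    (hψw.mul_prod hB).const_mul _
  refine (i1.norm.add i2.norm).mono' ?_ (ae_of_all _ fun p => ?_)
  · refine hψm.comp_fst.mul (hBm.comp_snd.mul ?_)
    exact (Real.measurable_log.comp (measurable_norm.comp
      (measurable_fst.sub measurable_snd))).aestronglyMeasurable
  · obtain ⟨x, y⟩ := p
    simp only [Pi.add_apply, norm_mul, Real.norm_eq_abs, abs_of_nonneg hM0,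
      abs_of_nonneg (logKernel_nonneg _), abs_of_pos (inv_pos.2 hδ),
      abs_of_nonneg (show 0 ≤ (1 + ‖x‖) ^ δ by positivity),
      abs_of_nonneg (show 0 ≤ (1 + ‖y‖) ^ δ by positivity)]
    have h1 := abs_log_norm_le hδ (x - y)
    have h2 : ‖x - y‖ ^ δ ≤ (1 + ‖x‖) ^ δ * (1 + ‖y‖) ^ δ := by
      rw [← Real.mul_rpow (by positivity) (by positivity)]
      refine Real.rpow_le_rpow (norm_nonneg _) ((norm_sub_le x y).trans ?_) hδ.le
      nlinarith [norm_nonneg x, norm_nonneg y, mul_nonneg (norm_nonneg x) (norm_nonneg y)]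
    have h3 : |Real.log ‖x - y‖| ≤
        logKernel (x - y) + δ⁻¹ * ((1 + ‖x‖) ^ δ * (1 + ‖y‖) ^ δ) := by
      refine h1.trans ?_
      rw [div_eq_inv_mul]
      gcongr
    calc |ψ x| * (|B y| * |Real.log ‖x - y‖|)
        ≤ |ψ x| * (|B y| * (logKernel (x - y) + δ⁻¹ * ((1 + ‖x‖) ^ δ * (1 + ‖y‖) ^ δ))) := by
          gcongr
      _ = |ψ x| * (|B y| * logKernel (x - y)) +
          δ⁻¹ * (|ψ x| * (1 + ‖x‖) ^ δ * (|B y| * (1 + ‖y‖) ^ δ)) := by ring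
      _ ≤ _ := by
        have := logKernel_nonneg (x - y)
        gcongr
        exact hM x

lemma locallyIntegrable_scalarPotential {B : Plane → ℝ} (hB : IsAdmissibleField B) :
    LocallyIntegrable (scalarPotential B) := by
  obtain ⟨δ, hδ, hBi⟩ := hB.exists_integrable_weight
  refine locallyIntegrable_iff.2 fun K hK => ?_
  obtain ⟨R, hR⟩ := hK.isBounded.subset_closedBall (0 : Plane)
  refine IntegrableOn.mono_set ?_ hR
  have hms : MeasurableSet (Metric.closedBall (0 : Plane) R) :=
    Metric.isClosed_closedBall.measurableSet
  have h := integrable_log_kernel hδ hB.locallyIntegrable.aestronglyMeasurable hBi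
    (ψ := (Metric.closedBall (0 : Plane) R).indicator fun _ => 1) (M := 1) (R := R)
    (aestronglyMeasurable_const.indicator hms)
    (fun x => by classical rw [Set.indicator_apply]; split_ifs <;> simp)
    (fun x hx => Set.indicator_of_notMem (by simpa using hx) _)
  have h2 := h.integral_prod_left.const_mul (-(1 / (2 * Real.pi)))
  rw [← integrable_indicator_iff hms]
  refine h2.congr (ae_of_all _ fun x => ?_)
  simp only [integral_const_mul]
  by_cases hx : x ∈ Metric.closedBall (0 : Plane) R
  · rw [Set.indicator_of_mem hx, Set.indicator_of_mem hx, one_mul, scalarPotential]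
  · rw [Set.indicator_of_notMem hx, Set.indicator_of_notMem hx, zero_mul, mul_zero]

/-- `-Δ h = B` in the sense of distributions. -/
lemma integral_scalarPotential_mul_laplacian {B : Plane → ℝ} (hB : IsAdmissibleField B)
    {φ : Plane → ℝ} (hφ : IsTestFunction φ) :
    ∫ x, scalarPotential B x * laplacian φ x = -∫ x, B x * φ x := by
  obtain ⟨δ, hδ, hBi⟩ := hB.exists_integrable_weight
  have hLc := hφ.continuous_laplacian
  have hLs := hφ.hasCompactSupport_laplacian
  obtain ⟨M, hM⟩ := hLs.exists_bound_of_continuous hLc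
  obtain ⟨R, hR⟩ := hLs.isCompact.isBounded.subset_closedBall (0 : Plane)
  have h := integrable_log_kernel hδ hB.locallyIntegrable.aestronglyMeasurable hBi
    (ψ := laplacian φ) (M := M) (R := R) hLc.aestronglyMeasurable hM
    (fun x hx => image_eq_zero_of_notMem_tsupport fun hx' => by
      have := hR hx'
      rw [mem_closedBall_zero_iff] at this
      linarith)
  have hinner : ∀ y, ∫ x, laplacian φ x * (B y * Real.log ‖x - y‖) =
      2 * Real.pi * (B y * φ y) := fun y => by
    have hφ' : IsTestFunction fun x => φ (x + y) :=
      ⟨hφ.1.comp (contDiff_id.add contDiff_const),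
        hφ.2.comp_homeomorph (Homeomorph.addRight y)⟩
    have hlap : laplacian (fun x => φ (x + y)) = fun x => laplacian φ (x + y) := by
      have : ∀ (f : Plane → ℝ) j, partialDeriv j (fun x => f (x + y)) =
          fun x => partialDeriv j f (x + y) := fun f j => by
        funext x
        simp only [partialDeriv, fderiv_comp_add_right]
      funext x
      simp only [laplacian, this]
    have h1 := integral_log_norm_mul_laplacian hφ'
    rw [hlap] at h1
    have h2 : ∫ x, Real.log ‖x‖ * laplacian φ (x + y) =
        ∫ x, Real.log ‖x - y‖ * laplacian φ x := by
      rw [← integral_sub_right_eq_self (fun x => Real.log ‖x‖ * laplacian φ (x + y)) y]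
      simp only [sub_add_cancel]
    rw [h2, zero_add] at h1
    calc ∫ x, laplacian φ x * (B y * Real.log ‖x - y‖)
        = ∫ x, B y * (Real.log ‖x - y‖ * laplacian φ x) := by
          congr 1; funext x; ring
      _ = _ := by rw [integral_const_mul, h1]; ring
  calc ∫ x, scalarPotential B x * laplacian φ x
      = ∫ x, -(1 / (2 * Real.pi)) * ∫ y, laplacian φ x * (B y * Real.log ‖x - y‖) := by
        congr 1
        funext x
        rw [scalarPotential, integral_const_mul]
        ring
    _ = -(1 / (2 * Real.pi)) * ∫ y, ∫ x, laplacian φ x * (B y * Real.log ‖x - y‖) := by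
        rw [integral_const_mul, integral_integral_swap h]
    _ = -∫ x, B x * φ x := by
        simp only [hinner]
        rw [integral_const_mul]
        have := Real.pi_ne_zero
        field_simp

/-! ### Mollification of the field and its potentials -/

/-- The convolution of `f` with the scalar kernel `η`. -/
def mollify {F : Type*} [NormedAddCommGroup F] [NormedSpace ℝ F] (η : Plane → ℝ) (f : Plane → F)
    (x : Plane) : F := ∫ t, η (x - t) • f t

section Mollify

variable {F : Type*} [NormedAddCommGroup F] [NormedSpace ℝ F] {η : Plane → ℝ} {f : Plane → F}

lemma mollify_eq_convolution (η : Plane → ℝ) (f : Plane → F) :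
    mollify η f = convolution f η (ContinuousLinearMap.lsmul ℝ ℝ).flip volume := rfl

lemma integrable_mollify (hη : IsTestFunction η) (hf : LocallyIntegrable f) (x : Plane) :
    Integrable fun t => η (x - t) • f t :=
  hη.2.convolutionExists_right (ContinuousLinearMap.lsmul ℝ ℝ).flip hf hη.continuous x

lemma contDiff_mollify (hη : IsTestFunction η) (hf : LocallyIntegrable f) :
    ContDiff ℝ ∞ (mollify η f) := by
  rw [mollify_eq_convolution]
  exact hη.2.contDiff_convolution_right _ hf hη.1

lemma partialDeriv_mollify (hη : IsTestFunction η) (hf : LocallyIntegrable f) (j : Fin 2) :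
    partialDeriv j (mollify η f) = mollify (partialDeriv j η) f := by
  funext x
  have h1 : ContDiff ℝ 1 η := hη.1.of_le (by simp)
  have h := hη.2.hasFDerivAt_convolution_right (ContinuousLinearMap.lsmul ℝ ℝ).flip hf h1 x
  rw [partialDeriv, mollify_eq_convolution, h.fderiv,
    convolution_precompR_apply _ hf (hη.2.fderiv ℝ) (h1.continuous_fderiv one_ne_zero)]
  rfl

end Mollify

/-- The reflected translate `t ↦ η (x - t)` is a test function. -/
lemma IsTestFunction.reflect {η : Plane → ℝ} (hη : IsTestFunction η) (x : Plane) :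
    IsTestFunction fun t => η (x - t) :=
  ⟨hη.1.comp (contDiff_const.sub contDiff_id),
    hη.2.comp_homeomorph (Homeomorph.subLeft x)⟩

lemma partialDeriv_reflect (η : Plane → ℝ) (x : Plane) (j : Fin 2) :
    partialDeriv j (fun t => η (x - t)) = fun t => -partialDeriv j η (x - t) := by
  funext t
  simp only [partialDeriv]
  have h := fderiv_comp_smul (𝕜 := ℝ) (f := fun z : Plane => η (z + x)) (x := t) (-1)
  simp only [neg_smul, one_smul, neg_add_eq_sub, fderiv_comp_add_right] at h
  rw [h]
  rfl

lemma laplacian_reflect (η : Plane → ℝ) (x : Plane) :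
    laplacian (fun t => η (x - t)) = fun t => laplacian η (x - t) := by
  have h : ∀ j : Fin 2, partialDeriv j (partialDeriv j fun t => η (x - t)) =
      fun t => partialDeriv j (partialDeriv j η) (x - t) := fun j => by
    rw [partialDeriv_reflect]
    funext t
    have h1 := congrFun (partialDeriv_reflect (partialDeriv j η) x j) t
    have h2 : partialDeriv j (fun t => -partialDeriv j η (x - t)) t =
        -partialDeriv j (fun t => partialDeriv j η (x - t)) t := by
      simp only [partialDeriv]
      rw [fderiv_fun_neg]
      rfl
    rw [h2, h1, neg_neg]
  funext t
  simp only [laplacian, h]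

lemma IsVectorPotential.locallyIntegrable {A : Plane → Plane} {B : Plane → ℝ}
    (hA : IsVectorPotential A B) (j : Fin 2) : LocallyIntegrable fun x => A x j := by
  have h := hA.memLpLoc.locallyIntegrable (by norm_num)
  refine h.mono ?_ (ae_of_all _ fun x => ?_)
  · exact ((EuclideanSpace.proj j : Plane →L[ℝ] ℝ).continuous.comp_aestronglyMeasurable
      h.aestronglyMeasurable)
  · exact PiLp.norm_apply_le (A x) j

/-- The distributional identity is tested against `t ↦ η(x - t)`; the reflection changes the sign of
each derivative. -/
lemma IsVectorPotential.curl_mollify {A : Plane → Plane} {B : Plane → ℝ}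
    (hA : IsVectorPotential A B) {η : Plane → ℝ} (hη : IsTestFunction η) (x : Plane) :
    mollify (partialDeriv 0 η) (fun t => A t 1) x - mollify (partialDeriv 1 η) (fun t => A t 0) x =
      mollify η B x := by
  have h := hA.curl_eq _ (hη.reflect x)
  simp only [partialDeriv_reflect] at h
  unfold mollify
  rw [← integral_sub (integrable_mollify (hη.partialDeriv 0) (hA.locallyIntegrable 1) x)
    (integrable_mollify (hη.partialDeriv 1) (hA.locallyIntegrable 0) x)]
  simp only [smul_eq_mul]
  rw [integral_congr_ae (ae_of_all _ fun t => mul_comm (η (x - t)) (B t)), ← h]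
  congr 1
  funext t
  ring

lemma laplacian_mollify_scalarPotential {B : Plane → ℝ} (hB : IsAdmissibleField B) {η : Plane → ℝ}
    (hη : IsTestFunction η) (x : Plane) :
    laplacian (mollify η (scalarPotential B)) x = -mollify η B x := by
  have hh := locallyIntegrable_scalarPotential hB
  have h := integral_scalarPotential_mul_laplacian hB (hη.reflect x)
  rw [laplacian_reflect] at h
  unfold laplacian
  rw [partialDeriv_mollify hη hh, partialDeriv_mollify hη hh,
    partialDeriv_mollify (hη.partialDeriv 0) hh, partialDeriv_mollify (hη.partialDeriv 1) hh]
  unfold mollify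
  rw [← integral_add (integrable_mollify ((hη.partialDeriv 0).partialDeriv 0) hh x)
    (integrable_mollify ((hη.partialDeriv 1).partialDeriv 1) hh x)]
  simp only [smul_eq_mul]
  rw [integral_congr_ae (ae_of_all _ fun t => mul_comm (η (x - t)) (B t)), ← h]
  congr 1
  funext t
  simp only [laplacian]
  ring

lemma fderiv_eq_partialDeriv {f : Plane → ℝ} (x v : Plane) :
    fderiv ℝ f x v = v 0 * partialDeriv 0 f x + v 1 * partialDeriv 1 f x := by
  have : v = v 0 • EuclideanSpace.single (0 : Fin 2) (1 : ℝ) +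
      v 1 • EuclideanSpace.single (1 : Fin 2) (1 : ℝ) := by
    ext i
    fin_cases i <;> simp
  conv_lhs => rw [this]
  rw [map_add, map_smul, map_smul]
  rfl

/-! ### The gauge transformation -/

/-- The Poincaré lemma in the plane. -/
lemma exists_potential {a : Fin 2 → Plane → ℝ} (ha : ∀ j, ContDiff ℝ 1 (a j))
    (hcurl : ∀ x, partialDeriv 0 (a 1) x = partialDeriv 1 (a 0) x) :
    ∃ χ : Plane → ℝ, ContDiff ℝ 1 χ ∧ ∀ j x, partialDeriv j χ x = a j x := by
  set P : Fin 2 → Plane →L[ℝ] ℝ := fun j => EuclideanSpace.proj j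
  have hP : ∀ j v, P j v = v j := fun _ _ => rfl
  set θ : Plane → Plane →L[ℝ] ℝ := fun x => a 0 x • P 0 + a 1 x • P 1
  have hθd : ∀ x, HasFDerivAt θ ((fderiv ℝ (a 0) x).smulRight (P 0) +
      (fderiv ℝ (a 1) x).smulRight (P 1)) x := fun x =>
    (((ha 0).differentiable one_ne_zero x).hasFDerivAt.smul_const (P 0)).add
      (((ha 1).differentiable one_ne_zero x).hasFDerivAt.smul_const (P 1))
  obtain ⟨χ, hχ⟩ := (convex_univ (𝕜 := ℝ) (E := Plane)).exists_forall_hasFDerivAt_of_fderiv_symmetric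
    isOpen_univ (show DifferentiableOn ℝ θ Set.univ from
      fun x _ => (hθd x).differentiableAt.differentiableWithinAt)
    (fun x _ v w => by
      rw [(hθd x).fderiv]
      simp only [add_apply, ContinuousLinearMap.smulRight_apply,
        smul_apply, smul_eq_mul, fderiv_eq_partialDeriv x, hcurl x, hP]
      ring)
  have hf : ∀ x, fderiv ℝ χ x = θ x := fun x => (hχ x trivial).fderiv
  refine ⟨χ, ?_, fun j x => ?_⟩
  · rw [contDiff_one_iff_fderiv]
    refine ⟨fun x => (hχ x trivial).differentiableAt, ?_⟩
    rw [show fderiv ℝ χ = θ from funext hf]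
    have := (ha 0).continuous
    have := (ha 1).continuous
    fun_prop
  · rw [partialDeriv, hf]
    fin_cases j <;> simp [θ, P]

/-- The complexified combination `A₁ + i s A₂`. -/
def complexPotential (s : ℤ) (A : Plane → Plane) (x : Plane) : ℂ :=
  (A x 0 : ℂ) + Complex.I * s * (A x 1 : ℂ)

lemma partialDeriv_cexp_mul {χ h : Plane → ℝ} {u : Plane → ℂ} (hχ : ContDiff ℝ 1 χ)
    (hh : ContDiff ℝ 1 h) (hu : ContDiff ℝ 1 u) (s : ℤ) (j : Fin 2) (x : Plane) :
    partialDeriv j (fun x => Complex.exp (-(Complex.I * χ x + s * h x)) * u x) x =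
      Complex.exp (-(Complex.I * χ x + s * h x)) * (partialDeriv j u x -
        (Complex.I * partialDeriv j χ x + s * partialDeriv j h x) * u x) := by
  have h1 : HasFDerivAt (fun x => (χ x : ℂ)) _ x :=
    Complex.ofRealCLM.hasFDerivAt.comp x (hχ.differentiable one_ne_zero x).hasFDerivAt
  have h2 : HasFDerivAt (fun x => (h x : ℂ)) _ x :=
    Complex.ofRealCLM.hasFDerivAt.comp x (hh.differentiable one_ne_zero x).hasFDerivAt
  have h3 := (((h1.const_mul Complex.I).add (h2.const_mul (s : ℂ))).fun_neg.cexp).mul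
    (hu.differentiable one_ne_zero x).hasFDerivAt
  have h4 : HasFDerivAt (fun x => Complex.exp (-(Complex.I * χ x + s * h x)) * u x) _ x := h3
  rw [partialDeriv, h4.fderiv]
  simp [partialDeriv]
  ring

/-- The mollified potential is smooth with curl `η * B = -Δ(η * h)`, so the classical factorization
of the Pauli operator applies to it. The bounds on `exp(s(η * h))` are hypotheses here and are later
derived from those on `exp(sh)`. -/
theorem lintegral_mollified {B : Plane → ℝ} (hB : IsAdmissibleField B) {A : Plane → Plane}
    (hA : IsVectorPotential A B) {α ρ : ℝ} (hρ : 0 < ρ) (hα : α ≠ 0) {s : ℤ} (hs : s = 1 ∨ s = -1)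
    {η : Plane → ℝ} (hη : IsTestFunction η) {k K : ℝ} (hk : 0 < k) (hK : 0 < K)
    (hlow : ∀ x, k * growth |α| ρ ‖x‖ ≤ Real.exp (s * mollify η (scalarPotential B) x))
    (hupp : ∀ x, Real.exp (s * mollify η (scalarPotential B) x) ≤ K * growth |α| ρ ‖x‖)
    {u : Plane → ℂ} (hu : ContDiff ℝ 1 u) (hsupp : HasCompactSupport u) :
    ENNReal.ofReal ((k / K) ^ 2) * ∫⁻ x, ENNReal.ofReal (radialWeight α ρ ‖x‖ * ‖u x‖ ^ 2) ≤
      ∫⁻ x, ENNReal.ofReal (‖Complex.I * dbar s u x +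
        mollify η (complexPotential s A) x * u x‖ ^ 2) := by
  set h := mollify η (scalarPotential B) with hh
  have hhl := locallyIntegrable_scalarPotential hB
  have hh1 : ContDiff ℝ ∞ h := contDiff_mollify hη hhl
  have hdh : ∀ j, partialDeriv j h = mollify (partialDeriv j η) (scalarPotential B) :=
    partialDeriv_mollify hη hhl
  have hdh1 : ∀ j, ContDiff ℝ ∞ (partialDeriv j h) := fun j => by
    rw [hdh]; exact contDiff_mollify (hη.partialDeriv j) hhl
  set a : Fin 2 → Plane → ℝ := fun j => mollify η fun t => A t j with ha
  have ha1 : ∀ j, ContDiff ℝ ∞ (a j) := fun j => contDiff_mollify hη (hA.locallyIntegrable j)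
  have hωa : ∀ x, mollify η (complexPotential s A) x = a 0 x + Complex.I * s * a 1 x := fun x => by
    simp only [a, mollify]
    rw [← integral_complex_ofReal, ← integral_complex_ofReal, ← integral_const_mul, ← integral_add
      (integrable_mollify hη (hA.locallyIntegrable 0) x).ofReal
      ((integrable_mollify hη (hA.locallyIntegrable 1) x).ofReal.const_mul _)]
    congr 1
    funext t
    simp only [complexPotential, Complex.real_smul, smul_eq_mul]
    push_cast
    ring
  -- Subtracting `(∂₂h, -∂₁h)`, whose curl is `-Δh`, leaves a closed field.
  obtain ⟨χ, hχ, hdχ⟩ := exists_potential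
    (a := ![fun x => a 0 x - partialDeriv 1 h x, fun x => a 1 x + partialDeriv 0 h x])
    (by
      intro j
      fin_cases j
      · exact ((ha1 0).sub (hdh1 1)).of_le (by simp)
      · exact ((ha1 1).add (hdh1 0)).of_le (by simp))
    (by
      intro x
      have hd : ∀ {f : Plane → ℝ}, ContDiff ℝ ∞ f → DifferentiableAt ℝ f x := fun hf =>
        (hf.differentiable (by simp)) x
      have e1 : partialDeriv 0 (fun x => a 1 x + partialDeriv 0 h x) x =
          partialDeriv 0 (a 1) x + partialDeriv 0 (partialDeriv 0 h) x := by
        rw [partialDeriv, fderiv_fun_add (hd (ha1 1)) (hd (hdh1 0))]; rfl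
      have e2 : partialDeriv 1 (fun x => a 0 x - partialDeriv 1 h x) x =
          partialDeriv 1 (a 0) x - partialDeriv 1 (partialDeriv 1 h) x := by
        rw [partialDeriv, fderiv_fun_sub (hd (ha1 0)) (hd (hdh1 1))]; rfl
      have e3 := hA.curl_mollify hη x
      have e4 := laplacian_mollify_scalarPotential hB hη x
      rw [← partialDeriv_mollify hη (hA.locallyIntegrable 1),
        ← partialDeriv_mollify hη (hA.locallyIntegrable 0)] at e3
      simp only [Matrix.cons_val_zero, Matrix.cons_val_one]
      rw [e1, e2]
      simp only [laplacian, ← hh] at e4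
      linarith)
  have hχ0 : ∀ x, partialDeriv 0 χ x = a 0 x - partialDeriv 1 h x := hdχ 0
  have hχ1 : ∀ x, partialDeriv 1 χ x = a 1 x + partialDeriv 0 h x := hdχ 1
  set v : Plane → ℂ := fun x => Complex.exp (-(Complex.I * χ x + s * h x)) * u x with hv
  have hh1' : ContDiff ℝ 1 h := hh1.of_le (by simp)
  have hv1 : ContDiff ℝ 1 v := by
    have c1 : ContDiff ℝ 1 fun x => (χ x : ℂ) := Complex.ofRealCLM.contDiff.comp hχ
    have c2 : ContDiff ℝ 1 fun x => (h x : ℂ) := Complex.ofRealCLM.contDiff.comp hh1'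
    exact ((contDiff_const.mul c1).add (contDiff_const.mul c2)).neg.cexp.mul hu
  have hvs : HasCompactSupport v := hsupp.mul_left
  have hexp : ∀ x, ‖Complex.exp (-(Complex.I * χ x + s * h x))‖ = Real.exp (-(s * h x)) := fun x => by
    rw [Complex.norm_exp]
    simp
  have hs2 : (s : ℂ) ^ 2 = 1 := by rcases hs with rfl | rfl <;> norm_num
  have hTu : ∀ x, ‖Complex.I * dbar s u x + mollify η (complexPotential s A) x * u x‖ =
      Real.exp (s * h x) * ‖dbar s v x‖ := fun x => by
    -- The gradient of `χ` cancels up to the terms in `∇h`, and those cancel against `s∇h` because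
    -- `s² = 1`.
    have e : dbar s v x = Complex.exp (-(Complex.I * χ x + s * h x)) * (-Complex.I *
        (Complex.I * dbar s u x + mollify η (complexPotential s A) x * u x)) := by
      rw [hωa, dbar, dbar, hv, partialDeriv_cexp_mul hχ hh1' hu,
        partialDeriv_cexp_mul hχ hh1' hu, hχ0, hχ1]
      push_cast
      have hI := Complex.I_sq
      generalize ((partialDeriv 0 h x : ℝ) : ℂ) = h0
      generalize ((partialDeriv 1 h x : ℝ) : ℂ) = h1
      generalize partialDeriv 0 u x = u0
      generalize partialDeriv 1 u x = u1
      generalize Complex.exp (-(Complex.I * χ x + s * h x)) = E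
      linear_combination (E * (u0 + Complex.I * s * u1) - E * s * u x * h0) * hI +
        (-E * Complex.I * h1 * u x) * hs2
    rw [e, norm_mul, hexp, norm_mul, norm_neg, Complex.norm_I, one_mul, ← mul_assoc, ← Real.exp_add]
    simp
  have hu' : ∀ x, ‖u x‖ = Real.exp (s * h x) * ‖v x‖ := fun x => by
    rw [hv, norm_mul, hexp, ← mul_assoc, ← Real.exp_add]
    simp
  have hmain := lintegral_radialWeight_le_dbar hρ hα hs hv1 hvs
  have hg : ∀ x : Plane, 0 < growth |α| ρ ‖x‖ := fun x => growth_pos _ hρ _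
  calc ENNReal.ofReal ((k / K) ^ 2) * ∫⁻ x, ENNReal.ofReal (radialWeight α ρ ‖x‖ * ‖u x‖ ^ 2)
      = ∫⁻ x, ENNReal.ofReal ((k / K) ^ 2 * (radialWeight α ρ ‖x‖ * ‖u x‖ ^ 2)) := by
        rw [← lintegral_const_mul' _ _ ENNReal.ofReal_ne_top]
        refine lintegral_congr fun x => ?_
        rw [← ENNReal.ofReal_mul (by positivity)]
    _ ≤ ∫⁻ x, ENNReal.ofReal (k ^ 2 *
          (radialWeight α ρ ‖x‖ * growth |α| ρ ‖x‖ ^ 2 * ‖v x‖ ^ 2)) := by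
        refine lintegral_mono fun x => ENNReal.ofReal_le_ofReal ?_
        have h1 : ‖u x‖ ^ 2 ≤ (K * growth |α| ρ ‖x‖ * ‖v x‖) ^ 2 := by
          rw [hu']
          exact pow_le_pow_left₀ (by positivity)
            (mul_le_mul_of_nonneg_right (hupp x) (norm_nonneg _)) 2
        have hW := radialWeight_nonneg (α := α) hρ ‖x‖
        calc (k / K) ^ 2 * (radialWeight α ρ ‖x‖ * ‖u x‖ ^ 2)
            ≤ (k / K) ^ 2 * (radialWeight α ρ ‖x‖ * (K * growth |α| ρ ‖x‖ * ‖v x‖) ^ 2) := by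
              gcongr
          _ = _ := by field_simp
    _ = ENNReal.ofReal (k ^ 2) * ∫⁻ x, ENNReal.ofReal
          (radialWeight α ρ ‖x‖ * growth |α| ρ ‖x‖ ^ 2 * ‖v x‖ ^ 2) := by
        rw [← lintegral_const_mul' _ _ ENNReal.ofReal_ne_top]
        refine lintegral_congr fun x => ?_
        rw [← ENNReal.ofReal_mul (by positivity)]
    _ ≤ ENNReal.ofReal (k ^ 2) * ∫⁻ x, ENNReal.ofReal (growth |α| ρ ‖x‖ ^ 2 * ‖dbar s v x‖ ^ 2) := by
        gcongr
    _ = ∫⁻ x, ENNReal.ofReal (k ^ 2 * (growth |α| ρ ‖x‖ ^ 2 * ‖dbar s v x‖ ^ 2)) := by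
        rw [← lintegral_const_mul' _ _ ENNReal.ofReal_ne_top]
        refine lintegral_congr fun x => ?_
        rw [← ENNReal.ofReal_mul (by positivity)]
    _ ≤ _ := by
        refine lintegral_mono fun x => ENNReal.ofReal_le_ofReal ?_
        have := hg x
        rw [hTu, ← mul_pow, ← mul_pow, ← mul_assoc]
        exact pow_le_pow_left₀ (by positivity)
          (mul_le_mul_of_nonneg_right (hlow x) (norm_nonneg _)) 2

/-! ### Mollifiers, Jensen's inequality and translations -/

lemma ofReal_norm_sq {E : Type*} [SeminormedAddCommGroup E] (z : E) :
    ENNReal.ofReal (‖z‖ ^ 2) = ‖z‖ₑ ^ 2 := by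
  rw [ENNReal.ofReal_pow (norm_nonneg _), ofReal_norm]

lemma eLpNorm_two_sq {X E : Type*} [MeasurableSpace X] [NormedAddCommGroup E] (f : X → E)
    (μ : Measure X) : eLpNorm f 2 μ ^ 2 = ∫⁻ x, ‖f x‖ₑ ^ 2 ∂μ := by
  have h := eLpNorm_nnreal_pow_eq_lintegral (f := f) (μ := μ) (p := 2) two_ne_zero
  norm_num at h
  exact_mod_cast h

lemma sq_lintegral_le {X : Type*} [MeasurableSpace X] (μ : Measure X) [IsProbabilityMeasure μ]
    {f : X → ℝ≥0∞} (hf : AEMeasurable f μ) : (∫⁻ x, f x ∂μ) ^ 2 ≤ ∫⁻ x, f x ^ 2 ∂μ := by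
  have h := ENNReal.lintegral_mul_le_Lp_mul_Lq μ Real.HolderConjugate.two_two hf
    (aemeasurable_const (b := (1 : ℝ≥0∞)))
  simp only [Pi.mul_apply, mul_one, ENNReal.one_rpow, lintegral_const, measure_univ] at h
  calc (∫⁻ x, f x ∂μ) ^ 2 ≤ ((∫⁻ x, f x ^ (2 : ℝ) ∂μ) ^ (1 / 2 : ℝ)) ^ 2 := by gcongr
    _ = ∫⁻ x, f x ^ 2 ∂μ := by
      rw [← ENNReal.rpow_natCast, ← ENNReal.rpow_mul]
      norm_num

/-- A smooth probability density supported in the ball of radius `ε`. -/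
structure IsMollifier (η : Plane → ℝ) (ε : ℝ) : Prop where
  test : IsTestFunction η
  nonneg : ∀ x, 0 ≤ η x
  integral_eq : ∫ x, η x = 1
  eq_zero : ∀ x, ε ≤ ‖x‖ → η x = 0

lemma exists_isMollifier {ε : ℝ} (hε : 0 < ε) : ∃ η, IsMollifier η ε := by
  let b : ContDiffBump (0 : Plane) := ⟨ε / 2, ε, by positivity, by linarith⟩
  refine ⟨b.normed volume, ⟨b.contDiff_normed, b.hasCompactSupport_normed⟩, b.nonneg_normed,
    b.integral_normed, fun x hx => ?_⟩
  have h : x ∉ Function.support (b.normed volume) := by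
    rw [b.support_normed_eq, mem_ball_zero_iff, not_lt]
    exact hx
  exact Function.notMem_support.1 h

lemma IsMollifier.integral_reflect {η : Plane → ℝ} {ε : ℝ} (h : IsMollifier η ε) (x : Plane) :
    ∫ t, η (x - t) = 1 := by
  rw [integral_sub_left_eq_self, h.integral_eq]

lemma IsMollifier.mollify_le {η : Plane → ℝ} {ε : ℝ} (h : IsMollifier η ε) {f G : Plane → ℝ}
    (hf : LocallyIntegrable f) {c C : ℝ} (hG : ∀ x y, G x - G y ≤ C * ‖y - x‖) (hC : 0 ≤ C)
    (hfG : ∀ x, f x ≤ c + G x) (x : Plane) : mollify η f x ≤ c + G x + C * ε := by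
  have hi : Integrable fun t => η (x - t) * (c + G x + C * ε) :=
    ((h.test.reflect x).continuous.integrable_of_hasCompactSupport (h.test.reflect x).2).mul_const _
  calc mollify η f x ≤ ∫ t, η (x - t) * (c + G x + C * ε) := by
        refine integral_mono (integrable_mollify h.test hf x) hi fun t => ?_
        simp only [smul_eq_mul]
        rcases le_or_gt ε ‖x - t‖ with ht | ht
        · rw [h.eq_zero _ ht, zero_mul, zero_mul]
        · have h1 := hfG t
          have h2 := hG t x
          have h3 : C * ‖x - t‖ ≤ C * ε := by gcongr
          exact mul_le_mul_of_nonneg_left (by linarith) (h.nonneg _)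
    _ = _ := by rw [integral_mul_const, h.integral_reflect, one_mul]

lemma log_growth {a ρ : ℝ} (hρ : 0 < ρ) (r : ℝ) :
    Real.log (growth a ρ r) = a * Real.log (max r ρ / ρ) := by
  rw [growth_eq_max hρ, Real.log_rpow (by positivity)]

/-- Truncating the radius below at `ρ` makes its logarithm Lipschitz with constant `1/ρ`. Averaging
over a ball of radius `ε` then moves `log g` by at most `aε/ρ`. -/
lemma log_growth_sub_le {a ρ : ℝ} (ha : 0 ≤ a) (hρ : 0 < ρ) (x y : Plane) :
    Real.log (growth a ρ ‖x‖) - Real.log (growth a ρ ‖y‖) ≤ a / ρ * ‖y - x‖ := by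
  rw [log_growth hρ, log_growth hρ, ← mul_sub, div_mul_eq_mul_div, mul_div_assoc]
  refine mul_le_mul_of_nonneg_left ?_ ha
  have hx : 0 < max ‖x‖ ρ := lt_max_of_lt_right hρ
  have hy : 0 < max ‖y‖ ρ := lt_max_of_lt_right hρ
  rw [← Real.log_div (by positivity) (by positivity),
    show max ‖x‖ ρ / ρ / (max ‖y‖ ρ / ρ) = max ‖x‖ ρ / max ‖y‖ ρ by field_simp]
  have h1 := Real.log_le_sub_one_of_pos (div_pos hx hy)
  have h2 : max ‖x‖ ρ - max ‖y‖ ρ ≤ ‖y - x‖ := by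
    have : ‖x‖ - ‖y‖ ≤ ‖y - x‖ := by rw [norm_sub_rev]; exact norm_sub_norm_le x y
    have h0 := norm_nonneg (y - x)
    rcases max_cases ‖x‖ ρ with ⟨h, _⟩ | ⟨h, _⟩ <;> rw [h]
    · linarith [le_max_left ‖y‖ ρ]
    · linarith [le_max_right ‖y‖ ρ]
  calc Real.log (max ‖x‖ ρ / max ‖y‖ ρ) ≤ (max ‖x‖ ρ - max ‖y‖ ρ) / max ‖y‖ ρ := by
        rw [sub_div, div_self hy.ne']; exact h1
    _ ≤ ‖y - x‖ / max ‖y‖ ρ := by gcongr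
    _ ≤ ‖y - x‖ / ρ := by gcongr; exact le_max_right _ _

lemma mollify_const_mul (η : Plane → ℝ) (f : Plane → ℝ) (c : ℝ) (x : Plane) :
    mollify η (fun t => c * f t) x = c * mollify η f x := by
  unfold mollify
  rw [← integral_const_mul]
  congr 1
  funext t
  simp only [smul_eq_mul]
  ring

/-- In logarithmic form both bounds are linear in `f`, so they survive averaging up to the
oscillation of `log g` over a ball of radius `ε`. The lower bound is the upper bound for `-s f`. -/
lemma IsMollifier.exp_mollify_bounds {η : Plane → ℝ} {ε : ℝ} (h : IsMollifier η ε) {f : Plane → ℝ}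
    (hf : LocallyIntegrable f) {a ρ k K : ℝ} (ha : 0 ≤ a) (hρ : 0 < ρ) (hk : 0 < k) (hK : 0 < K)
    {s : ℤ} (hlow : ∀ x, k * growth a ρ ‖x‖ ≤ Real.exp (s * f x))
    (hupp : ∀ x, Real.exp (s * f x) ≤ K * growth a ρ ‖x‖) (x : Plane) :
    k * Real.exp (-(a / ρ * ε)) * growth a ρ ‖x‖ ≤ Real.exp (s * mollify η f x) ∧
      Real.exp (s * mollify η f x) ≤ K * Real.exp (a / ρ * ε) * growth a ρ ‖x‖ := by
  have hg : ∀ x : Plane, 0 < growth a ρ ‖x‖ := fun x => growth_pos _ hρ _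
  have hC : 0 ≤ a / ρ := by positivity
  have hfs : ∀ c : ℝ, LocallyIntegrable fun t => c * f t := fun c => hf.smul c
  constructor
  · have h1 := h.mollify_le (f := fun t => (-s : ℝ) * f t) (hfs _) (c := -Real.log k)
      (G := fun x => -Real.log (growth a ρ ‖x‖)) (C := a / ρ)
      (fun x y => by
        have := log_growth_sub_le ha hρ y x
        rw [norm_sub_rev] at this
        linarith) hC (fun x => by
        have h2 := Real.log_le_log (mul_pos hk (hg x)) (hlow x)
        rw [Real.log_exp, Real.log_mul hk.ne' (hg x).ne'] at h2
        linarith) x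
    rw [mollify_const_mul] at h1
    calc k * Real.exp (-(a / ρ * ε)) * growth a ρ ‖x‖
        = Real.exp (Real.log k + -(a / ρ * ε) + Real.log (growth a ρ ‖x‖)) := by
          rw [Real.exp_add, Real.exp_add, Real.exp_log hk, Real.exp_log (hg x)]
      _ ≤ _ := Real.exp_le_exp.2 (by linarith)
  · have h1 := h.mollify_le (f := fun t => (s : ℝ) * f t) (hfs _) (c := Real.log K)
      (G := fun x => Real.log (growth a ρ ‖x‖)) (C := a / ρ)
      (fun x y => log_growth_sub_le ha hρ x y) hC (fun x => by
        have h2 := Real.log_le_log (Real.exp_pos _) (hupp x)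
        rwa [Real.log_exp, Real.log_mul hK.ne' (hg x).ne'] at h2) x
    rw [mollify_const_mul] at h1
    calc _ ≤ Real.exp (Real.log K + a / ρ * ε + Real.log (growth a ρ ‖x‖)) :=
          Real.exp_le_exp.2 (by linarith)
      _ = _ := by
          rw [Real.exp_add, Real.exp_add, Real.exp_log hK, Real.exp_log (hg x)]

/-- Jensen's inequality for mollifications. -/
lemma IsMollifier.enorm_add_mollify_mul_sq_le {η : Plane → ℝ} {ε : ℝ} (h : IsMollifier η ε)
    {f : Plane → ℂ} (hf : LocallyIntegrable f) (hfm : StronglyMeasurable f) (a c : ℂ) (x : Plane) :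
    ‖a + mollify η f x * c‖ₑ ^ 2 ≤ ∫⁻ y, ENNReal.ofReal (η y) * ‖a + f (x - y) * c‖ₑ ^ 2 := by
  have hηm : Measurable fun y => ENNReal.ofReal (η y) := h.test.continuous.measurable.ennreal_ofReal
  -- The kernel is a probability density, so the mollified expression is a mean of translated ones
  -- and the square of the mean is at most the mean of the squares.
  set μ : Measure Plane := volume.withDensity fun y => ENNReal.ofReal (η y)
  have hηi : Integrable η := h.test.continuous.integrable_of_hasCompactSupport h.test.2
  have : IsProbabilityMeasure μ := ⟨by
    rw [withDensity_apply _ MeasurableSet.univ, Measure.restrict_univ,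
      ← ofReal_integral_eq_lintegral_ofReal hηi (ae_of_all _ h.nonneg), h.integral_eq,
      ENNReal.ofReal_one]⟩
  have hFm : Measurable fun y => ‖a + f (x - y) * c‖ₑ := by
    have : StronglyMeasurable fun y => f (x - y) :=
      hfm.comp_measurable (measurable_const.sub measurable_id)
    exact (((this.mul_const c).const_add a).measurable).enorm
  have hint : Integrable fun y => η y • f (x - y) := by
    have := (integrable_mollify h.test hf x).comp_sub_left x
    simpa using this
  have e : a + mollify η f x * c = ∫ y, η y • (a + f (x - y) * c) := by
    have e1 : mollify η f x = ∫ y, η y • f (x - y) := by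
      unfold mollify
      rw [← integral_sub_left_eq_self (fun y => η y • f (x - y)) volume x]
      simp only [sub_sub_cancel]
    have e2 : ∀ y, η y • (a + f (x - y) * c) = η y • a + (η y • f (x - y)) * c := fun y => by
      rw [smul_add, smul_mul_assoc]
    simp only [e2]
    rw [integral_add (hηi.smul_const a) (hint.mul_const c), integral_smul_const, h.integral_eq,
      one_smul, integral_mul_const, e1]
  calc ‖a + mollify η f x * c‖ₑ ^ 2 ≤ (∫⁻ y, ‖η y • (a + f (x - y) * c)‖ₑ) ^ 2 := by
        rw [e]
        gcongr
        exact enorm_integral_le_lintegral_enorm _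
    _ = (∫⁻ y, ‖a + f (x - y) * c‖ₑ ∂μ) ^ 2 := by
        rw [lintegral_withDensity_eq_lintegral_mul _ hηm hFm]
        congr 1
        refine lintegral_congr fun y => ?_
        rw [Pi.mul_apply, enorm_smul, Real.enorm_eq_ofReal (h.nonneg y)]
    _ ≤ ∫⁻ y, ‖a + f (x - y) * c‖ₑ ^ 2 ∂μ := sq_lintegral_le μ hFm.aemeasurable
    _ = _ := by
        rw [lintegral_withDensity_eq_lintegral_mul _ hηm (hFm.pow_const 2)]
        rfl

/-- Jensen followed by Tonelli reduces mollification to small translations. It is used with `f` the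
potential, and again with `a = -f`, `c = 1` to get convergence of mollifications in `L²`. -/
lemma IsMollifier.lintegral_mollify_le {η : Plane → ℝ} {ε : ℝ} (h : IsMollifier η ε)
    {f : Plane → ℂ} (hf : LocallyIntegrable f) (hfm : StronglyMeasurable f) {a c : Plane → ℂ}
    (ha : StronglyMeasurable a) (hc : StronglyMeasurable c) {M : ℝ≥0∞}
    (hM : ∀ y, ‖y‖ < ε → ∫⁻ x, ‖a x + f (x - y) * c x‖ₑ ^ 2 ≤ M) :
    ∫⁻ x, ‖a x + mollify η f x * c x‖ₑ ^ 2 ≤ M := by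
  have hηi : Integrable η := h.test.continuous.integrable_of_hasCompactSupport h.test.2
  have hηm : Measurable fun y => ENNReal.ofReal (η y) := h.test.continuous.measurable.ennreal_ofReal
  calc ∫⁻ x, ‖a x + mollify η f x * c x‖ₑ ^ 2
      ≤ ∫⁻ x, ∫⁻ y, ENNReal.ofReal (η y) * ‖a x + f (x - y) * c x‖ₑ ^ 2 :=
        lintegral_mono fun x => h.enorm_add_mollify_mul_sq_le hf hfm _ _ x
    _ = ∫⁻ y, ∫⁻ x, ENNReal.ofReal (η y) * ‖a x + f (x - y) * c x‖ₑ ^ 2 := by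
        refine lintegral_lintegral_swap ?_
        refine Measurable.aemeasurable ?_
        have h1 : StronglyMeasurable fun p : Plane × Plane => a p.1 + f (p.1 - p.2) * c p.1 :=
          (ha.comp_measurable measurable_fst).add
            ((hfm.comp_measurable (measurable_fst.sub measurable_snd)).mul
              (hc.comp_measurable measurable_fst))
        exact (hηm.comp measurable_snd).mul (h1.measurable.enorm.pow_const 2)
    _ = ∫⁻ y, ENNReal.ofReal (η y) * ∫⁻ x, ‖a x + f (x - y) * c x‖ₑ ^ 2 :=
        lintegral_congr fun y => lintegral_const_mul' _ _ ENNReal.ofReal_ne_top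
    _ ≤ ∫⁻ y, ENNReal.ofReal (η y) * M := by
        refine lintegral_mono fun y => ?_
        rcases le_or_gt ε ‖y‖ with hy | hy
        · simp [h.eq_zero y hy]
        · exact mul_le_mul_right (hM y hy) _
    _ = M := by
        rw [lintegral_mul_const _ hηm, ← ofReal_integral_eq_lintegral_ofReal hηi
          (ae_of_all _ h.nonneg), h.integral_eq, ENNReal.ofReal_one, one_mul]

/-- A change of variables moves the translation from `f` to the continuous functions `a` and `c`.
Dominated convergence then applies, with majorant a multiple of `1 + ‖f‖` on a fixed ball. -/
lemma tendsto_lintegral_translate {f : Plane → ℂ} (hf : MemLpLoc f 2) (hfm : StronglyMeasurable f)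
    {a c : Plane → ℂ}
    (ha : Continuous a) (hc : Continuous c) (has : HasCompactSupport a) (hcs : HasCompactSupport c) :
    Tendsto (fun y => ∫⁻ x, ‖a x + f (x - y) * c x‖ₑ ^ 2) (𝓝 0)
      (𝓝 (∫⁻ x, ‖a x + f x * c x‖ₑ ^ 2)) := by
  have hshift : ∀ y, ∫⁻ x, ‖a x + f (x - y) * c x‖ₑ ^ 2 =
      ∫⁻ x, ‖a (x + y) + f x * c (x + y)‖ₑ ^ 2 := fun y => by
    rw [← lintegral_add_right_eq_self (fun x => ‖a x + f (x - y) * c x‖ₑ ^ 2) y]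
    simp only [add_sub_cancel_right]
  simp only [hshift]
  obtain ⟨M1, hM1⟩ := has.exists_bound_of_continuous ha
  obtain ⟨M2, hM2⟩ := hcs.exists_bound_of_continuous hc
  obtain ⟨R, hR⟩ := (has.isCompact.union hcs.isCompact).isBounded.subset_closedBall (0 : Plane)
  set M := max M1 M2
  set K := Metric.closedBall (0 : Plane) (R + 1)
  have hKm : MeasurableSet K := Metric.isClosed_closedBall.measurableSet
  have hK : IsCompact K := isCompact_closedBall _ _
  set b : Plane → ℝ := K.indicator fun x => M * (1 + ‖f x‖) with hb
  have hbL : MemLp b 2 volume := by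
    rw [hb, memLp_indicator_iff_restrict hKm]
    have : IsFiniteMeasure (volume.restrict K) := ⟨by simpa using hK.measure_lt_top⟩
    exact ((memLp_const (1 : ℝ)).add (hf K hK).norm).const_mul M
  have hM0 : 0 ≤ M := (norm_nonneg _).trans ((hM1 0).trans (le_max_left _ _))
  have hlim : ∀ x, Tendsto (fun y => ‖a (x + y) + f x * c (x + y)‖ₑ ^ 2) (𝓝 0)
      (𝓝 (‖a x + f x * c x‖ₑ ^ 2)) := fun x => by
    have : Continuous fun y => a (x + y) + f x * c (x + y) := by fun_prop
    have h := ((ENNReal.continuous_pow 2).comp this.enorm).tendsto 0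
    simpa only [Function.comp_def, add_zero] using h
  refine tendsto_lintegral_filter_of_dominated_convergence (fun x => ‖b x‖ₑ ^ 2) ?_ ?_ ?_
    (ae_of_all _ hlim)
  · refine Eventually.of_forall fun y => ?_
    have h1 : StronglyMeasurable fun x => a (x + y) + f x * c (x + y) :=
      (ha.comp (continuous_add_const y)).stronglyMeasurable.add
        (hfm.mul (hc.comp (continuous_add_const y)).stronglyMeasurable)
    exact h1.measurable.enorm.pow_const 2
  · filter_upwards [Metric.ball_mem_nhds (0 : Plane) one_pos] with y hy
    refine ae_of_all _ fun x => ?_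
    gcongr
    rw [mem_ball_zero_iff] at hy
    rw [enorm_le_iff_norm_le]
    by_cases hx : x ∈ K
    · rw [hb, Set.indicator_of_mem hx, Real.norm_of_nonneg (by positivity)]
      calc ‖a (x + y) + f x * c (x + y)‖ ≤ ‖a (x + y)‖ + ‖f x‖ * ‖c (x + y)‖ := by
            rw [← norm_mul]; exact norm_add_le _ _
        _ ≤ M + ‖f x‖ * M := by
            gcongr
            · exact (hM1 _).trans (le_max_left _ _)
            · exact (hM2 _).trans (le_max_right _ _)
        _ = _ := by ring
    · have hxy : R < ‖x + y‖ := by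
        simp only [K, mem_closedBall_zero_iff, not_le] at hx
        have := norm_sub_le (x + y) y
        rw [add_sub_cancel_right] at this
        linarith
      have h0 : x + y ∉ tsupport a ∪ tsupport c := fun h => by
        have := hR h
        rw [mem_closedBall_zero_iff] at this
        linarith
      rw [Set.mem_union, not_or] at h0
      rw [image_eq_zero_of_notMem_tsupport h0.1, image_eq_zero_of_notMem_tsupport h0.2]
      simp
  · rw [← eLpNorm_two_sq]
    exact ENNReal.pow_ne_top hbL.2.ne

lemma memLpLoc_complexPotential {A : Plane → Plane} (hA : MemLpLoc A 2) (s : ℤ) :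
    MemLpLoc (complexPotential s A) 2 := by
  intro K hK
  have h : ∀ j, MemLp (fun x => A x j) 2 (volume.restrict K) := fun j =>
    (hA K hK).of_le ((EuclideanSpace.proj j : Plane →L[ℝ] ℝ).continuous.comp_aestronglyMeasurable
      (hA K hK).1) (ae_of_all _ fun x => PiLp.norm_apply_le (A x) j)
  have h0 : MemLp (fun x => ((A x 0 : ℝ) : ℂ)) 2 (volume.restrict K) := (h 0).ofReal
  have h1 : MemLp (fun x => ((A x 1 : ℝ) : ℂ)) 2 (volume.restrict K) := (h 1).ofReal
  have h2 : MemLp (fun x => Complex.I * s * ((A x 1 : ℝ) : ℂ)) 2 (volume.restrict K) :=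
    h1.const_mul (Complex.I * s)
  exact h0.add h2

/-- The Pauli–Hardy inequality for smooth compactly supported functions. -/
theorem lintegral_smooth_le {B : Plane → ℝ} (hB : IsAdmissibleField B) {A : Plane → Plane}
    (hA : IsVectorPotential A B) {α ρ : ℝ} (hρ : 0 < ρ) (hα : α ≠ 0) {s : ℤ} (hs : s = 1 ∨ s = -1)
    {k K : ℝ} (hk : 0 < k) (hK : 0 < K)
    (hlow : ∀ x, k * growth |α| ρ ‖x‖ ≤ Real.exp (s * scalarPotential B x))
    (hupp : ∀ x, Real.exp (s * scalarPotential B x) ≤ K * growth |α| ρ ‖x‖)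
    {u : Plane → ℂ} (hu : ContDiff ℝ 1 u) (hsupp : HasCompactSupport u) :
    ENNReal.ofReal ((k / K) ^ 2) * ∫⁻ x, ENNReal.ofReal (radialWeight α ρ ‖x‖ * ‖u x‖ ^ 2) ≤
      ∫⁻ x, ‖Complex.I * dbar s u x + complexPotential s A x * u x‖ₑ ^ 2 := by
  set I₀ := ∫⁻ x, ENNReal.ofReal (radialWeight α ρ ‖x‖ * ‖u x‖ ^ 2)
  have hL2 := memLpLoc_complexPotential hA.memLpLoc s
  have hloc := hL2.locallyIntegrable (by norm_num)
  have hae := hloc.aestronglyMeasurable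
  -- Jensen and Tonelli above need a genuinely measurable representative of the potential.
  set f := hae.mk _
  have hfm : StronglyMeasurable f := hae.stronglyMeasurable_mk
  have hfe : complexPotential s A =ᵐ[volume] f := hae.ae_eq_mk
  have hfL2 : MemLpLoc f 2 := fun K hK => (hL2 K hK).ae_eq (ae_restrict_of_ae hfe)
  have hfloc : LocallyIntegrable f := hfL2.locallyIntegrable (by norm_num)
  have hd : Continuous (dbar s u) := continuous_dbar hu
  have hds : HasCompactSupport (dbar s u) :=
    (hsupp.fderiv_apply ℝ _).add ((hsupp.fderiv_apply ℝ _).mul_left)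
  have hT := tendsto_lintegral_translate hfL2 hfm (a := fun x => Complex.I * dbar s u x)
    (continuous_const.mul hd) hu.continuous hds.mul_left hsupp
  have hgoal : ∫⁻ x, ‖Complex.I * dbar s u x + complexPotential s A x * u x‖ₑ ^ 2 =
      ∫⁻ x, ‖Complex.I * dbar s u x + f x * u x‖ₑ ^ 2 := by
    refine lintegral_congr_ae ?_
    filter_upwards [hfe] with x hx
    rw [hx]
  rw [hgoal]
  set J := ∫⁻ x, ‖Complex.I * dbar s u x + f x * u x‖ₑ ^ 2
  refine ENNReal.le_of_forall_pos_le_add fun δ hδ hJ => ?_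
  have hev : ∀ᶠ y in 𝓝 (0 : Plane),
      ∫⁻ x, ‖Complex.I * dbar s u x + f (x - y) * u x‖ₑ ^ 2 < J + δ :=
    hT.eventually (gt_mem_nhds (ENNReal.lt_add_right hJ.ne (by simpa using hδ.ne')))
  obtain ⟨ε₀, hε₀, hball⟩ := Metric.eventually_nhds_iff.1 hev
  -- For a kernel of radius `ε < ε₀`, mollification costs `δ` on the right and the factors
  -- `exp(∓|α|ε/ρ)` in `k` and `K` on the left. The latter tend to one as `ε → 0`.
  have key : ∀ ε, 0 < ε → ε < ε₀ →
      ENNReal.ofReal ((k * Real.exp (-(|α| / ρ * ε)) / (K * Real.exp (|α| / ρ * ε))) ^ 2) * I₀ ≤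
        J + δ := fun ε hε hεε => by
    obtain ⟨η, hη⟩ := exists_isMollifier hε
    have hb := hη.exp_mollify_bounds (locallyIntegrable_scalarPotential hB) (abs_nonneg α) hρ hk hK
      hlow hupp
    refine (lintegral_mollified hB hA hρ hα hs hη.test (by positivity) (by positivity)
      (fun x => (hb x).1) (fun x => (hb x).2) hu hsupp).trans ?_
    have hm : mollify η (complexPotential s A) = mollify η f := by
      funext x
      refine integral_congr_ae ?_
      filter_upwards [hfe] with t ht
      rw [ht]
    simp only [ofReal_norm_sq, hm]
    refine hη.lintegral_mollify_le hfloc hfm (continuous_const.mul hd).stronglyMeasurable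
      hu.continuous.stronglyMeasurable fun y hy => (hball ?_).le
    rw [dist_zero_right]
    exact hy.trans hεε
  have hlim : Tendsto (fun ε : ℝ => ENNReal.ofReal
      ((k * Real.exp (-(|α| / ρ * ε)) / (K * Real.exp (|α| / ρ * ε))) ^ 2)) (𝓝[>] 0)
      (𝓝 (ENNReal.ofReal ((k / K) ^ 2))) := by
    have hc : Continuous fun ε : ℝ =>
        (k * Real.exp (-(|α| / ρ * ε)) / (K * Real.exp (|α| / ρ * ε))) ^ 2 :=
      (Continuous.div (by fun_prop) (by fun_prop) fun x => by positivity).pow 2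
    have h := (ENNReal.continuous_ofReal.comp hc).tendsto 0
    simp only [Function.comp_def, mul_zero, neg_zero, Real.exp_zero, mul_one] at h
    exact h.mono_left nhdsWithin_le_nhds
  have hlim2 := ENNReal.Tendsto.mul_const (b := I₀) hlim (Or.inl (by
    rw [ne_eq, ENNReal.ofReal_eq_zero, not_le]
    positivity))
  refine le_of_tendsto hlim2 ?_
  filter_upwards [self_mem_nhdsWithin, mem_nhdsWithin_of_mem_nhds (Iio_mem_nhds hε₀)] with ε h1 h2
  exact key ε h1 h2

/-! ### From smooth functions to truncations of `H¹` functions -/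

lemma tendsto_eLpNorm_translate_sub {f : Plane → ℂ} (hf : MemLp f 2 volume) :
    Tendsto (fun y => eLpNorm (fun x => f (x - y) - f x) 2 volume) (𝓝 0) (𝓝 0) := by
  let g : C(Plane, C(Plane, Plane)) :=
    (ContinuousMap.mk (fun a : Plane × Plane => a.2 - a.1) (by fun_prop)).curry
  have hgm : ∀ y, MeasurePreserving (g y) volume volume := fun y =>
    measurePreserving_sub_right volume y
  have h := (tendsto_const_nhds (x := hf.toLp f) (f := 𝓝 (0 : Plane))).compMeasurePreservingLp
    (g.continuous.tendsto 0) hgm (hgm 0) (by norm_num)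
  rw [Lp.tendsto_Lp_iff_tendsto_eLpNorm'] at h
  refine h.congr fun y => eLpNorm_congr_ae ?_
  have e1 := Lp.coeFn_compMeasurePreserving (hf.toLp f) (hgm y)
  have e2 := Lp.coeFn_compMeasurePreserving (hf.toLp f) (hgm 0)
  have e3 := (hgm y).quasiMeasurePreserving.ae_eq_comp hf.coeFn_toLp
  have e4 := (hgm 0).quasiMeasurePreserving.ae_eq_comp hf.coeFn_toLp
  filter_upwards [e1, e2, e3, e4] with x h1 h2 h3 h4
  rw [Pi.sub_apply, h1, h2, h3, h4]
  simp [g]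

lemma tendsto_eLpNorm_mollify_sub {f : Plane → ℂ} (hf : MemLp f 2 volume) {η : ℕ → Plane → ℝ}
    {ε : ℕ → ℝ} (hη : ∀ n, IsMollifier (η n) (ε n)) (hε : Tendsto ε atTop (𝓝 0)) :
    Tendsto (fun n => eLpNorm (fun x => mollify (η n) f x - f x) 2 volume) atTop (𝓝 0) := by
  have hfm := hf.1.stronglyMeasurable_mk
  set f' := hf.1.mk f
  have hfe : f =ᵐ[volume] f' := hf.1.ae_eq_mk
  have hf' : MemLp f' 2 volume := hf.ae_eq hfe
  have hloc : LocallyIntegrable f' := hf'.locallyIntegrable (by norm_num)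
  have hcongr : ∀ n, eLpNorm (fun x => mollify (η n) f x - f x) 2 volume =
      eLpNorm (fun x => mollify (η n) f' x - f' x) 2 volume := fun n => by
    have hm : mollify (η n) f = mollify (η n) f' := by
      funext x
      refine integral_congr_ae ?_
      filter_upwards [hfe] with t ht
      rw [ht]
    refine eLpNorm_congr_ae ?_
    filter_upwards [hfe] with x hx
    rw [hm, hx]
  simp only [hcongr]
  have ht := tendsto_eLpNorm_translate_sub hf'
  rw [ENNReal.tendsto_nhds_zero] at ht ⊢
  intro δ hδ
  obtain ⟨r, hr, hball⟩ := Metric.eventually_nhds_iff.1 (ht δ hδ)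
  filter_upwards [hε.eventually (gt_mem_nhds hr)] with n hn
  have h := (hη n).lintegral_mollify_le hloc hfm (a := fun x => -f' x) (c := fun _ => 1)
    (M := δ ^ 2) hfm.neg stronglyMeasurable_const (fun y hy => by
      have h1 := hball (y := y) (by rw [dist_zero_right]; exact hy.trans hn)
      calc ∫⁻ x, ‖-f' x + f' (x - y) * 1‖ₑ ^ 2
          = eLpNorm (fun x => f' (x - y) - f' x) 2 volume ^ 2 := by
            rw [eLpNorm_two_sq]
            simp only [mul_one, neg_add_eq_sub]
        _ ≤ δ ^ 2 := by gcongr)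
  simp only [mul_one, neg_add_eq_sub] at h
  rw [← eLpNorm_two_sq] at h
  exact (ENNReal.pow_le_pow_left_iff two_ne_zero).1 h

lemma IsH1WithGradient.partialDeriv_mollify {u : Plane → ℂ} {G : Fin 2 → Plane → ℂ}
    (hu : IsH1WithGradient u G) {η : Plane → ℝ} (hη : IsTestFunction η) (j : Fin 2) :
    partialDeriv j (mollify η u) = mollify η (G j) := by
  have hloc : LocallyIntegrable u := hu.memLp.locallyIntegrable (by norm_num)
  rw [MagneticHardy.partialDeriv_mollify hη hloc]
  funext x
  have h := hu.weak_grad j _ (hη.reflect x)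
  simp only [partialDeriv_reflect] at h
  unfold mollify
  simp only [Complex.real_smul]
  calc ∫ t, ((partialDeriv j η (x - t) : ℝ) : ℂ) * u t
      = -∫ t, u t * ((-partialDeriv j η (x - t) : ℝ) : ℂ) := by
        rw [← integral_neg]
        congr 1
        funext t
        push_cast
        ring
    _ = ∫ t, ((η (x - t) : ℝ) : ℂ) * G j t := by
        rw [h, neg_neg]
        congr 1
        funext t
        ring

/-- The operator `i(∂₁ + i s ∂₂) + (A₁ + i s A₂)` applied to `F(χ u)`, where `p` is the
gradient of `u`. -/
def truncatedOp (s : ℤ) (A : Plane → Plane) (F : ℂ → ℂ) (χ : Plane → ℝ) (u : Plane → ℂ)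
    (p : Fin 2 → Plane → ℂ) (x : Plane) : ℂ :=
  Complex.I * (fderiv ℝ F (χ x • u x) (χ x • p 0 x + partialDeriv 0 χ x • u x) +
    Complex.I * s * fderiv ℝ F (χ x • u x) (χ x • p 1 x + partialDeriv 1 χ x • u x)) +
    complexPotential s A x * F (χ x • u x)

lemma dbar_truncated (s : ℤ) {F : ℂ → ℂ} (hF : ContDiff ℝ 1 F) {χ : Plane → ℝ}
    (hχ : ContDiff ℝ 1 χ) {u : Plane → ℂ} (hu : ContDiff ℝ 1 u) (A : Plane → Plane) (x : Plane) :
    Complex.I * dbar s (fun x => F (χ x • u x)) x + complexPotential s A x * F (χ x • u x) =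
      truncatedOp s A F χ u (fun j => partialDeriv j u) x := by
  have h : ∀ j, partialDeriv j (fun x => F (χ x • u x)) x =
      fderiv ℝ F (χ x • u x) (χ x • partialDeriv j u x + partialDeriv j χ x • u x) := fun j => by
    have h1 := (hF.differentiable one_ne_zero (χ x • u x)).hasFDerivAt.comp x
      ((hχ.differentiable one_ne_zero x).hasFDerivAt.smul
        (hu.differentiable one_ne_zero x).hasFDerivAt)
    have h2 : HasFDerivAt (fun x => F (χ x • u x)) _ x := h1
    rw [partialDeriv, h2.fderiv]
    rfl
  rw [dbar, h, h, truncatedOp]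

lemma lintegral_le_of_tendsto_ae {X : Type*} [MeasurableSpace X] {μ : Measure X}
    {f : ℕ → X → ℝ≥0∞} {g : X → ℝ≥0∞} (hf : ∀ n, AEMeasurable (f n) μ)
    (hfg : ∀ᵐ x ∂μ, Tendsto (fun n => f n x) atTop (𝓝 (g x))) {c : ℕ → ℝ≥0∞} {C : ℝ≥0∞}
    (hc : Tendsto c atTop (𝓝 C)) (hle : ∀ n, ∫⁻ x, f n x ∂μ ≤ c n) : ∫⁻ x, g x ∂μ ≤ C := by
  calc ∫⁻ x, g x ∂μ = ∫⁻ x, liminf (fun n => f n x) atTop ∂μ := by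
        refine lintegral_congr_ae ?_
        filter_upwards [hfg] with x hx
        exact hx.liminf_eq.symm
    _ ≤ liminf (fun n => ∫⁻ x, f n x ∂μ) atTop := lintegral_liminf_le' hf
    _ ≤ liminf c atTop := liminf_le_liminf (Eventually.of_forall hle)
    _ = C := hc.liminf_eq

lemma norm_gradPart_le {C M₁ M₂ : ℝ} {s : ℤ} (hs : s = 1 ∨ s = -1) (L : ℂ →L[ℝ] ℂ) (hL : ‖L‖ ≤ C)
    {c d₀ d₁ : ℝ} (hc : |c| ≤ M₁) (hd₀ : |d₀| ≤ M₂) (hd₁ : |d₁| ≤ M₂) (p₀ p₁ w : ℂ) :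
    ‖Complex.I * (L (c • p₀ + d₀ • w) + Complex.I * s * L (c • p₁ + d₁ • w))‖ ≤
      C * (M₁ * (‖p₀‖ + ‖p₁‖) + 2 * M₂ * ‖w‖) := by
  have hC : 0 ≤ C := (norm_nonneg _).trans hL
  have key : ∀ {p : ℂ} {d : ℝ}, |d| ≤ M₂ → ‖L (c • p + d • w)‖ ≤ C * (M₁ * ‖p‖ + M₂ * ‖w‖) :=
    fun {p d} hd => by
      refine (L.le_opNorm _).trans ?_
      gcongr
      refine (norm_add_le _ _).trans ?_
      rw [norm_smul, norm_smul, Real.norm_eq_abs, Real.norm_eq_abs]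
      gcongr
  have hsn : ‖Complex.I * (s : ℂ)‖ = 1 := by rcases hs with rfl | rfl <;> simp
  rw [norm_mul, Complex.norm_I, one_mul]
  refine (norm_add_le _ _).trans ?_
  rw [norm_mul, hsn, one_mul]
  have h1 := key (p := p₀) hd₀
  have h2 := key (p := p₁) hd₁
  linarith

lemma aestronglyMeasurable_fderiv_apply {F : ℂ → ℂ} (hF : ContDiff ℝ 1 F) {z w : Plane → ℂ}
    (hz : AEStronglyMeasurable z volume) (hw : AEStronglyMeasurable w volume) :
    AEStronglyMeasurable (fun x => fderiv ℝ F (z x) (w x)) volume := by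
  have h1 : AEStronglyMeasurable (fun x => fderiv ℝ F (z x)) volume :=
    (hF.continuous_fderiv one_ne_zero).comp_aestronglyMeasurable hz
  exact (ContinuousLinearMap.id ℝ (ℂ →L[ℝ] ℂ)).aestronglyMeasurable_comp₂ h1 hw

lemma tendsto_eLpNorm_two_of_dominated {f : ℕ → Plane → ℂ} {g : Plane → ℂ} {b : Plane → ℝ}
    (hf : ∀ n, AEStronglyMeasurable (f n) volume) (hb : MemLp b 2 volume)
    (hfb : ∀ n, ∀ᵐ x, ‖f n x‖ ≤ b x) (hfg : ∀ᵐ x, Tendsto (fun n => f n x) atTop (𝓝 (g x))) :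
    Tendsto (fun n => eLpNorm (f n) 2 volume ^ 2) atTop (𝓝 (eLpNorm g 2 volume ^ 2)) := by
  simp only [eLpNorm_two_sq]
  refine tendsto_lintegral_of_dominated_convergence' (fun x => ‖b x‖ₑ ^ 2)
    (fun n => (hf n).enorm.pow_const 2) (fun n => ?_) ?_ ?_
  · filter_upwards [hfb n] with x hx
    gcongr
    rw [enorm_le_iff_norm_le]
    exact hx.trans (le_abs_self _)
  · rw [← eLpNorm_two_sq]
    exact ENNReal.pow_ne_top hb.2.ne
  · filter_upwards [hfg] with x hx
    exact ((ENNReal.continuous_pow 2).tendsto _).comp hx.enorm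

/-- The Pauli–Hardy inequality for the truncations `F(χ u)` of an `H¹` function `u`. -/
theorem lintegral_truncated_le {B : Plane → ℝ} (hB : IsAdmissibleField B) {A : Plane → Plane}
    (hA : IsVectorPotential A B) {α ρ : ℝ} (hρ : 0 < ρ) (hα : α ≠ 0) {s : ℤ} (hs : s = 1 ∨ s = -1)
    {k K : ℝ} (hk : 0 < k) (hK : 0 < K)
    (hlow : ∀ x, k * growth |α| ρ ‖x‖ ≤ Real.exp (s * scalarPotential B x))
    (hupp : ∀ x, Real.exp (s * scalarPotential B x) ≤ K * growth |α| ρ ‖x‖)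
    {u : Plane → ℂ} {G : Fin 2 → Plane → ℂ} (hu : IsH1WithGradient u G)
    {F : ℂ → ℂ} (hF : ContDiff ℝ 1 F) (hFs : HasCompactSupport F) (hF0 : F 0 = 0)
    {χ : Plane → ℝ} (hχ : ContDiff ℝ 1 χ) (hχs : HasCompactSupport χ) :
    ∫⁻ x, ENNReal.ofReal ((k / K) ^ 2) *
        ENNReal.ofReal (radialWeight α ρ ‖x‖ * ‖F (χ x • u x)‖ ^ 2) ≤
      ∫⁻ x, ‖truncatedOp s A F χ u G x‖ₑ ^ 2 := by
  have hε : Tendsto (fun n : ℕ => 1 / ((n : ℝ) + 1)) atTop (𝓝 0) :=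
    tendsto_one_div_add_atTop_nhds_zero_nat
  choose η hη using fun n : ℕ => exists_isMollifier (Nat.one_div_pos_of_nat (α := ℝ) (n := n))
  have huloc : LocallyIntegrable u := hu.memLp.locallyIntegrable (by norm_num)
  have hGloc : ∀ j, LocallyIntegrable (G j) := fun j =>
    (hu.memLp_grad j).locallyIntegrable (by norm_num)
  have hsm : ∀ n, ContDiff ℝ 1 (mollify (η n) u) := fun n =>
    (contDiff_mollify (hη n).test huloc).of_le (by simp)
  have hL0 := tendsto_eLpNorm_mollify_sub hu.memLp hη hε
  -- Convergence in `L²` gives a subsequence converging almost everywhere, which the nonlinear terms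
  -- `F(χw)` and `F'(χw)` require.
  obtain ⟨ns, hns, hae⟩ := (tendstoInMeasure_of_tendsto_eLpNorm (p := 2) two_ne_zero
    (fun n => (hsm n).continuous.aestronglyMeasurable) hu.memLp.1 hL0).exists_seq_tendsto_ae
  set w : ℕ → Plane → ℂ := fun n => mollify (η (ns n)) u
  set q : ℕ → Fin 2 → Plane → ℂ := fun n j => mollify (η (ns n)) (G j)
  have hw1 : ∀ n, ContDiff ℝ 1 (w n) := fun n => hsm (ns n)
  have hq : ∀ n, (fun j => partialDeriv j (w n)) = q n := fun n => by
    funext j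
    exact hu.partialDeriv_mollify (hη _).test j
  have hqc : ∀ n j, Continuous (q n j) := fun n j =>
    (contDiff_mollify (hη _).test (hGloc j)).continuous
  have hwL : Tendsto (fun n => eLpNorm (fun x => w n x - u x) 2 volume) atTop (𝓝 0) :=
    hL0.comp hns.tendsto_atTop
  have hqL : ∀ j, Tendsto (fun n => eLpNorm (fun x => q n j x - G j x) 2 volume) atTop (𝓝 0) :=
    fun j => (tendsto_eLpNorm_mollify_sub (hu.memLp_grad j) hη hε).comp hns.tendsto_atTop
  have hum := hu.memLp.1
  have hGm : ∀ j, AEStronglyMeasurable (G j) volume := fun j => (hu.memLp_grad j).1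
  have hχc := hχ.continuous
  have hdχ := fun j => continuous_partialDeriv hχ j
  have hDF := hF.continuous_fderiv one_ne_zero
  obtain ⟨C, hC⟩ := (hFs.fderiv ℝ).exists_bound_of_continuous hDF
  obtain ⟨M, hM⟩ := hFs.exists_bound_of_continuous hF.continuous
  obtain ⟨M₁, hM₁⟩ := hχs.exists_bound_of_continuous hχc
  obtain ⟨N₀, hN₀⟩ := (hχs.fderiv_apply ℝ (EuclideanSpace.single 0 1)).exists_bound_of_continuous
    (hdχ 0)
  obtain ⟨N₁, hN₁⟩ := (hχs.fderiv_apply ℝ (EuclideanSpace.single 1 1)).exists_bound_of_continuous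
    (hdχ 1)
  set M₂ := max N₀ N₁
  have hb₀ : ∀ x, |partialDeriv 0 χ x| ≤ M₂ := fun x => (hN₀ x).trans (le_max_left _ _)
  have hb₁ : ∀ x, |partialDeriv 1 χ x| ≤ M₂ := fun x => (hN₁ x).trans (le_max_right _ _)
  have hC0 : 0 ≤ C := (norm_nonneg _).trans (hC 0)
  have hM0 : 0 ≤ M := (norm_nonneg _).trans (hM 0)
  have hM₁0 : 0 ≤ M₁ := (norm_nonneg _).trans (hM₁ 0)
  have hM₂0 : 0 ≤ M₂ := (abs_nonneg _).trans (hb₀ 0)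
  have hωL2 := memLpLoc_complexPotential hA.memLpLoc s
  have hωm : AEStronglyMeasurable (complexPotential s A) volume :=
    (hωL2.locallyIntegrable (by norm_num)).aestronglyMeasurable
  -- the part of the operator that tends to zero in `L²`
  set a : ℕ → Plane → ℂ := fun n x => Complex.I *
    (fderiv ℝ F (χ x • w n x) (χ x • (q n 0 x - G 0 x) + partialDeriv 0 χ x • (w n x - u x)) +
      Complex.I * s *
      fderiv ℝ F (χ x • w n x) (χ x • (q n 1 x - G 1 x) + partialDeriv 1 χ x • (w n x - u x)))
  -- In this part the gradient is frozen at that of `u`, so the only dependence on `n` is through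
  -- the bounded continuous functions `F` and `F'` evaluated at `χ w n`.
  set b : ℕ → Plane → ℂ := fun n x => Complex.I *
    (fderiv ℝ F (χ x • w n x) (χ x • G 0 x + partialDeriv 0 χ x • u x) +
      Complex.I * s * fderiv ℝ F (χ x • w n x) (χ x • G 1 x + partialDeriv 1 χ x • u x)) +
    complexPotential s A x * F (χ x • w n x)
  have hab : ∀ n, truncatedOp s A F χ (w n) (q n) = fun x => a n x + b n x := fun n => by
    funext x
    simp only [truncatedOp, a, b]
    have e : ∀ j, χ x • q n j x + partialDeriv j χ x • w n x =
        (χ x • (q n j x - G j x) + partialDeriv j χ x • (w n x - u x)) +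
          (χ x • G j x + partialDeriv j χ x • u x) := fun j => by
      simp only [smul_sub]; abel
    generalize fderiv ℝ F (χ x • w n x) = L at *
    rw [e 0, e 1, map_add L (_ + _) (_ + _), map_add L (χ x • (q n 1 x - G 1 x) + _) (_ + _)]
    ring
  have hzm : ∀ n, AEStronglyMeasurable (fun x => χ x • w n x) volume := fun n =>
    (hχc.smul (hw1 n).continuous).aestronglyMeasurable
  have hgm : ∀ {p v : Plane → ℂ} (j), AEStronglyMeasurable p volume →
      AEStronglyMeasurable v volume →
      AEStronglyMeasurable (fun x => χ x • p x + partialDeriv j χ x • v x) volume :=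
    fun j hp hv => (hχc.aestronglyMeasurable.smul hp).add
      ((hdχ j).aestronglyMeasurable.smul hv)
  have hdm : ∀ n j, AEStronglyMeasurable (fun x => q n j x - G j x) volume := fun n j =>
    (hqc n j).aestronglyMeasurable.sub (hGm j)
  have hvm : ∀ n, AEStronglyMeasurable (fun x => w n x - u x) volume := fun n =>
    (hw1 n).continuous.aestronglyMeasurable.sub hum
  have ham : ∀ n, AEStronglyMeasurable (a n) volume := fun n =>
    ((aestronglyMeasurable_fderiv_apply hF (hzm n) (hgm 0 (hdm n 0) (hvm n))).add
      ((aestronglyMeasurable_fderiv_apply hF (hzm n)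
        (hgm 1 (hdm n 1) (hvm n))).const_mul _)).const_mul _
  have hbm : ∀ n, AEStronglyMeasurable (b n) volume := fun n =>
    (((aestronglyMeasurable_fderiv_apply hF (hzm n) (hgm 0 (hGm 0) hum)).add
      ((aestronglyMeasurable_fderiv_apply hF (hzm n)
        (hgm 1 (hGm 1) hum)).const_mul _)).const_mul _).add
      (hωm.mul (hF.continuous.comp_aestronglyMeasurable (hzm n)))
  have ha0 : Tendsto (fun n => eLpNorm (a n) 2 volume) atTop (𝓝 0) := by
    have hle : ∀ n, eLpNorm (a n) 2 volume ≤ ENNReal.ofReal C *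
        (ENNReal.ofReal M₁ * (eLpNorm (fun x => q n 0 x - G 0 x) 2 volume +
          eLpNorm (fun x => q n 1 x - G 1 x) 2 volume) +
        ENNReal.ofReal (2 * M₂) * eLpNorm (fun x => w n x - u x) 2 volume) := fun n => by
      have h1 : eLpNorm (a n) 2 volume ≤ eLpNorm (C • (M₁ • ((fun x => ‖q n 0 x - G 0 x‖) +
          fun x => ‖q n 1 x - G 1 x‖) + (2 * M₂) • fun x => ‖w n x - u x‖)) 2 volume :=
        eLpNorm_mono_real fun x => norm_gradPart_le hs _ (hC _) (hM₁ x) (hb₀ x) (hb₁ x) _ _ _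
      refine h1.trans ?_
      rw [eLpNorm_const_smul, Real.enorm_eq_ofReal hC0]
      gcongr
      refine (eLpNorm_add_le (((hdm n 0).norm.add (hdm n 1).norm).const_smul _)
        ((hvm n).norm.const_smul _) (by norm_num)).trans ?_
      rw [eLpNorm_const_smul, eLpNorm_const_smul, Real.enorm_eq_ofReal hM₁0,
        Real.enorm_eq_ofReal (by positivity : (0 : ℝ) ≤ 2 * M₂), eLpNorm_norm]
      gcongr
      refine (eLpNorm_add_le (hdm n 0).norm (hdm n 1).norm (by norm_num)).trans ?_
      rw [eLpNorm_norm, eLpNorm_norm]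
    refine tendsto_of_tendsto_of_tendsto_of_le_of_le tendsto_const_nhds ?_ (fun _ => zero_le) hle
    have h1 := ENNReal.Tendsto.const_mul (a := ENNReal.ofReal M₁) ((hqL 0).add (hqL 1))
      (Or.inr ENNReal.ofReal_ne_top)
    have h2 := ENNReal.Tendsto.const_mul (a := ENNReal.ofReal (2 * M₂)) hwL
      (Or.inr ENNReal.ofReal_ne_top)
    have h3 := ENNReal.Tendsto.const_mul (a := ENNReal.ofReal C) (h1.add h2)
      (Or.inr ENNReal.ofReal_ne_top)
    simpa using h3
  have hb2 : Tendsto (fun n => eLpNorm (b n) 2 volume ^ 2) atTop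
      (𝓝 (eLpNorm (truncatedOp s A F χ u G) 2 volume ^ 2)) := by
    -- The potential term is bounded by `M‖A₁ + isA₂‖` on the compact support of `χ`, where the
    -- potential is square integrable, and vanishes elsewhere since `F 0 = 0`.
    set D : Plane → ℝ := fun x => C * (M₁ * (‖G 0 x‖ + ‖G 1 x‖) + 2 * M₂ * ‖u x‖) +
      (tsupport χ).indicator (fun x => ‖complexPotential s A x‖ * M) x
    have hDL : MemLp D 2 volume := by
      refine MemLp.add ?_ ?_
      · exact ((((hu.memLp_grad 0).norm.add (hu.memLp_grad 1).norm).const_mul M₁).add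
          (hu.memLp.norm.const_mul (2 * M₂))).const_mul C
      · rw [memLp_indicator_iff_restrict (isClosed_tsupport χ).measurableSet]
        exact (hωL2 _ hχs).norm.mul_const M
    refine tendsto_eLpNorm_two_of_dominated hbm hDL (fun n => ae_of_all _ fun x => ?_) ?_
    · refine (norm_add_le _ _).trans (add_le_add
        (norm_gradPart_le hs _ (hC _) (hM₁ x) (hb₀ x) (hb₁ x) _ _ _) ?_)
      by_cases hx : x ∈ tsupport χ
      · rw [Set.indicator_of_mem hx, norm_mul]
        gcongr
        exact hM _
      · rw [image_eq_zero_of_notMem_tsupport hx, zero_smul, hF0, mul_zero, norm_zero,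
          Set.indicator_of_notMem hx]
    · filter_upwards [hae] with x hx
      have hz : Tendsto (fun n => χ x • w n x) atTop (𝓝 (χ x • u x)) := hx.const_smul _
      have hL : Tendsto (fun n => fderiv ℝ F (χ x • w n x)) atTop (𝓝 (fderiv ℝ F (χ x • u x))) :=
        (hDF.tendsto (χ x • u x)).comp hz
      have hFz : Tendsto (fun n => F (χ x • w n x)) atTop (𝓝 (F (χ x • u x))) := (hF.continuous.tendsto (χ x • u x)).comp hz
      have hLv : ∀ v, Tendsto (fun n => fderiv ℝ F (χ x • w n x) v) atTop
          (𝓝 (fderiv ℝ F (χ x • u x) v)) := fun v =>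
        ((ContinuousLinearMap.apply ℝ ℂ v).continuous.tendsto _).comp hL
      exact (((hLv _).add ((hLv _).const_mul _)).const_mul _).add (hFz.const_mul _)
  have hb1 : Tendsto (fun n => eLpNorm (b n) 2 volume) atTop
      (𝓝 (eLpNorm (truncatedOp s A F χ u G) 2 volume)) := by
    have h := (ENNReal.continuous_rpow_const (y := (2 : ℝ)⁻¹)).tendsto _ |>.comp hb2
    have e : ∀ y : ℝ≥0∞, (y ^ 2) ^ (2 : ℝ)⁻¹ = y := fun y => by
      rw [← ENNReal.rpow_natCast, ← ENNReal.rpow_mul]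
      norm_num
    simpa only [Function.comp_def, e] using h
  have hlim : Tendsto (fun n => (eLpNorm (a n) 2 volume + eLpNorm (b n) 2 volume) ^ 2) atTop
      (𝓝 (eLpNorm (truncatedOp s A F χ u G) 2 volume ^ 2)) := by
    have h := (ENNReal.continuous_pow 2).tendsto _ |>.comp (ha0.add hb1)
    simpa only [Function.comp_def, zero_add] using h
  rw [← eLpNorm_two_sq]
  have hWm := measurable_radialWeight α ρ
  -- Fatou's lemma on the left suffices, so no integrability of the weighted `L²` mass is needed.
  refine lintegral_le_of_tendsto_ae (f := fun n x => ENNReal.ofReal ((k / K) ^ 2) *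
    ENNReal.ofReal (radialWeight α ρ ‖x‖ * ‖F (χ x • w n x)‖ ^ 2)) (fun n => ?_) ?_ hlim fun n => ?_
  · have h1 : Measurable fun x => F (χ x • w n x) :=
      (hF.continuous.comp (hχc.smul (hw1 n).continuous)).measurable
    have h2 : Measurable fun x : Plane => radialWeight α ρ ‖x‖ := hWm.comp measurable_norm
    exact ((h2.mul (h1.norm.pow_const 2)).ennreal_ofReal.const_mul _).aemeasurable
  · filter_upwards [hae] with x hx
    have hz : Tendsto (fun n => χ x • w n x) atTop (𝓝 (χ x • u x)) := hx.const_smul _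
    have hFz := (hF.continuous.tendsto (χ x • u x)).comp hz
    exact ENNReal.Tendsto.const_mul (ENNReal.tendsto_ofReal ((hFz.norm.pow 2).const_mul _))
      (Or.inr ENNReal.ofReal_ne_top)
  · have hφ1 : ContDiff ℝ 1 fun x => F (χ x • w n x) := hF.comp (hχ.smul (hw1 n))
    have hφs : HasCompactSupport fun x => F (χ x • w n x) :=
      hχs.mono fun x hx => by
        by_contra h
        rw [Function.notMem_support] at h
        exact hx (by simp only [h, zero_smul, hF0])
    have h := lintegral_smooth_le hB hA hρ hα hs hk hK hlow hupp hφ1 hφs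
    rw [lintegral_const_mul' _ _ ENNReal.ofReal_ne_top]
    refine h.trans ?_
    simp only [dbar_truncated s hF hχ (hw1 n) A, hq n]
    rw [← eLpNorm_two_sq, hab n]
    gcongr
    exact eLpNorm_add_le (ham n) (hbm n) (by norm_num)

lemma exists_truncation_one : ∃ f : ℂ → ℂ, ContDiff ℝ 1 f ∧ HasCompactSupport f ∧
    (∀ z, ‖f z‖ ≤ ‖z‖) ∧ ∀ z, ‖z‖ ≤ 1 → f z = z := by
  let b : ContDiffBump (0 : ℂ) := ⟨1, 2, one_pos, one_lt_two⟩
  refine ⟨fun z => b z • z, b.contDiff.smul contDiff_id, b.hasCompactSupport.smul_right,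
    fun z => ?_, fun z hz => ?_⟩
  · rw [norm_smul, Real.norm_of_nonneg b.nonneg]
    exact mul_le_of_le_one_left (norm_nonneg _) b.le_one
  · have h1 : z ∈ Metric.closedBall (0 : ℂ) b.rIn := mem_closedBall_zero_iff.2 hz
    simp only [b.one_of_mem_closedBall h1, one_smul]

/-- The functions are the rescalings `(n+1) f(z/(n+1))` of one truncation, and this scaling leaves
the derivative bound unchanged. -/
lemma exists_truncation : ∃ (F : ℕ → ℂ → ℂ) (C : ℝ), ∀ n, ContDiff ℝ 1 (F n) ∧
    HasCompactSupport (F n) ∧ (∀ z, ‖fderiv ℝ (F n) z‖ ≤ C) ∧ (∀ z, ‖F n z‖ ≤ ‖z‖) ∧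
    ∀ z, ‖z‖ < n + 1 → F n z = z := by
  obtain ⟨f, hf, hfs, hle, heq⟩ := exists_truncation_one
  obtain ⟨C, hC⟩ := (hfs.fderiv ℝ).exists_bound_of_continuous (hf.continuous_fderiv one_ne_zero)
  have hn : ∀ n : ℕ, (0 : ℝ) < n + 1 := fun n => n.cast_add_one_pos
  refine ⟨fun n z => ((n : ℝ) + 1) • f (((n : ℝ) + 1)⁻¹ • z), C, fun n => ⟨?_, ?_, ?_, ?_, ?_⟩⟩
  · exact (hf.comp (contDiff_const_smul _)).const_smul _
  · exact (hfs.comp_smul (inv_ne_zero (hn n).ne')).smul_left (f := fun _ => (n : ℝ) + 1)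
  · intro z
    have hd : DifferentiableAt ℝ (fun z => f (((n : ℝ) + 1)⁻¹ • z)) z :=
      ((hf.comp (contDiff_const_smul _)).differentiable one_ne_zero) z
    rw [fderiv_fun_const_smul hd, fderiv_comp_smul, smul_smul, mul_inv_cancel₀ (hn n).ne',
      one_smul]
    exact hC _
  · intro z
    have h := hle (((n : ℝ) + 1)⁻¹ • z)
    rw [norm_smul, norm_inv, Real.norm_of_nonneg (hn n).le, ← div_eq_inv_mul,
      le_div_iff₀' (hn n)] at h
    rwa [norm_smul, Real.norm_of_nonneg (hn n).le]
  · intro z hz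
    have h1 : ‖((n : ℝ) + 1)⁻¹ • z‖ ≤ 1 := by
      rw [norm_smul, norm_inv, Real.norm_of_nonneg (hn n).le, inv_mul_le_iff₀ (hn n), mul_one]
      exact hz.le
    simp only
    rw [heq _ h1, smul_smul, mul_inv_cancel₀ (hn n).ne', one_smul]

lemma exists_cutoff : ∃ (χ : ℕ → Plane → ℝ) (C : ℝ), ∀ n, ContDiff ℝ 1 (χ n) ∧
    HasCompactSupport (χ n) ∧ (∀ j x, |partialDeriv j (χ n) x| ≤ C) ∧ (∀ x, |χ n x| ≤ 1) ∧
    ∀ x, ‖x‖ < n + 1 → χ n x = 1 := by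
  let b : ContDiffBump (0 : Plane) := ⟨1, 2, one_pos, one_lt_two⟩
  have hb : ContDiff ℝ 1 b := b.contDiff
  obtain ⟨C, hC⟩ := (b.hasCompactSupport.fderiv ℝ).exists_bound_of_continuous
    (hb.continuous_fderiv one_ne_zero)
  have hn : ∀ n : ℕ, (0 : ℝ) < n + 1 := fun n => n.cast_add_one_pos
  refine ⟨fun n x => b (((n : ℝ) + 1)⁻¹ • x), C, fun n => ⟨?_, ?_, ?_, ?_, ?_⟩⟩
  · exact hb.comp (contDiff_const_smul _)
  · exact b.hasCompactSupport.comp_smul (inv_ne_zero (hn n).ne')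
  · intro j x
    rw [partialDeriv, fderiv_comp_smul, ← Real.norm_eq_abs]
    refine (ContinuousLinearMap.le_opNorm _ _).trans ?_
    rw [PiLp.norm_single, norm_one, mul_one, norm_smul, norm_inv,
      Real.norm_of_nonneg (hn n).le]
    have h1 : ((n : ℝ) + 1)⁻¹ ≤ 1 := inv_le_one_of_one_le₀ (by simp)
    calc _ ≤ 1 * C := by
          gcongr
          exact hC _
      _ = C := one_mul C
  · intro x
    rw [abs_of_nonneg b.nonneg]
    exact b.le_one
  · intro x hx
    refine b.one_of_mem_closedBall ?_
    rw [mem_closedBall_zero_iff, norm_smul, norm_inv, Real.norm_of_nonneg (hn n).le,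
      inv_mul_le_iff₀ (hn n), mul_one]
    exact hx.le

/-! ### Removal of the truncations -/

/-- The operator `i(∂₁ + i s ∂₂) + (A₁ + i s A₂)` applied to `u` with gradient `G`. -/
def pauliOp (s : ℤ) (A : Plane → Plane) (u : Plane → ℂ) (G : Fin 2 → Plane → ℂ) (x : Plane) : ℂ :=
  Complex.I * (G 0 x + Complex.I * s * G 1 x) + complexPotential s A x * u x

/-- The Hardy inequality for the factors of the Pauli operator on `H¹`. -/
theorem lintegral_radialWeight_le_pauliOp {B : Plane → ℝ} (hB : IsAdmissibleField B)
    {A : Plane → Plane} (hA : IsVectorPotential A B) {α ρ : ℝ} (hρ : 0 < ρ) (hα : α ≠ 0) {s : ℤ}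
    (hs : s = 1 ∨ s = -1) {k K : ℝ} (hk : 0 < k) (hK : 0 < K)
    (hlow : ∀ x, k * growth |α| ρ ‖x‖ ≤ Real.exp (s * scalarPotential B x))
    (hupp : ∀ x, Real.exp (s * scalarPotential B x) ≤ K * growth |α| ρ ‖x‖)
    {u : Plane → ℂ} {G : Fin 2 → Plane → ℂ} (hu : IsH1WithGradient u G) :
    ∫⁻ x, ENNReal.ofReal ((k / K) ^ 2) * ENNReal.ofReal (radialWeight α ρ ‖x‖ * ‖u x‖ ^ 2) ≤
      ∫⁻ x, ‖pauliOp s A u G x‖ₑ ^ 2 := by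
  have hum := hu.memLp.1
  have hGm : ∀ j, AEStronglyMeasurable (G j) volume := fun j => (hu.memLp_grad j).1
  have hωm : AEStronglyMeasurable (complexPotential s A) volume :=
    ((memLpLoc_complexPotential hA.memLpLoc s).locallyIntegrable (by norm_num)).aestronglyMeasurable
  have hTm : AEStronglyMeasurable (pauliOp s A u G) volume :=
    (((hGm 0).add ((hGm 1).const_mul _)).const_mul _).add (hωm.mul hum)
  rw [← eLpNorm_two_sq]
  -- An infinite right side leaves nothing to prove. In the finite case the gradient part is in
  -- `L²`, hence so is `(A₁ + isA₂)u`, which supplies the majorant for dominated convergence.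
  by_cases hfin : eLpNorm (pauliOp s A u G) 2 volume = ⊤
  · rw [hfin]
    simp
  have hT : MemLp (pauliOp s A u G) 2 volume := ⟨hTm, lt_top_iff_ne_top.2 hfin⟩
  have hωu : MemLp (fun x => complexPotential s A x * u x) 2 volume := by
    have h := hT.sub (((hu.memLp_grad 0).add ((hu.memLp_grad 1).const_mul
      (Complex.I * s))).const_mul Complex.I)
    refine h.ae_eq (ae_of_all _ fun x => ?_)
    simp [pauliOp]
  obtain ⟨F, C, hF⟩ := exists_truncation
  obtain ⟨χ, M, hχ⟩ := exists_cutoff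
  have hC0 : 0 ≤ C := (norm_nonneg _).trans ((hF 0).2.2.1 0)
  have hM0 : 0 ≤ M := (abs_nonneg _).trans ((hχ 0).2.2.1 0 0)
  have hev : ∀ x, ∀ᶠ n : ℕ in atTop, ‖x‖ < n + 1 ∧ ‖u x‖ < n + 1 := fun x => by
    obtain ⟨N, hN⟩ := exists_nat_gt (max ‖x‖ ‖u x‖)
    filter_upwards [eventually_ge_atTop N] with n hn
    have h1 : (N : ℝ) ≤ n := Nat.cast_le.2 hn
    constructor
    · linarith [le_max_left ‖x‖ ‖u x‖]
    · linarith [le_max_right ‖x‖ ‖u x‖]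
  have hval : ∀ {n : ℕ} {x : Plane}, ‖x‖ < n + 1 → ‖u x‖ < n + 1 → F n (χ n x • u x) = u x :=
    fun {n x} h1 h2 => by
      rw [(hχ n).2.2.2.2 x h1, one_smul, (hF n).2.2.2.2 _ h2]
  -- The strict inequalities make `χ n = 1` near `x` and `F n = id` near `u x`, so the derivatives
  -- are exactly those of the untruncated expression.
  have hop : ∀ {n : ℕ} {x : Plane}, ‖x‖ < n + 1 → ‖u x‖ < n + 1 →
      truncatedOp s A (F n) (χ n) u G x = pauliOp s A u G x := fun {n x} h1 h2 => by
    have hd : ∀ j, partialDeriv j (χ n) x = 0 := fun j => by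
      have h : χ n =ᶠ[𝓝 x] fun _ => 1 := by
        filter_upwards [(continuous_norm.tendsto x).eventually (gt_mem_nhds h1)] with y hy
        exact (hχ n).2.2.2.2 y hy
      rw [partialDeriv, h.fderiv_eq]
      simp
    have hDF : fderiv ℝ (F n) (u x) = ContinuousLinearMap.id ℝ ℂ := by
      have h : F n =ᶠ[𝓝 (u x)] id := by
        filter_upwards [(continuous_norm.tendsto (u x)).eventually (gt_mem_nhds h2)] with y hy
        exact (hF n).2.2.2.2 y hy
      rw [h.fderiv_eq, fderiv_id]
    rw [truncatedOp, hval h1 h2, hd, hd, (hχ n).2.2.2.2 x h1, pauliOp]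
    simp [hDF]
  have hFn0 : ∀ n, F n 0 = 0 := fun n => (hF n).2.2.2.2 0 (by simpa using n.cast_add_one_pos)
  have hzm : ∀ n, AEStronglyMeasurable (fun x => χ n x • u x) volume := fun n =>
    (hχ n).1.continuous.aestronglyMeasurable.smul hum
  have hgm : ∀ n j, AEStronglyMeasurable
      (fun x => χ n x • G j x + partialDeriv j (χ n) x • u x) volume := fun n j =>
    ((hχ n).1.continuous.aestronglyMeasurable.smul (hGm j)).add
      ((continuous_partialDeriv (hχ n).1 j).aestronglyMeasurable.smul hum)
  have hFm : ∀ n, AEStronglyMeasurable (fun x => F n (χ n x • u x)) volume := fun n =>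
    (hF n).1.continuous.comp_aestronglyMeasurable (hzm n)
  have hlim : Tendsto (fun n => eLpNorm (truncatedOp s A (F n) (χ n) u G) 2 volume ^ 2) atTop
      (𝓝 (eLpNorm (pauliOp s A u G) 2 volume ^ 2)) := by
    refine tendsto_eLpNorm_two_of_dominated
      (b := fun x => C * (1 * (‖G 0 x‖ + ‖G 1 x‖) + 2 * M * ‖u x‖) +
        ‖complexPotential s A x * u x‖) (fun n => ?_) ?_ (fun n => ae_of_all _ fun x => ?_)
      (ae_of_all _ fun x => ?_)
    · exact (((aestronglyMeasurable_fderiv_apply (hF n).1 (hzm n) (hgm n 0)).add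
        ((aestronglyMeasurable_fderiv_apply (hF n).1 (hzm n) (hgm n 1)).const_mul _)).const_mul
          _).add (hωm.mul (hFm n))
    · exact (((((hu.memLp_grad 0).norm.add (hu.memLp_grad 1).norm).const_mul 1).add
          (hu.memLp.norm.const_mul (2 * M))).const_mul C).add hωu.norm
    · refine (norm_add_le _ _).trans (add_le_add
        (norm_gradPart_le hs _ ((hF n).2.2.1 _) ((hχ n).2.2.2.1 x) ((hχ n).2.2.1 0 x)
          ((hχ n).2.2.1 1 x) _ _ _) ?_)
      rw [norm_mul, norm_mul]
      gcongr
      refine ((hF n).2.2.2.1 _).trans ?_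
      rw [norm_smul, Real.norm_eq_abs]
      exact mul_le_of_le_one_left (norm_nonneg _) ((hχ n).2.2.2.1 x)
    · refine tendsto_const_nhds.congr' ?_
      filter_upwards [hev x] with n hn
      exact (hop hn.1 hn.2).symm
  refine lintegral_le_of_tendsto_ae (f := fun n x => ENNReal.ofReal ((k / K) ^ 2) *
    ENNReal.ofReal (radialWeight α ρ ‖x‖ * ‖F n (χ n x • u x)‖ ^ 2)) (fun n => ?_)
    (ae_of_all _ fun x => ?_) hlim fun n => ?_
  · have h2 : Measurable fun x : Plane => radialWeight α ρ ‖x‖ :=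
      (measurable_radialWeight α ρ).comp measurable_norm
    exact ((h2.aemeasurable.mul ((hFm n).norm.aemeasurable.pow_const 2)).ennreal_ofReal.const_mul _)
  · refine tendsto_const_nhds.congr' ?_
    filter_upwards [hev x] with n hn
    rw [hval hn.1 hn.2]
  · rw [eLpNorm_two_sq]
    exact lintegral_truncated_le hB hA hρ hα hs hk hK hlow hupp hu (hF n).1 (hF n).2.1 (hFn0 n)
      (hχ n).1 (hχ n).2.1

/-! ### Conclusion -/

/-- With `σ = sign α` the exponent `σα` is `|α|`, so both signs of the flux lead to one increasing
weight. -/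
lemma comparison_sign {B : Plane → ℝ} (hα : flux B ≠ 0) {ρ : ℝ} (hρ : 0 < ρ) (r : ℝ) :
    comparison B (SignType.sign (flux B)) ρ r = growth |flux B| ρ r := by
  unfold comparison growth
  split_ifs with h
  · rfl
  · have hr : 0 < r := hρ.trans (not_le.1 h)
    have e : ρ ^ (-flux B) * r ^ flux B = (r / ρ) ^ flux B := by
      rw [Real.div_rpow hr.le hρ.le, Real.rpow_neg hρ.le, div_eq_inv_mul]
    rw [e]
    rcases lt_or_gt_of_ne hα with h0 | h0
    · rw [sign_neg h0, abs_of_neg h0, Real.rpow_neg (by positivity)]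
      simp
    · rw [sign_pos h0, abs_of_pos h0]
      simp

lemma hardyWeight_eq (B : Plane → ℝ) (σ : SignType) (ρ : ℝ) (x : Plane) :
    hardyWeight B σ ρ x = beta B σ ρ * radialWeight (flux B) ρ ‖x‖ := rfl

/-- A real supremum over an unbounded family has the default value `0`, and so does the quotient by
it. Thus `β ≠ 0` already forces the supremum to be finite and the infimum positive, and no
asymptotics of `h` are required. -/
lemma expRatio_bounds {B : Plane → ℝ} {σ : SignType} {ρ : ℝ} (hpos : ∀ x, 0 < expRatio B σ ρ x)
    (hβ : beta B σ ρ ≠ 0) : 0 < lowerConst B σ ρ ∧ 0 < upperConst B σ ρ ∧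
      ∀ x, lowerConst B σ ρ ≤ expRatio B σ ρ x ∧ expRatio B σ ρ x ≤ upperConst B σ ρ := by
  have hq : lowerConst B σ ρ / upperConst B σ ρ ≠ 0 := fun h => hβ (by rw [beta, h]; simp)
  obtain ⟨h1, h2⟩ := div_ne_zero_iff.1 hq
  have hl : 0 < lowerConst B σ ρ :=
    lt_of_le_of_ne (Real.iInf_nonneg fun x => (hpos x).le) (Ne.symm h1)
  have hb : BddAbove (Set.range (expRatio B σ ρ)) := by
    by_contra h
    exact h2 (Real.iSup_of_not_bddAbove h)
  have hb' : BddBelow (Set.range (expRatio B σ ρ)) := ⟨0, by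
    rintro _ ⟨x, rfl⟩
    exact (hpos x).le⟩
  have hx : ∀ x, lowerConst B σ ρ ≤ expRatio B σ ρ x ∧ expRatio B σ ρ x ≤ upperConst B σ ρ :=
    fun x => ⟨ciInf_le hb' x, le_ciSup hb x⟩
  exact ⟨hl, hl.trans_le ((hx 0).1.trans (hx 0).2), hx⟩

lemma lintegral_pauliOp_le {A : Plane → Plane} {s : ℤ} (hs : s = 1 ∨ s = -1) (u : Plane → ℂ)
    (G : Fin 2 → Plane → ℂ) :
    (1 / 2 : ℝ≥0∞) * ∫⁻ x, ‖pauliOp s A u G x‖ₑ ^ 2 ≤ magneticEnergy A u G := by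
  have e : (1 / 2 : ℝ≥0∞) = ENNReal.ofReal (1 / 2) := by
    rw [ENNReal.ofReal_div_of_pos two_pos]
    simp
  rw [e, ← lintegral_const_mul' _ _ ENNReal.ofReal_ne_top, magneticEnergy]
  refine lintegral_mono fun x => ?_
  rw [← ofReal_norm_sq, ← ENNReal.ofReal_mul (by norm_num), Fin.sum_univ_two]
  refine ENNReal.ofReal_le_ofReal ?_
  set p := Complex.I * G 0 x + (A x 0 : ℂ) * u x
  set q := Complex.I * G 1 x + (A x 1 : ℂ) * u x
  have h : pauliOp s A u G x = p + Complex.I * s * q := by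
    simp only [pauliOp, complexPotential, p, q]
    ring
  have hsn : ‖Complex.I * (s : ℂ)‖ = 1 := by rcases hs with rfl | rfl <;> simp
  have hn : ‖p + Complex.I * s * q‖ ≤ ‖p‖ + ‖q‖ := by
    refine (norm_add_le _ _).trans_eq ?_
    rw [norm_mul, hsn, one_mul]
  rw [h]
  have := pow_le_pow_left₀ (norm_nonneg _) hn 2
  nlinarith [sq_nonneg (‖p‖ - ‖q‖)]

/-- The Hardy inequality for the magnetic Dirichlet form with non-zero flux. -/
theorem hardy_inequality {B : Plane → ℝ} (hB : IsAdmissibleField B) {A : Plane → Plane}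
    (hA : IsVectorPotential A B) (hα : flux B ≠ 0) {u : Plane → ℂ} {G : Fin 2 → Plane → ℂ}
    (hu : IsH1WithGradient u G) {ρ : ℝ} (hρ : 0 < ρ) :
    (1 / 2 : ℝ≥0∞) * ∫⁻ x, ENNReal.ofReal
        (hardyWeight B (SignType.sign (flux B)) ρ x * ‖u x‖ ^ 2) ≤ magneticEnergy A u G := by
  set σ := SignType.sign (flux B) with hσ
  -- If `β = 0`, which includes the default values for degenerate `k` or `K`, the weight vanishes
  -- identically.
  by_cases hβ : beta B σ ρ = 0
  · simp [hardyWeight_eq, hβ]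
  -- The choice `s = -σ` makes `exp(sh)` the numerator of the quotient that defines `k` and `K`.
  have hs : (-(σ : ℤ) : ℤ) = 1 ∨ (-(σ : ℤ) : ℤ) = -1 := by
    rcases lt_or_gt_of_ne hα with h0 | h0
    · left
      rw [hσ, sign_neg h0]
      rfl
    · right
      rw [hσ, sign_pos h0]
      rfl
  have hcast : (((-(σ : ℤ) : ℤ)) : ℝ) = -(σ : ℝ) := by
    rcases lt_or_gt_of_ne hα with h0 | h0
    · rw [hσ, sign_neg h0]
      simp
    · rw [hσ, sign_pos h0]
      simp
  have hg : ∀ x : Plane, 0 < growth |flux B| ρ ‖x‖ := fun x => growth_pos _ hρ _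
  have hR : ∀ x, expRatio B σ ρ x =
      Real.exp ((-(σ : ℤ) : ℤ) * scalarPotential B x) / growth |flux B| ρ ‖x‖ := fun x => by
    rw [expRatio, hσ, comparison_sign hα hρ, ← hσ, hcast]
  obtain ⟨hk, hK, hb⟩ := expRatio_bounds (fun x => by
    rw [hR]
    exact div_pos (Real.exp_pos _) (hg x)) hβ
  have hmain := lintegral_radialWeight_le_pauliOp hB hA hρ hα hs hk hK
    (fun x => (le_div_iff₀ (hg x)).1 (hR x ▸ (hb x).1))
    (fun x => (div_le_iff₀ (hg x)).1 (hR x ▸ (hb x).2)) hu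
  refine le_trans (mul_le_mul_right ?_ _) (lintegral_pauliOp_le hs u G)
  refine le_trans (le_of_eq (lintegral_congr fun x => ?_)) hmain
  rw [← ENNReal.ofReal_mul (sq_nonneg _), hardyWeight_eq, beta, mul_assoc]

end MagneticHardy

end

theorem corollary2p9 (B : MagneticHardy.Plane → ℝ) (hB : MagneticHardy.IsAdmissibleField B)
    (A : MagneticHardy.Plane → MagneticHardy.Plane) (hA : MagneticHardy.IsVectorPotential A B)
    (hα : MagneticHardy.flux B ≠ 0)
    (u : MagneticHardy.Plane → ℂ) (G : Fin 2 → MagneticHardy.Plane → ℂ)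
    (hu : MagneticHardy.IsH1WithGradient u G) (ρ : ℝ) (hρ : 0 < ρ) :
    (1 / 2 : ℝ≥0∞) * ∫⁻ x, ENNReal.ofReal
        (MagneticHardy.hardyWeight B (SignType.sign (MagneticHardy.flux B)) ρ x * ‖u x‖ ^ 2) ≤
      MagneticHardy.magneticEnergy A u G :=
  MagneticHardy.hardy_inequality hB hA hα hu hρ
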